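/- Let $d\ge 1$, $\alpha\in(0,1)$, and let $\Omega\subset\mathbb R^d$ be a piecewise $C^{2,\alpha}$-piecewise convex domain: $\Omega$ is a Lipschitz domain, $\partial\Omega=\bigcup_{n=1}^N\overline{\Gamma}_n$, and each $\Gamma_n$ has zero $d$-dimensional Lebesgue measure, is locally the graph of a $C^{2,\alpha}$ function, and is contained in a level set of a convex $C^{2,\alpha}$ function $\varphi_n$ (defined on an open convex set containing $\Gamma_n$) such that $\nabla\varphi_n/|\nabla\varphi_n|$ is the unit outward normal on $\Gamma_n$. Let $\mathscr T_h$ be a finite mesh of pairwise disjoint open elements $K\subset\Omega$ with $\bigcup_{K}\overline K=\overline\Omega$, hanging nodes being allowed. Each $K$ is a possibly curved simplex or parallelepiped, i.e. $K=F_K(\hat K)$, where $\hat K$ is the open unit simplex or unit cube, $F_K(\hat x)=\tilde B_K\hat x+\tilde b_K+\Phi_K(\hat x)$, $\tilde B_K$ is invertible, $\Phi_K$ is $C^1$ up to the boundary of $\hat K$, and $\sup_{\hat K}\|D\Phi_K\tilde B_K^{-1}\|<1$. A face $F$ of $K$ is a nonempty relatively open piece of the image under $F_K$ of one open facet of $\hat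 K$ which is either contained in the image of an open facet of another element (interior face), or contained in a single $\Gamma_n$ (boundary face). Interior faces are assumed to be flat, i.e. contained in a hyperplane. For $s\ge0$ let $H^s(K)$ be the Sobolev–Slobodeckij space, and let $\tau_F$ be the trace operator onto $F$, i.e. the extension by continuity, from $H^\sigma(K)$ with $\sigma>1/2$ to $L^2(F)$, of the restriction of smooth functions to $F$ (applied to vector fields and matrices componentwise). For $t_1,\dots,t_{d-1}$ an orthonormal basis of the tangent space of $F$ at the point considered, let $$\nabla_{\mathbf T}u=\sum_{i=1}^{d-1}t_i\,\frac{\partial u}{\partial t_i},\qquad \operatorname{div}_{\mathbf T}w=\sum_{i=1}^{d-1}t_i\cdot\frac{\partial w}{\partial t_i}$$ denote the (weak) tangential gradient and the (weak) tangential divergence of a tangential field $w$ on $F$. Then, for each $K\in\mathscr T_h$ and each face $F$ of $K$, the unit normal $n_F$ to $F$ pointing out of $K$ exists, and so does the mean curvature $\mathcal H_F=(\nabla\cdot n_F)|_F$, where $n_F$ is extended to a $C^1$ field of unit vectors near $F$ (the value does not depend on the extension). Moreover, all the traces and weak tangential derivatives below exist, and almost everywhere on $F$ with respect to surface measure $$\tau_F(\nabla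 v)=\nabla_{\mathbf T}(\tau_Fv)+\Big(\tau_F\frac{\partial v}{\partial n_F}\Big)n_F\qquad\forall v\in H^s(K),\ s>3/2,$$ $$\tau_F(\Delta v)=\operatorname{div}_{\mathbf T}\nabla_{\mathbf T}(\tau_Fv)+\mathcal H_F\Big(\tau_F\frac{\partial v}{\partial n_F}\Big)+\tau_F\frac{\partial}{\partial n_F}(\nabla v\cdot n_F)\qquad\forall v\in H^s(K),\ s>5/2.$$ Here $\tau_F\frac{\partial v}{\partial n_F}=n_F\cdot\tau_F(\nabla v)$ and $\tau_F\frac{\partial}{\partial n_F}(\nabla v\cdot n_F)=n_F^{T}\,\tau_F(D^2v)\,n_F$; that is, $n_F$ is kept fixed when $\nabla v\cdot n_F$ is differentiated in the normal direction. -/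

import Mathlib

open Set Filter Topology MeasureTheory
open scoped NNReal ENNReal ContDiff

noncomputable section

/-- Euclidean space `ℝ^d`. -/
abbrev Euc (d : ℕ) : Type := EuclideanSpace ℝ (Fin d)

/-- The `i`-th standard basis vector of `ℝ^d`. -/
def stdVec {d : ℕ} (i : Fin d) : Euc d := EuclideanSpace.single i (1 : ℝ)

/-! ### Domains -/

/-- `f` is of class `C^{k,α}` on the open set `D`. -/
def IsHolderC {d : ℕ} (k : ℕ) (α : ℝ≥0) (f : Euc d → ℝ) (D : Set (Euc d)) : Prop :=
  ContDiffOn ℝ k f D ∧ ∃ C : ℝ≥0, HolderOnWith C α (iteratedFDeriv ℝ k f) D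

/-- A Lipschitz domain: open, connected, and near each boundary point, after a rotation, the set
below the graph of a Lipschitz function. The direction `ν` plays the role of the vertical axis, and
`y - ⟪y, ν⟫ ν` is the horizontal part of `y`. -/
structure IsLipschitzDomain {d : ℕ} (Ω : Set (Euc d)) : Prop where
  isOpen : IsOpen Ω
  isConnected : IsConnected Ω
  local_graph : ∀ x ∈ frontier Ω, ∃ (ν : Euc d) (r : ℝ) (L : ℝ≥0) (ψ : Euc d → ℝ),
    ‖ν‖ = 1 ∧ 0 < r ∧ LipschitzWith L ψ ∧
    Ω ∩ Metric.ball x r =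
      {y ∈ Metric.ball x r | inner ℝ y ν < ψ (y - (inner ℝ y ν) • ν)}

/-- `Γ` is locally the graph of a `C^{k,α}` function. -/
def IsLocallyHolderGraph {d : ℕ} (k : ℕ) (α : ℝ≥0) (Γ : Set (Euc d)) : Prop :=
  ∀ x ∈ Γ, ∃ (ν : Euc d) (r : ℝ) (ψ : Euc d → ℝ), ‖ν‖ = 1 ∧ 0 < r ∧ IsHolderC k α ψ univ ∧
    Γ ∩ Metric.ball x r =
      {y ∈ Metric.ball x r | inner ℝ y ν = ψ (y - (inner ℝ y ν) • ν)}

/-- The direction `ν` points out of `Ω` at `x`. -/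
def PointsOutward {d : ℕ} (Ω : Set (Euc d)) (x ν : Euc d) : Prop :=
  ∀ᶠ t : ℝ in 𝓝[>] 0, x - t • ν ∈ Ω ∧ x + t • ν ∉ Ω

/-- `Ω` is a piecewise `C^{k,α}`-piecewise convex domain with boundary portions `Γ 0, …, Γ (N-1)`:
a Lipschitz domain whose boundary is the union of the closures of the `Γ n`, where each `Γ n` is
Lebesgue null, is locally a `C^{k,α}` graph, and lies in a level set of a convex `C^{k,α}` function
`φ` for which `∇φ / |∇φ|` is the unit outward normal on `Γ n`. -/
structure IsPiecewiseConvexDomain {d : ℕ} (k : ℕ) (α : ℝ≥0) (Ω : Set (Euc d)) {N : ℕ}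
    (Γ : Fin N → Set (Euc d)) : Prop where
  lipschitz : IsLipschitzDomain Ω
  frontier_eq : frontier Ω = ⋃ n, closure (Γ n)
  null : ∀ n, volume (Γ n) = 0
  graph : ∀ n, IsLocallyHolderGraph k α (Γ n)
  convex : ∀ n, ∃ (D : Set (Euc d)) (φ : Euc d → ℝ) (c : ℝ),
    IsOpen D ∧ Γ n ⊆ D ∧ ConvexOn ℝ D φ ∧ IsHolderC k α φ D ∧
    ∀ x ∈ Γ n, φ x = c ∧ gradient φ x ≠ 0 ∧
      PointsOutward Ω x (‖gradient φ x‖⁻¹ • gradient φ x)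

/-! ### Curved elements, meshes and faces -/

/-- The two types of reference cells. -/
inductive RefCell where
  | simplex
  | cube

/-- The open reference cell: the unit simplex or the unit cube. -/
def RefCell.interior (d : ℕ) : RefCell → Set (Euc d)
  | .simplex => {x | (∀ i, 0 < x i) ∧ ∑ i, x i < 1}
  | .cube => {x | ∀ i, 0 < x i ∧ x i < 1}

/-- `S` is a relatively open `(d-1)`-dimensional face of the reference cell. -/
def RefCell.IsFacet {d : ℕ} : RefCell → Set (Euc d) → Prop
  | .simplex, S =>
      (∃ i, S = {x | x i = 0 ∧ (∀ j, j ≠ i → 0 < x j) ∧ ∑ j, x j < 1}) ∨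
      S = {x | (∀ j, 0 < x j) ∧ ∑ j, x j = 1}
  | .cube, S =>
      ∃ i, ∃ c : ℝ, (c = 0 ∨ c = 1) ∧ S = {x | x i = c ∧ ∀ j, j ≠ i → 0 < x j ∧ x j < 1}

/-- A possibly curved simplex or parallelepiped: the image of a reference cell under
`F_K = B x + b + Φ x`, with `B` invertible, `Φ` of class `C^1` up to the boundary of the reference
cell, and `sup ‖DΦ B⁻¹‖ < 1`. -/
structure CurvedElement (d : ℕ) where
  cell : RefCell
  B : Euc d ≃L[ℝ] Euc d
  b : Euc d
  Φ : Euc d → Euc d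
  contDiffOn : ContDiffOn ℝ 1 Φ (closure (cell.interior d))
  small : ∃ C : ℝ, C < 1 ∧ ∀ x ∈ cell.interior d,
    ‖(fderiv ℝ Φ x).comp (B.symm : Euc d →L[ℝ] Euc d)‖ ≤ C

namespace CurvedElement

variable {d : ℕ}

/-- The element map `F_K`. -/
def map (K : CurvedElement d) (x : Euc d) : Euc d := K.B x + K.b + K.Φ x

/-- The (open) element, as a set. -/
def carrier (K : CurvedElement d) : Set (Euc d) := K.map '' K.cell.interior d

/-- `S` is a (curved, relatively open) facet of the element. -/
def IsFacet (K : CurvedElement d) (S : Set (Euc d)) : Prop :=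
  ∃ S₀, K.cell.IsFacet S₀ ∧ S = K.map '' S₀

end CurvedElement

/-- `F` is a nonempty relatively open piece of a facet of `K`. With hanging nodes a face of the mesh
need not be a whole facet of the element. -/
def IsFacetPiece {d : ℕ} (K : CurvedElement d) (F : Set (Euc d)) : Prop :=
  F.Nonempty ∧ ∃ S O, K.IsFacet S ∧ IsOpen O ∧ F = S ∩ O

/-- `F` is an interior face of `K`, shared with the element `K'`. -/
def IsInteriorFace {d : ℕ} (K K' : CurvedElement d) (F : Set (Euc d)) : Prop :=
  IsFacetPiece K F ∧ ∃ S', K'.IsFacet S' ∧ F ⊆ S'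

/-- The elements `T 0, …, T (M-1)` form an exact mesh on `Ω`, hanging nodes being allowed. Only
boundary faces may be curved: interior faces are flat. -/
structure IsMesh {d : ℕ} (Ω : Set (Euc d)) {M : ℕ} (T : Fin M → CurvedElement d) : Prop where
  subset : ∀ k, (T k).carrier ⊆ Ω
  disjoint : ∀ k l, k ≠ l → Disjoint (T k).carrier (T l).carrier
  exact : ⋃ k, closure (T k).carrier = closure Ω
  flat : ∀ k l, k ≠ l → ∀ F, IsInteriorFace (T k) (T l) F →
    ∃ (ν : Euc d) (c : ℝ), ‖ν‖ = 1 ∧ ∀ x ∈ F, inner ℝ x ν = c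

/-- `F` is a face of the element `T k` in the mesh: either an interior face, shared with another
element, or a boundary face, which is contained in a single boundary portion `Γ n`. -/
def IsMeshFace {d : ℕ} {N M : ℕ} (Γ : Fin N → Set (Euc d)) (T : Fin M → CurvedElement d)
    (k : Fin M) (F : Set (Euc d)) : Prop :=
  (∃ l, k ≠ l ∧ IsInteriorFace (T k) (T l) F) ∨ (IsFacetPiece (T k) F ∧ ∃ n, F ⊆ Γ n)

/-! ### Sobolev spaces and traces -/

/-- `w` is the weak partial derivative `∂_i v` on the open set `U`. -/
def HasWeakPartial {d : ℕ} (U : Set (Euc d)) (i : Fin d) (v w : Euc d → ℝ) : Prop :=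
  LocallyIntegrableOn v U volume ∧ LocallyIntegrableOn w U volume ∧
  ∀ φ : Euc d → ℝ, ContDiff ℝ ∞ φ → HasCompactSupport φ → tsupport φ ⊆ U →
    ∫ x in U, v x * fderiv ℝ φ x (stdVec i) = - ∫ x in U, w x * φ x

/-- The square of the Gagliardo (Sobolev–Slobodeckij) seminorm of order `σ ∈ (0,1)` on `U`. -/
def gagliardoSq {d : ℕ} (U : Set (Euc d)) (σ : ℝ) (v : Euc d → ℝ) : ℝ≥0∞ :=
  ∫⁻ x in U, ∫⁻ y in U, ENNReal.ofReal ((v x - v y) ^ 2 / ‖x - y‖ ^ ((d : ℝ) + 2 * σ))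

/-- Membership in `H^{k+σ}(U)`, where `k ∈ ℕ` and `σ ∈ [0,1)`: the weak derivatives up to order `k`
are in `L²(U)`, and if `σ > 0` those of order `k` have finite Gagliardo seminorm of order `σ`. -/
def MemSlobodeckij {d : ℕ} (U : Set (Euc d)) (σ : ℝ) : ℕ → (Euc d → ℝ) → Prop
  | 0, v => MemLp v 2 (volume.restrict U) ∧ (0 < σ → gagliardoSq U σ v < ⊤)
  | k + 1, v => MemLp v 2 (volume.restrict U) ∧
      ∀ i, ∃ w, HasWeakPartial U i v w ∧ MemSlobodeckij U σ k w

/-- `v ∈ H^s(U)` for real `s ≥ 0`. -/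
def MemHs {d : ℕ} (U : Set (Euc d)) (s : ℝ) (v : Euc d → ℝ) : Prop :=
  MemSlobodeckij U (Int.fract s) ⌊s⌋₊ v

/-- The square of the norm of `H^σ(U)`, for `σ ∈ (0,1)`. -/
def fracNormSq {d : ℕ} (U : Set (Euc d)) (σ : ℝ) (v : Euc d → ℝ) : ℝ≥0∞ :=
  (∫⁻ x in U, ENNReal.ofReal (v x ^ 2)) + gagliardoSq U σ v

/-- The surface measure on a hypersurface `F` of `ℝ^{m+1}`. -/
def surf {m : ℕ} (F : Set (Euc (m + 1))) : Measure (Euc (m + 1)) :=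
  (μHE[m] : Measure (Euc (m + 1))).restrict F

/-- `g` is the trace `τ_F v` on `F ⊆ ∂K`. The trace operator is the extension by continuity of the
restriction `φ ↦ φ|_F` of smooth functions, from the norm of `H^σ(K)`, `1/2 < σ < 1`, to the norm
of `L²(F)`. -/
def HasTrace {m : ℕ} (K F : Set (Euc (m + 1))) (v g : Euc (m + 1) → ℝ) : Prop :=
  MemLp v 2 (volume.restrict K) ∧ MemLp g 2 (surf F) ∧
  ∃ σ : ℝ, 1 / 2 < σ ∧ σ < 1 ∧ ∃ φ : ℕ → Euc (m + 1) → ℝ,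
    (∀ n, ContDiff ℝ ∞ (φ n) ∧ HasCompactSupport (φ n)) ∧
    Tendsto (fun n => fracNormSq K σ (fun x => φ n x - v x)) atTop (𝓝 0) ∧
    Tendsto (fun n => eLpNorm (fun x => φ n x - g x) 2 (surf F)) atTop (𝓝 0)

/-- Componentwise trace of a vector field `(w_i)`. -/
def HasVectorTrace {m : ℕ} (K F : Set (Euc (m + 1)))
    (w : Fin (m + 1) → Euc (m + 1) → ℝ) (G : Euc (m + 1) → Euc (m + 1)) : Prop :=
  ∀ i, HasTrace K F (w i) (fun x => G x i)

/-! ### Geometry of faces and tangential operators -/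

/-- `n` is the unit normal to `F` that points out of `K`. -/
def IsOutwardUnitNormal {d : ℕ} (K F : Set (Euc d)) (n : Euc d → Euc d) : Prop :=
  ∀ x ∈ F, ‖n x‖ = 1 ∧ (∀ t ∈ tangentConeAt ℝ F x, inner ℝ (n x) t = 0) ∧ PointsOutward K x (n x)

/-- `H = (∇ · n)|_F` is the mean curvature of `F`, where the divergence is that of an extension of
the unit normal `n` to a `C^1` unit vector field on a neighbourhood of `F`. -/
def IsMeanCurvature {d : ℕ} (F : Set (Euc d)) (n : Euc d → Euc d) (H : Euc d → ℝ) : Prop :=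
  ∃ (U : Set (Euc d)) (N : Euc d → Euc d), IsOpen U ∧ F ⊆ U ∧ ContDiffOn ℝ 1 N U ∧
    (∀ x ∈ U, ‖N x‖ = 1) ∧ (∀ x ∈ F, N x = n x) ∧
    ∀ x ∈ F, H x = ∑ i, (fderiv ℝ N x (stdVec i)) i

/-- `T` is the weak tangential gradient `∇_T u` of `u : F → ℝ`: a tangential field such that in each
regular local parametrization `X` of `F` one has `∂_a (u ∘ X) = T ∘ X · ∂_a X` weakly. Thus
`T = ∑ t_i ∂u/∂t_i` for orthonormal tangent vectors `t_i`. -/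
def HasTangentialGradient {m : ℕ} (F : Set (Euc (m + 1))) (n : Euc (m + 1) → Euc (m + 1))
    (u : Euc (m + 1) → ℝ) (T : Euc (m + 1) → Euc (m + 1)) : Prop :=
  (∀ᵐ x ∂(surf F), inner ℝ (T x) (n x) = 0) ∧
  ∀ (U : Set (Euc m)) (X : Euc m → Euc (m + 1)), IsOpen U → ContDiffOn ℝ 1 X U →
    (∀ p ∈ U, Function.Injective (fderiv ℝ X p)) → MapsTo X U F →
    ∀ a, HasWeakPartial U a (fun p => u (X p))
      (fun p => inner ℝ (T (X p)) (fderiv ℝ X p (stdVec a)))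

/-- `h` is the weak tangential divergence `div_T w` of the tangential field `w` on `F`: the trace
of the matrix whose rows are the tangential gradients `A j = ∇_T w_j` of the components. In
orthonormal tangent vectors `t_i` this is `∑ t_i · ∂w/∂t_i`. -/
def HasTangentialDivergence {m : ℕ} (F : Set (Euc (m + 1))) (n w : Euc (m + 1) → Euc (m + 1))
    (h : Euc (m + 1) → ℝ) : Prop :=
  (∀ᵐ x ∂(surf F), inner ℝ (w x) (n x) = 0) ∧
  ∃ A : Fin (m + 1) → Euc (m + 1) → Euc (m + 1),
    (∀ j, HasTangentialGradient F n (fun x => w x j) (A j)) ∧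
    ∀ᵐ x ∂(surf F), h x = ∑ j, A j x j

/-- The trace `τ_F (∂v/∂n) = n · τ_F (∇v)` of the normal derivative, where `G = τ_F (∇v)`. -/
def normalDeriv {d : ℕ} (n G : Euc d → Euc d) (x : Euc d) : ℝ := inner ℝ (n x) (G x)

/-- The trace of `∂/∂n (∇v · n)`, that is `n · τ_F (D²v) n`, where `M i = τ_F (∇ ∂_i v)`; the normal
`n` is kept fixed (extended constantly in the normal direction) when `∇v · n` is differentiated. -/
def secondNormalDeriv {d : ℕ} (n : Euc d → Euc d) (M : Fin d → Euc d → Euc d) (x : Euc d) : ℝ :=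
  ∑ i, normalDeriv n (M i) x * n x i

end

/-!
# Traces of gradients and Laplacians on the faces of a curved mesh

**Geometry.** The map of a curved element is a contractive perturbation of an invertible affine map,
so it is a `C¹` map of a convex cell, with invertible derivative and bi-Lipschitz up to the boundary
(`RegularMap`). Linearizing it shows that the element has an interior cone at every point of its
closure (`RegularMap.interiorCone`). A face is a relatively open piece of the image of a flat facet;
its unit normal is the normalised image of the facet normal under the inverse transpose of the
derivative (`RegularMap.exists_unit_normal`), and the facet provides a single bi-Lipschitz chart of
the face (`RegularFace.exists_globalChart`). The normal extends to a `C¹` unit field: `∇φ / |∇φ|`, for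
the level set function `φ` of a boundary portion, on boundary faces, and a locally constant field on
flat interior faces (`IsMeshFace.exists_isMeanCurvature`).

**Traces.** For `σ > 1/2` the averages of a smooth function over balls of radius `r₀ / 2 ^ j` centred
on the face form a series whose increments decay geometrically in `L²` of the face, with bounds in
terms of the `H^σ` norm on the element; this gives the trace inequality
(`exists_trace_inequality`). Localizing and averaging along interior cones shows that smooth
functions are dense in `H^σ` (`IsConeDomain.exists_smooth_approx`). Traces therefore exist and are
unique. As the definition of a trace asks for an order `σ < 1`, functions of order at least one are
first shown to have fractional derivatives of every such order (`RegularMap.gagliardoSq_lt_top`).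

**First identity.** Let `f` have the weak gradient `Df`, and let both have traces. Near a point of
the face, averages of `f` along one cone are smooth up to the face, their partial derivatives are
the averages of `Df`, and both converge in `L²` of the face to the traces. The chain rule in a chart
passes to the limit: the trace of `Df` is the gradient of the trace of `f` in every chart
(`HasTrace.hasChartGradient`). Removing the normal component gives a weak tangential gradient,
and there is only one, because the derivatives of the global chart together with the normal span the
space (`HasTangentialGradient.unique`).

**Second identity.** Let `G` and `Q i` be the traces of `∇v` and of `∇∂_i v`, and let `N` be a `C¹` unit
extension of the normal `n`. The result above, applied to each `∂_i v`, says that `Q i` is the chart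
gradient of `G i`; by the Leibniz rule the components of the tangential part `G - ⟪N, G⟫ N` have chart
gradients too (`HasChartGradient.tangentialPart`). The tangential divergence of that field is the trace
of its derivative minus the normal-normal entry. Since `|N| = 1` gives `∑ k, N_k ∂_i N_k = 0`, what
remains is `∑ i, Q i i - (div N) ⟪n, G⟫ - nᵀ Q n` (`sum_eq_divergence_add`, `sum_trace_eq`), and
`∑ i, Q i i` is the trace of the Laplacian.
-/

noncomputable section

/-! ### Interior cones and regular maps of convex sets -/

/-- Uniform interior cone property of `K` near `p` with axis `w`: for all points `x` of the closure
of `K` near `p`, small balls around `x + t • w`, of radius proportional to `t`, lie in `K`.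
The single parameter `r` bounds the neighbourhood, the height and the aperture of the cones. -/
structure InteriorCone {d : ℕ} (K : Set (Euc d)) (p w : Euc d) (r : ℝ) : Prop where
  pos : 0 < r
  subset : ∀ x ∈ closure K, dist x p < r → ∀ t : ℝ, 0 < t → t ≤ r →
    Metric.closedBall (x + t • w) (r * t) ⊆ K

theorem InteriorCone.of_smul {d : ℕ} {K : Set (Euc d)} {p w : Euc d} {r s : ℝ} (hs : 0 < s)
    (h : InteriorCone K p (s • w) r) : ∃ r', InteriorCone K p w r' := by
  have hr := h.pos
  refine ⟨min r (min (r * s) (r / s)), by positivity, fun x hx hxp t ht htr => ?_⟩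
  have h1 := h.subset x hx (hxp.trans_le (min_le_left _ _)) (t / s) (by positivity)
    ((div_le_iff₀ hs).2 (htr.trans ((min_le_right _ _).trans (min_le_left _ _))))
  rw [smul_smul, div_mul_cancel₀ _ hs.ne'] at h1
  refine (Metric.closedBall_subset_closedBall ?_).trans h1
  calc min r (min (r * s) (r / s)) * t ≤ (r / s) * t := by
        gcongr; exact (min_le_right _ _).trans (min_le_right _ _)
    _ = r * (t / s) := by ring

/-- `f` is an injective `C^1` map, up to the boundary, of the bounded open convex set `C`, with
derivative `A`; it expands distances at least by `κ` and at most by `L`. -/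
structure RegularMap {d : ℕ} (f : Euc d → Euc d) (A : Euc d → Euc d →L[ℝ] Euc d)
    (C : Set (Euc d)) (κ L : ℝ) : Prop where
  isOpen : IsOpen C
  convex : Convex ℝ C
  bounded : Bornology.IsBounded C
  deriv : ∀ x ∈ closure C, HasFDerivWithinAt f (A x) (closure C) x
  cont : ContinuousOn A (closure C)
  pos : 0 < κ
  lower : ∀ x ∈ closure C, ∀ y ∈ closure C, κ * ‖x - y‖ ≤ ‖f x - f y‖
  upper : ∀ x ∈ closure C, ∀ y ∈ closure C, ‖f x - f y‖ ≤ L * ‖x - y‖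
  lowerA : ∀ x ∈ closure C, ∀ h, κ * ‖h‖ ≤ ‖A x h‖

namespace RegularMap

variable {d : ℕ} {f : Euc d → Euc d} {A : Euc d → Euc d →L[ℝ] Euc d} {C : Set (Euc d)} {κ L : ℝ}

theorem continuousOn (h : RegularMap f A C κ L) : ContinuousOn f (closure C) :=
  fun x hx => (h.deriv x hx).continuousWithinAt

theorem injOn (h : RegularMap f A C κ L) : InjOn f (closure C) := by
  intro x hx y hy hxy
  have := h.lower x hx y hy
  rw [hxy, sub_self, norm_zero] at this
  have h2 : ‖x - y‖ ≤ 0 := by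
    by_contra! h3
    nlinarith [h.pos, mul_pos h.pos h3]
  exact sub_eq_zero.1 (norm_le_zero_iff.1 h2)

theorem isCompact_closure (h : RegularMap f A C κ L) : IsCompact (closure C) :=
  h.bounded.isCompact_closure

theorem closure_image (h : RegularMap f A C κ L) : closure (f '' C) = f '' closure C := by
  apply subset_antisymm
  · exact closure_minimal (image_mono subset_closure)
      (h.isCompact_closure.image_of_continuousOn h.continuousOn).isClosed
  · exact h.continuousOn.image_closure

theorem exists_equiv (h : RegularMap f A C κ L) {p : Euc d} (hp : p ∈ closure C) :
    ∃ e : Euc d ≃L[ℝ] Euc d, (e : Euc d →L[ℝ] Euc d) = A p := by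
  have hinj : Function.Injective (A p : Euc d →ₗ[ℝ] Euc d) := by
    rw [injective_iff_map_eq_zero]
    intro a ha
    have := h.lowerA p hp a
    have ha' : A p a = 0 := ha
    rw [ha', norm_zero] at this
    have h2 : ‖a‖ ≤ 0 := by
      by_contra! h3
      nlinarith [h.pos, mul_pos h.pos h3]
    exact norm_le_zero_iff.1 h2
  refine ⟨(LinearEquiv.ofInjectiveEndo _ hinj).toContinuousLinearEquiv, ?_⟩
  ext x : 1
  rfl

theorem exists_approximatesLinearOn (h : RegularMap f A C κ L) {p : Euc d} (hp : p ∈ closure C)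
    {c : ℝ≥0} (hc : 0 < c) :
    ∃ ρ > 0, ApproximatesLinearOn f (A p) (closure C ∩ Metric.ball p ρ) c := by
  obtain ⟨ρ, hρ, hρc⟩ := Metric.continuousWithinAt_iff.1 (h.cont p hp) c (by exact_mod_cast hc)
  refine ⟨ρ, hρ, fun x hx y hy => ?_⟩
  have hconv : Convex ℝ (closure C ∩ Metric.ball p ρ) := h.convex.closure.inter (convex_ball _ _)
  have := hconv.norm_image_sub_le_of_norm_hasFDerivWithin_le (𝕜 := ℝ) (f := fun z => f z - A p z)
    (f' := fun z => A z - A p) (C := c) (fun z hz =>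
      ((h.deriv z hz.1).sub (A p).hasFDerivWithinAt).mono inter_subset_left)
    (fun z hz => by
      have := hρc hz.1 hz.2
      rw [dist_eq_norm] at this
      exact this.le) hy hx
  simpa [map_sub, sub_sub_sub_comm] using this

theorem surjOn_closedBall (h : RegularMap f A C κ L) {p : Euc d} (hp : p ∈ closure C) {c : ℝ≥0}
    {s : Set (Euc d)} (hs : ApproximatesLinearOn f (A p) s c) {b : Euc d} {ε : ℝ} (hε : 0 ≤ ε)
    (hb : Metric.closedBall b ε ⊆ s) :
    SurjOn f (Metric.closedBall b ε) (Metric.closedBall (f b) ((κ - c) * ε)) := by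
  obtain ⟨e, he⟩ := h.exists_equiv hp
  have hκ := h.pos
  let N : (A p).NonlinearRightInverse :=
    { toFun := e.symm
      nnnorm := ⟨κ⁻¹, by positivity⟩
      bound' := fun y => by
        have := h.lowerA p hp (e.symm y)
        rw [← he] at this
        simp only [ContinuousLinearEquiv.coe_coe, ContinuousLinearEquiv.apply_symm_apply] at this
        change ‖e.symm y‖ ≤ κ⁻¹ * ‖y‖
        rwa [inv_mul_eq_div, le_div_iff₀' hκ]
      right_inv' := fun y => by rw [← he]; simp }
  have := hs.surjOn_closedBall_of_nonlinearRightInverse N hε hb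
  have hN : ((N.nnnorm : ℝ)⁻¹) = κ := by change (κ⁻¹)⁻¹ = κ; simp
  rwa [hN] at this

/-- The image of a convex set under a regular map has the interior cone property: the linear
approximation maps small balls around `x + t • w` onto sets containing balls of comparable
radius. -/
theorem interiorCone (h : RegularMap f A C κ L) {p w : Euc d} (hp : p ∈ closure C)
    (hw : p + w ∈ C) : ∃ r, InteriorCone (f '' C) (f p) (A p w) r := by
  have hκ := h.pos
  obtain ⟨η₀, hη₀, hball⟩ := Metric.nhds_basis_closedBall.mem_iff.1 (h.isOpen.mem_nhds hw)
  set η := η₀ / 3 with hηd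
  have hη : 0 < η := by positivity
  -- `c` bounds the linearization error: `c ≤ κ / 2` keeps `f` quantitatively onto, and `c * ‖w‖` has
  -- to be small against the radius `κ * η` that `f` covers at unit height
  set c : ℝ := min (κ / 2) (κ * η / (2 * (‖w‖ + 1))) with hcd
  have hc : 0 < c := by positivity
  have hc1 : c ≤ κ / 2 := min_le_left _ _
  have hc2 : c * ‖w‖ ≤ κ * η / 2 := by
    calc c * ‖w‖ ≤ κ * η / (2 * (‖w‖ + 1)) * (‖w‖ + 1) := by
          gcongr
          · exact min_le_right _ _
          · linarith
      _ = κ * η / 2 := by field_simp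
  obtain ⟨ρ, hρ, happ⟩ := h.exists_approximatesLinearOn hp (c := ⟨c, hc.le⟩) hc
  set r : ℝ := min (min 1 (κ * η / 2)) (min (κ * (ρ / 2) / 2) (ρ / (2 * (‖w‖ + 2 * η + 1))))
    with hrd
  have hr : 0 < r := by positivity
  have hr1 : r ≤ 1 := (min_le_left _ _).trans (min_le_left _ _)
  have hr2 : r ≤ κ * η / 2 := (min_le_left _ _).trans (min_le_right _ _)
  have hr3 : r ≤ κ * (ρ / 2) / 2 := (min_le_right _ _).trans (min_le_left _ _)
  have hr4 : r ≤ ρ / (2 * (‖w‖ + 2 * η + 1)) := (min_le_right _ _).trans (min_le_right _ _)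
  refine ⟨r, hr, ?_⟩
  rw [h.closure_image]
  rintro _ ⟨x, hx, rfl⟩ hxp t ht htr
  have hxp' : ‖x - p‖ < r / κ := by
    rw [lt_div_iff₀ hκ, mul_comm]
    exact (h.lower x hx p hp).trans_lt (by rwa [dist_eq_norm] at hxp)
  have hxη : ‖x - p‖ < η := hxp'.trans_le (by
    rw [div_le_iff₀ hκ]; nlinarith [mul_pos hκ hη])
  have hxρ : ‖x - p‖ < ρ / 2 := hxp'.trans_le (by
    rw [div_le_iff₀ hκ]; nlinarith [mul_pos hκ hρ])
  have htρ : t * (‖w‖ + 2 * η) < ρ / 2 := by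
    have h1 : t * (‖w‖ + 2 * η + 1) ≤ ρ / 2 := by
      have := htr.trans hr4
      rw [le_div_iff₀ (by positivity)] at this
      linarith
    nlinarith
  -- the balls around `x + t • w` in the reference domain
  have hbC : Metric.closedBall (x + t • w) (2 * η * t) ⊆ C := by
    intro y hy
    rw [mem_closedBall_iff_norm] at hy
    have hy' : x + t⁻¹ • (y - x) ∈ C := by
      apply hball
      rw [mem_closedBall_iff_norm]
      have h1 : x + t⁻¹ • (y - x) - (p + w) = (x - p) + t⁻¹ • (y - (x + t • w)) := by
        rw [← sub_sub y, smul_sub t⁻¹ (y - x), smul_smul, inv_mul_cancel₀ ht.ne', one_smul]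
        abel
      rw [h1]
      calc _ ≤ ‖x - p‖ + t⁻¹ * ‖y - (x + t • w)‖ := by
            refine (norm_add_le _ _).trans ?_
            rw [norm_smul, Real.norm_of_nonneg (by positivity)]
        _ ≤ η + t⁻¹ * (2 * η * t) := by gcongr
        _ = η₀ := by rw [hηd]; field_simp; ring
    -- `y` is a convex combination of `x` and a point near `p + w`, with weights `1 - t` and `t`
    have := h.convex.combo_closure_interior_mem_interior hx (y := x + t⁻¹ • (y - x))
      (by rwa [h.isOpen.interior_eq]) (a := 1 - t) (b := t) (by linarith) ht (by ring)
    rw [h.isOpen.interior_eq] at this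
    convert this using 1
    rw [smul_add, smul_smul, mul_inv_cancel₀ ht.ne', sub_smul, one_smul, one_smul]
    abel
  have hbS : Metric.closedBall (x + t • w) (2 * η * t) ⊆ closure C ∩ Metric.ball p ρ := by
    refine fun y hy => ⟨subset_closure (hbC hy), ?_⟩
    rw [mem_closedBall_iff_norm] at hy
    rw [mem_ball_iff_norm]
    have h1 : y - p = (y - (x + t • w)) + (x - p) + t • w := by abel
    calc ‖y - p‖ ≤ ‖y - (x + t • w)‖ + ‖x - p‖ + ‖t • w‖ := by
          rw [h1]; exact norm_add₃_le
      _ ≤ 2 * η * t + ρ / 2 + t * ‖w‖ := by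
          rw [norm_smul, Real.norm_of_nonneg ht.le]; gcongr
      _ < ρ := by nlinarith
  have hsurj := h.surjOn_closedBall hp happ (by positivity) hbS
  have hxS : x ∈ closure C ∩ Metric.ball p ρ :=
    ⟨hx, by rw [mem_ball_iff_norm]; linarith⟩
  have hdist := happ (x + t • w) (hbS (Metric.mem_closedBall_self (by positivity))) x hxS
  rw [add_sub_cancel_left, norm_smul, Real.norm_of_nonneg ht.le, map_smul] at hdist
  change _ ≤ c * _ at hdist
  change SurjOn f _ (Metric.closedBall _ ((κ - c) * _)) at hsurj
  intro y hy
  have hy2 : y ∈ Metric.closedBall (f (x + t • w)) ((κ - c) * (2 * η * t)) := by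
    rw [mem_closedBall_iff_norm] at hy ⊢
    have h1 : y - f (x + t • w) = (y - (f x + t • A p w)) - (f (x + t • w) - f x - t • A p w) := by
      abel
    rw [h1]
    have h5 : (0 : ℝ) < η * t := by positivity
    calc _ ≤ r * t + c * (t * ‖w‖) := (norm_sub_le _ _).trans (add_le_add hy hdist)
      _ ≤ κ * η / 2 * t + κ * η / 2 * t := by nlinarith
      _ ≤ (κ - c) * (2 * η * t) := by nlinarith
  obtain ⟨z, hz, rfl⟩ := hsurj hy2
  exact ⟨z, hbC hz, rfl⟩

theorem isOpen_image (h : RegularMap f A C κ L) : IsOpen (f '' C) := by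
  rw [isOpen_iff_mem_nhds]
  rintro _ ⟨p, hp, rfl⟩
  have hκ := h.pos
  obtain ⟨ρ, hρ, happ⟩ := h.exists_approximatesLinearOn (subset_closure hp)
    (c := ⟨κ / 2, by positivity⟩) (by change (0 : ℝ) < κ / 2; positivity)
  obtain ⟨ε, hε, hball⟩ := Metric.nhds_basis_closedBall.mem_iff.1
    (inter_mem (h.isOpen.mem_nhds hp) (Metric.ball_mem_nhds p hρ))
  have := h.surjOn_closedBall (subset_closure hp) happ hε.le
    (fun y hy => ⟨subset_closure (hball hy).1, (hball hy).2⟩)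
  refine mem_of_superset (Metric.closedBall_mem_nhds _ ?_)
    (this.trans (image_mono fun y hy => (hball hy).1))
  change 0 < (κ - κ / 2) * ε
  nlinarith [mul_pos hκ hε]

theorem hasFDerivWithinAt_inverse (h : RegularMap f A C κ L) {p : Euc d} (hp : p ∈ closure C)
    {g : Euc d → Euc d} (hg : LeftInvOn g f (closure C)) {e : Euc d ≃L[ℝ] Euc d}
    (he : (e : Euc d →L[ℝ] Euc d) = A p) :
    HasFDerivWithinAt g (e.symm : Euc d →L[ℝ] Euc d) (f '' closure C) (f p) := by
  have hκ := h.pos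
  have hgp : g (f p) = p := hg hp
  refine HasFDerivWithinAt.of_local_left_inverse (f := f) (t := closure C) ?_ ?_
    (mem_image_of_mem _ hp) ?_
  · rw [hgp]
    refine tendsto_nhdsWithin_iff.2 ⟨?_, ?_⟩
    · rw [Metric.tendsto_nhdsWithin_nhds]
      intro ε hε
      refine ⟨κ * ε, by positivity, ?_⟩
      rintro _ ⟨x, hx, rfl⟩ hd
      rw [hg hx, dist_eq_norm]
      rw [dist_eq_norm] at hd
      have := (h.lower x hx p hp).trans_lt hd
      exact lt_of_mul_lt_mul_left this hκ.le
    · filter_upwards [self_mem_nhdsWithin]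
      rintro _ ⟨x, hx, rfl⟩
      rwa [hg hx]
  · rw [hgp, he]
    exact h.deriv p hp
  · filter_upwards [self_mem_nhdsWithin]
    rintro _ ⟨x, hx, rfl⟩
    rw [hg hx]

end RegularMap

/-! ### Flat facets and the outward normal of their images -/

/-- `S` is a flat open piece of the boundary of `C`: in the open set `O`, the set `C` is the
half-space `⟪ν, x⟫ < c` and `S` the hyperplane `⟪ν, x⟫ = c`. -/
structure FlatFacet {d : ℕ} (C S O : Set (Euc d)) (ν : Euc d) (c : ℝ) : Prop where
  isOpen : IsOpen O
  ne : ν ≠ 0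
  inside : C = O ∩ {x | inner ℝ ν x < c}
  facet : S = O ∩ {x | inner ℝ ν x = c}

namespace FlatFacet

variable {d : ℕ} {C S O : Set (Euc d)} {ν : Euc d} {c : ℝ}

theorem eventually_add_smul_mem (hS : FlatFacet C S O ν c) {p w : Euc d} (hp : p ∈ S)
    (hw : inner ℝ ν w < 0) : ∀ᶠ s : ℝ in 𝓝[>] 0, p + s • w ∈ C := by
  rw [hS.facet] at hp
  have hcont : Continuous fun s : ℝ => p + s • w := by fun_prop
  have h1 : ∀ᶠ s : ℝ in 𝓝[>] 0, p + s • w ∈ O :=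
    (hcont.continuousAt.eventually_mem (by simpa using hS.isOpen.mem_nhds hp.1)).filter_mono
      nhdsWithin_le_nhds
  filter_upwards [h1, self_mem_nhdsWithin] with s hs1 hs0
  rw [hS.inside]
  refine ⟨hs1, ?_⟩
  have : inner ℝ ν p = c := hp.2
  rw [mem_ofPred_eq, inner_add_right, inner_smul_right, this]
  have : s * inner ℝ ν w < 0 := mul_neg_of_pos_of_neg hs0 hw
  linarith

theorem subset_closure (hS : FlatFacet C S O ν c) : S ⊆ closure C := by
  intro p hp
  have h1 := hS.eventually_add_smul_mem hp (w := -ν) (by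
    rw [inner_neg_right, real_inner_self_eq_norm_sq]
    have := norm_pos_iff.2 hS.ne
    nlinarith)
  have h2 : Tendsto (fun s : ℝ => p + s • -ν) (𝓝[>] 0) (𝓝 p) := by
    have : Continuous fun s : ℝ => p + s • -ν := by fun_prop
    have := this.tendsto 0
    simp only [zero_smul, add_zero] at this
    exact this.mono_left nhdsWithin_le_nhds
  exact mem_closure_of_tendsto h2 h1

end FlatFacet

namespace RegularMap

variable {d : ℕ} {f : Euc d → Euc d} {A : Euc d → Euc d →L[ℝ] Euc d} {C : Set (Euc d)} {κ L : ℝ}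
  {S O : Set (Euc d)} {ν : Euc d} {c : ℝ}

/-- At a point of a facet the image has an interior cone in the direction of every vector that the
derivative maps from a strictly inward one. -/
theorem interiorCone_of_inward (h : RegularMap f A C κ L) (hS : FlatFacet C S O ν c)
    {p w : Euc d} (hp : p ∈ S) (hw : inner ℝ ν w < 0) :
    ∃ r, InteriorCone (f '' C) (f p) (A p w) r := by
  obtain ⟨s, hs, hs0⟩ := ((hS.eventually_add_smul_mem hp hw).and self_mem_nhdsWithin).exists
  obtain ⟨r, hr⟩ := h.interiorCone (hS.subset_closure hp) hs
  rw [map_smul] at hr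
  exact hr.of_smul hs0

theorem hasFDerivWithinAt_level (h : RegularMap f A C κ L) {g : Euc d → Euc d}
    (hg : LeftInvOn g f (closure C)) {p : Euc d} (hp : p ∈ closure C) {e : Euc d ≃L[ℝ] Euc d}
    (he : (e : Euc d →L[ℝ] Euc d) = A p) (ν : Euc d) :
    HasFDerivWithinAt (fun y => inner ℝ ν (g y))
      ((innerSL ℝ ν).comp (e.symm : Euc d →L[ℝ] Euc d)) (f '' closure C) (f p) :=
  (innerSL ℝ ν).hasFDerivAt.comp_hasFDerivWithinAt (f p) (h.hasFDerivWithinAt_inverse hp hg he)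

/-- Directions whose preimage under the derivative points strictly out of the facet leave the image
at once: to first order `⟪ν, f⁻¹⟫` increases along them from the value `c`, while it is less than `c`
on the image of `C`. -/
theorem eventually_add_smul_notMem (h : RegularMap f A C κ L) (hS : FlatFacet C S O ν c)
    {p y : Euc d} (hp : p ∈ S) {e : Euc d ≃L[ℝ] Euc d} (he : (e : Euc d →L[ℝ] Euc d) = A p)
    (hy : 0 < inner ℝ ν (e.symm y)) : ∀ᶠ t : ℝ in 𝓝[>] 0, f p + t • y ∉ f '' C := by
  have hpC := hS.subset_closure hp
  obtain ⟨g, hg⟩ : ∃ g : Euc d → Euc d, LeftInvOn g f (closure C) :=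
    ⟨Function.invFunOn f (closure C), h.injOn.leftInvOn_invFunOn⟩
  have hd := h.hasFDerivWithinAt_level hg hpC he ν
  have hypos : 0 < ‖y‖ + 1 := by positivity
  have h1 := (hasFDerivWithinAt_iff_isLittleO.1 hd).def
    (show 0 < inner ℝ ν (e.symm y) / (‖y‖ + 1) by positivity)
  rw [eventually_nhdsWithin_iff] at h1
  have hcont : Tendsto (fun t : ℝ => f p + t • y) (𝓝[>] 0) (𝓝 (f p)) := by
    have : Continuous fun s : ℝ => f p + s • y := by fun_prop
    have := this.tendsto 0
    simp only [zero_smul, add_zero] at this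
    exact this.mono_left nhdsWithin_le_nhds
  filter_upwards [hcont.eventually h1, self_mem_nhdsWithin] with t ht ht0 hmem
  have ht0' : (0 : ℝ) < t := ht0
  have h2 := ht (image_mono _root_.subset_closure hmem)
  obtain ⟨x, hx, hxe⟩ := hmem
  rw [← hxe, hg (_root_.subset_closure hx), hg hpC, hxe] at h2
  simp only [add_sub_cancel_left, map_smul, smul_eq_mul, norm_smul, Real.norm_of_nonneg ht0'.le,
    ContinuousLinearMap.comp_apply, innerSL_apply_apply, ContinuousLinearEquiv.coe_coe] at h2
  rw [hS.facet] at hp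
  rw [hS.inside] at hx
  have hp2 : inner ℝ ν p = c := hp.2
  have hx2 : inner ℝ ν x < c := hx.2
  have h3 := (abs_le.1 h2).1
  have h4 : inner ℝ ν (e.symm y) / (‖y‖ + 1) * (t * ‖y‖) ≤ t * inner ℝ ν (e.symm y) := by
    rw [div_mul_eq_mul_div, div_le_iff₀ hypos]
    nlinarith [mul_pos ht0' hy, norm_nonneg y]
  linarith

/-- The function `⟪ν, f⁻¹⟫` is constant on the image of the facet, so its derivative annihilates the
tangent cone. -/
theorem inner_tangent_eq_zero (h : RegularMap f A C κ L) (hS : FlatFacet C S O ν c)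
    {p y : Euc d} (hp : p ∈ S) {e : Euc d ≃L[ℝ] Euc d} (he : (e : Euc d →L[ℝ] Euc d) = A p)
    (hy : y ∈ tangentConeAt ℝ (f '' S) (f p)) : inner ℝ ν (e.symm y) = 0 := by
  have hpC := hS.subset_closure hp
  obtain ⟨g, hg⟩ : ∃ g : Euc d → Euc d, LeftInvOn g f (closure C) :=
    ⟨Function.invFunOn f (closure C), h.injOn.leftInvOn_invFunOn⟩
  have hd := (h.hasFDerivWithinAt_level hg hpC he ν).mono (image_mono hS.subset_closure)
  have hval : ∀ z ∈ f '' S, inner ℝ ν (g z) = c := by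
    rintro _ ⟨x, hx, rfl⟩
    rw [hg (hS.subset_closure hx)]
    rw [hS.facet] at hx
    exact hx.2
  have hd0 : HasFDerivWithinAt (fun y => inner ℝ ν (g y)) (0 : Euc d →L[ℝ] ℝ) (f '' S) (f p) :=
    (hasFDerivWithinAt_const c (f p) (f '' S)).congr hval (hval _ (mem_image_of_mem f hp))
  exact hd.unique_on hd0 hy

/-- Tangent vectors of the facet are mapped to the tangent cone of any relatively open piece of its
image; this is what makes the normal direction unique. -/
theorem map_mem_tangentConeAt (h : RegularMap f A C κ L) (hS : FlatFacet C S O ν c)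
    {O' : Set (Euc d)} (hO' : IsOpen O') {p w : Euc d} (hp : p ∈ S) (hpO : f p ∈ O')
    (hw : inner ℝ ν w = 0) : A p w ∈ tangentConeAt ℝ (f '' S ∩ O') (f p) := by
  have hd := (h.deriv p (hS.subset_closure hp)).mono hS.subset_closure
  rw [tangentConeAt_inter_nhds (hO'.mem_nhds hpO)]
  refine hd.mapsTo_tangent_cone ?_
  rw [hS.facet] at hp ⊢
  rw [inter_comm, tangentConeAt_inter_nhds (hS.isOpen.mem_nhds hp.1)]
  refine mem_tangentConeAt_of_add_smul_mem (l := 𝓝[≠] (0 : ℝ)) (c := fun t : ℝ => t)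
    tendsto_id ?_
  refine Eventually.of_forall fun t => ?_
  have : inner ℝ ν p = c := hp.2
  simp [inner_add_right, inner_smul_right, this, hw]

/-- The normalised image of `ν` under the inverse transpose of the derivative is a unit outward
normal of the image of the facet, its negative is the axis of an interior cone, and up to sign it is
the only unit vector that annihilates the tangent cone. -/
theorem exists_unit_normal (h : RegularMap f A C κ L) (hS : FlatFacet C S O ν c)
    {p : Euc d} (hp : p ∈ S) :
    ∃ m : Euc d, ‖m‖ = 1 ∧ (∀ t ∈ tangentConeAt ℝ (f '' S) (f p), inner ℝ m t = 0) ∧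
      PointsOutward (f '' C) (f p) m ∧ (∃ r, InteriorCone (f '' C) (f p) (-m) r) ∧
      ∀ O', IsOpen O' → f p ∈ O' → ∀ y : Euc d, ‖y‖ = 1 →
        (∀ t ∈ tangentConeAt ℝ (f '' S ∩ O') (f p), inner ℝ y t = 0) → y = m ∨ y = -m := by
  have hpC := hS.subset_closure hp
  obtain ⟨e, he⟩ := h.exists_equiv hpC
  set Ai : Euc d →L[ℝ] Euc d := (e.symm : Euc d →L[ℝ] Euc d) with hAi
  set n₀ := ContinuousLinearMap.adjoint Ai ν with hn₀
  have hin : ∀ y, inner ℝ n₀ y = inner ℝ ν (e.symm y) := fun y =>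
    ContinuousLinearMap.adjoint_inner_left Ai y ν
  have hn₀ne : n₀ ≠ 0 := by
    intro h0
    have := hin (e ν)
    rw [h0, inner_zero_left, e.symm_apply_apply, real_inner_self_eq_norm_sq] at this
    have h2 := norm_pos_iff.2 hS.ne
    nlinarith
  have hn₀pos := norm_pos_iff.2 hn₀ne
  have hpos : 0 < inner ℝ ν (e.symm (‖n₀‖⁻¹ • n₀)) := by
    rw [← hin, inner_smul_right, real_inner_self_eq_norm_sq]
    positivity
  obtain ⟨r, hr⟩ := h.interiorCone_of_inward hS (w := e.symm (-(‖n₀‖⁻¹ • n₀))) hp (by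
    rw [map_neg, inner_neg_right]; linarith)
  have hr' : InteriorCone (f '' C) (f p) (-(‖n₀‖⁻¹ • n₀)) r := by
    rw [← he] at hr
    simpa using hr
  refine ⟨‖n₀‖⁻¹ • n₀, ?_, ?_, ?_, ⟨r, hr'⟩, ?_⟩
  · rw [norm_smul, norm_inv, norm_norm, inv_mul_cancel₀ hn₀pos.ne']
  · intro t ht
    rw [inner_smul_left, hin, h.inner_tangent_eq_zero hS hp he ht, mul_zero]
  · have h1 := h.eventually_add_smul_notMem hS hp he hpos
    have h2 : ∀ᶠ t : ℝ in 𝓝[>] 0, t ∈ Ioc 0 r := Ioc_mem_nhdsGT hr'.pos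
    filter_upwards [h1, h2] with t ht1 ht2
    refine ⟨?_, ht1⟩
    apply hr'.subset (f p) (by rw [h.closure_image]; exact mem_image_of_mem f hpC)
      (by simpa using hr'.pos) t ht2.1 ht2.2
    rw [smul_neg, ← sub_eq_add_neg]
    exact Metric.mem_closedBall_self (by have := hr'.pos; have := ht2.1; positivity)
  · intro O' hO' hpO y hy1 hyt
    set u := ContinuousLinearMap.adjoint (A p) y with hu
    have hu0 : ∀ w, inner ℝ ν w = 0 → inner ℝ u w = 0 := fun w hw => by
      rw [hu, ContinuousLinearMap.adjoint_inner_left]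
      exact hyt _ (h.map_mem_tangentConeAt hS hO' hp hpO hw)
    have hνpos := norm_pos_iff.2 hS.ne
    set lam := inner ℝ ν u / ‖ν‖ ^ 2 with hlam
    have h1 : inner ℝ ν (u - lam • ν) = 0 := by
      rw [inner_sub_right, inner_smul_right, real_inner_self_eq_norm_sq, hlam]
      field_simp
      ring
    have h2 : u = lam • ν := by
      have h3 := hu0 _ h1
      have h4 : inner ℝ (u - lam • ν) (u - lam • ν) = 0 := by
        rw [inner_sub_left, h3, inner_smul_left, h1]; simp
      exact sub_eq_zero.1 (inner_self_eq_zero.1 h4)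
    have hy : y = lam • n₀ := by
      refine ext_inner_right ℝ fun z => ?_
      rw [inner_smul_left, hin]
      have : inner ℝ u (e.symm z) = lam * inner ℝ ν (e.symm z) := by
        rw [h2, inner_smul_left]; rfl
      rw [hu, ContinuousLinearMap.adjoint_inner_left, ← he] at this
      simpa using this
    have hl : |lam| = ‖n₀‖⁻¹ := by
      rw [hy, norm_smul] at hy1
      exact eq_inv_of_mul_eq_one_left hy1
    rcases abs_eq (by positivity) |>.1 hl with h5 | h5
    · left; rw [hy, h5]
    · right; rw [hy, h5, neg_smul]

theorem exists_isOutwardUnitNormal (h : RegularMap f A C κ L) (hS : FlatFacet C S O ν c)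
    (O' : Set (Euc d)) : ∃ n, IsOutwardUnitNormal (f '' C) (f '' S ∩ O') n := by
  have : ∀ x : Euc d, ∃ m : Euc d, x ∈ f '' S ∩ O' → ‖m‖ = 1 ∧
      (∀ t ∈ tangentConeAt ℝ (f '' S ∩ O') x, inner ℝ m t = 0) ∧ PointsOutward (f '' C) x m := by
    intro x
    by_cases hx : x ∈ f '' S ∩ O'
    · obtain ⟨⟨p, hp, rfl⟩, -⟩ := hx
      obtain ⟨m, h1, h2, h3, -⟩ := h.exists_unit_normal hS hp
      exact ⟨m, fun _ => ⟨h1, fun t ht => h2 t (tangentConeAt_mono inter_subset_left ht), h3⟩⟩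
    · exact ⟨0, fun h => absurd h hx⟩
  choose n hn using this
  exact ⟨n, fun x hx => hn x hx⟩

/-- Any outward unit normal field has the properties of the normal found in `exists_unit_normal`,
because the two candidates `m` and `-m` are told apart by the side on which `f '' C` lies. -/
theorem normal_unique (h : RegularMap f A C κ L) (hS : FlatFacet C S O ν c)
    {O' : Set (Euc d)} (hO' : IsOpen O') {n : Euc d → Euc d}
    (hn : IsOutwardUnitNormal (f '' C) (f '' S ∩ O') n) {x : Euc d} (hx : x ∈ f '' S ∩ O') :
    (∃ r, InteriorCone (f '' C) x (-n x) r) ∧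
    ∀ y : Euc d, ‖y‖ = 1 → (∀ t ∈ tangentConeAt ℝ (f '' S ∩ O') x, inner ℝ y t = 0) →
      y = n x ∨ y = - n x := by
  obtain ⟨⟨p, hp, rfl⟩, hxO⟩ := hx
  obtain ⟨m, h1, h2, h3, h4, h5⟩ := h.exists_unit_normal hS hp
  obtain ⟨n1, n2, n3⟩ := hn (f p) ⟨mem_image_of_mem f hp, hxO⟩
  have hnm : n (f p) = m := by
    rcases h5 O' hO' hxO _ n1 n2 with h6 | h6
    · exact h6
    · rw [h6] at n3
      obtain ⟨t, ht1, ht2⟩ := (h3.and n3).exists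
      rw [smul_neg, sub_neg_eq_add] at ht2
      exact absurd ht2.1 ht1.2
  rw [hnm]
  exact ⟨h4, h5 O' hO' hxO⟩

end RegularMap

/-! ### Elements are regular images of reference cells -/

theorem RefCell.isOpen_interior (d : ℕ) (c : RefCell) : IsOpen (c.interior d) := by
  cases c with
  | simplex =>
    have : RefCell.interior d .simplex =
        (⋂ i, {x : Euc d | 0 < x i}) ∩ {x : Euc d | ∑ i, x i < 1} := by
      ext x; simp [RefCell.interior]
    rw [this]
    exact (isOpen_iInter_of_finite fun i => isOpen_lt (by fun_prop) (by fun_prop)).inter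
      (isOpen_lt (by fun_prop) (by fun_prop))
  | cube =>
    have : RefCell.interior d .cube =
        (⋂ i, {x : Euc d | 0 < x i} ∩ {x : Euc d | x i < 1}) := by
      ext x; simp [RefCell.interior]
    rw [this]
    exact isOpen_iInter_of_finite fun i => (isOpen_lt (by fun_prop) (by fun_prop)).inter
      (isOpen_lt (by fun_prop) (by fun_prop))

theorem RefCell.convex_interior (d : ℕ) (c : RefCell) : Convex ℝ (c.interior d) := by
  have hlt : ∀ {a b u v r : ℝ}, u < r → v < r → 0 ≤ a → 0 ≤ b → a + b = 1 →
      a * u + b * v < r := by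
    intro a b u v r hu hv ha hb hab
    exact (convex_Iio r) hu hv ha hb hab
  have hgt : ∀ {a b u v r : ℝ}, r < u → r < v → 0 ≤ a → 0 ≤ b → a + b = 1 →
      r < a * u + b * v := by
    intro a b u v r hu hv ha hb hab
    exact (convex_Ioi r) hu hv ha hb hab
  cases c with
  | simplex =>
    intro x hx y hy a b ha hb hab
    refine ⟨fun i => ?_, ?_⟩
    · simpa using hgt (hx.1 i) (hy.1 i) ha hb hab
    · have := hlt hx.2 hy.2 ha hb hab
      simpa [Finset.sum_add_distrib, Finset.mul_sum] using this
  | cube =>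
    intro x hx y hy a b ha hb hab i
    exact ⟨by simpa using hgt (hx i).1 (hy i).1 ha hb hab,
      by simpa using hlt (hx i).2 (hy i).2 ha hb hab⟩

theorem RefCell.isBounded_interior (d : ℕ) (c : RefCell) :
    Bornology.IsBounded (c.interior d) := by
  have key : ∀ x ∈ c.interior d, ∀ i, 0 < x i ∧ x i < 1 := by
    cases c with
    | simplex =>
      intro x hx i
      exact ⟨hx.1 i, (Finset.single_le_sum (fun j _ => (hx.1 j).le) (Finset.mem_univ i)).trans_lt
        hx.2⟩
    | cube => intro x hx i; exact hx i
  refine (Metric.isBounded_iff_subset_closedBall 0).2 ⟨√d, fun x hx => ?_⟩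
  rw [mem_closedBall_zero_iff, EuclideanSpace.norm_eq]
  refine Real.sqrt_le_sqrt ?_
  calc ∑ i, ‖x i‖ ^ 2 ≤ ∑ i : Fin d, (1 : ℝ) := by
        refine Finset.sum_le_sum fun i _ => ?_
        have := key x hx i
        rw [Real.norm_of_nonneg this.1.le]
        nlinarith
    _ = d := by simp

theorem RefCell.IsFacet.exists_flatFacet {m : ℕ} {c : RefCell} {S : Set (Euc (m + 1))}
    (hS : c.IsFacet S) : ∃ O ν r, FlatFacet (c.interior (m + 1)) S O ν r := by
  have hsgl : ∀ (i : Fin (m + 1)) (a : ℝ), a ≠ 0 → EuclideanSpace.single i a ≠ (0 : Euc (m + 1)) := by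
    intro i a ha h0
    have := congrArg (fun v : Euc (m + 1) => v i) h0
    simp [ha] at this
  cases c with
  | simplex =>
    rcases hS with ⟨i, rfl⟩ | rfl
    · refine ⟨(⋂ j : {j // j ≠ i}, {x : Euc (m + 1) | 0 < x j}) ∩ {x : Euc (m + 1) | ∑ j, x j < 1},
        EuclideanSpace.single i (-1), 0, ?_, hsgl i _ (by norm_num), ?_, ?_⟩
      · exact (isOpen_iInter_of_finite fun i => isOpen_lt (by fun_prop) (by fun_prop)).inter
          (isOpen_lt (by fun_prop) (by fun_prop))
      · ext x
        simp only [RefCell.interior, mem_ofPred_eq, mem_inter_iff, mem_iInter, Subtype.forall,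
          EuclideanSpace.inner_single_left]
        constructor
        · rintro ⟨h1, h2⟩
          exact ⟨⟨fun j _ => h1 j, h2⟩, by simpa using h1 i⟩
        · rintro ⟨⟨h1, h2⟩, h3⟩
          refine ⟨fun j => ?_, h2⟩
          by_cases hj : j = i
          · subst hj; simpa using h3
          · exact h1 j hj
      · ext x
        simp only [mem_ofPred_eq, mem_inter_iff, mem_iInter, Subtype.forall,
          EuclideanSpace.inner_single_left]
        constructor
        · rintro ⟨h1, h2, h3⟩
          exact ⟨⟨h2, h3⟩, by simp [h1]⟩
        · rintro ⟨⟨h1, h2⟩, h3⟩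
          exact ⟨by simpa using h3, h1, h2⟩
    · refine ⟨⋂ j, {x : Euc (m + 1) | 0 < x j}, WithLp.toLp 2 (fun _ => (1 : ℝ)), 1, ?_, ?_, ?_, ?_⟩
      · exact isOpen_iInter_of_finite fun i => isOpen_lt (by fun_prop) (by fun_prop)
      · intro h0
        have := congrArg (fun v : Euc (m + 1) => v 0) h0
        simp at this
      · ext x
        simp [RefCell.interior, PiLp.inner_apply]
      · ext x
        simp [PiLp.inner_apply]
  | cube =>
    obtain ⟨i, c, hc, rfl⟩ := hS
    rcases hc with rfl | rfl
    · refine ⟨(⋂ j : {j // j ≠ i}, {x : Euc (m + 1) | 0 < x j} ∩ {x : Euc (m + 1) | x j < 1}) ∩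
        {x : Euc (m + 1) | x i < 1}, EuclideanSpace.single i (-1), 0, ?_, hsgl i _ (by norm_num), ?_, ?_⟩
      · exact (isOpen_iInter_of_finite fun i => (isOpen_lt (by fun_prop) (by fun_prop)).inter
          (isOpen_lt (by fun_prop) (by fun_prop))).inter (isOpen_lt (by fun_prop) (by fun_prop))
      · ext x
        simp only [RefCell.interior, mem_ofPred_eq, mem_inter_iff, mem_iInter, Subtype.forall,
          EuclideanSpace.inner_single_left]
        constructor
        · intro h1
          exact ⟨⟨fun j _ => h1 j, (h1 i).2⟩, by simpa using (h1 i).1⟩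
        · rintro ⟨⟨h1, h2⟩, h3⟩ j
          by_cases hj : j = i
          · subst hj; exact ⟨by simpa using h3, h2⟩
          · exact h1 j hj
      · ext x
        simp only [mem_ofPred_eq, mem_inter_iff, mem_iInter, Subtype.forall,
          EuclideanSpace.inner_single_left]
        constructor
        · rintro ⟨h1, h2⟩
          exact ⟨⟨h2, by rw [h1]; norm_num⟩, by simp [h1]⟩
        · rintro ⟨⟨h1, h2⟩, h3⟩
          exact ⟨by simpa using h3, h1⟩
    · refine ⟨(⋂ j : {j // j ≠ i}, {x : Euc (m + 1) | 0 < x j} ∩ {x : Euc (m + 1) | x j < 1}) ∩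
        {x : Euc (m + 1) | 0 < x i}, EuclideanSpace.single i 1, 1, ?_, hsgl i _ (by norm_num), ?_, ?_⟩
      · exact (isOpen_iInter_of_finite fun i => (isOpen_lt (by fun_prop) (by fun_prop)).inter
          (isOpen_lt (by fun_prop) (by fun_prop))).inter (isOpen_lt (by fun_prop) (by fun_prop))
      · ext x
        simp only [RefCell.interior, mem_ofPred_eq, mem_inter_iff, mem_iInter, Subtype.forall,
          EuclideanSpace.inner_single_left]
        constructor
        · intro h1
          exact ⟨⟨fun j _ => h1 j, (h1 i).1⟩, by simpa using (h1 i).2⟩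
        · rintro ⟨⟨h1, h2⟩, h3⟩ j
          by_cases hj : j = i
          · subst hj; exact ⟨h2, by simpa using h3⟩
          · exact h1 j hj
      · ext x
        simp only [mem_ofPred_eq, mem_inter_iff, mem_iInter, Subtype.forall,
          EuclideanSpace.inner_single_left]
        constructor
        · rintro ⟨h1, h2⟩
          exact ⟨⟨h2, by rw [h1]; norm_num⟩, by simp [h1]⟩
        · rintro ⟨⟨h1, h2⟩, h3⟩
          exact ⟨by simpa using h3, h1⟩

namespace CurvedElement

/-- The map of a curved element is a contractive perturbation of an invertible affine map, hence a
regular map of the reference cell. -/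
theorem exists_regularMap {d : ℕ} (K : CurvedElement d) (hne : (K.cell.interior d).Nonempty) :
    ∃ A κ L, RegularMap K.map A (K.cell.interior d) κ L := by
  set C := K.cell.interior d with hC
  have hCo : IsOpen C := K.cell.isOpen_interior d
  have hCc : Convex ℝ C := K.cell.convex_interior d
  have hint : (interior (closure C)).Nonempty :=
    hne.mono (hCo.subset_interior_iff.2 subset_closure)
  have huniq : UniqueDiffOn ℝ (closure C) := uniqueDiffOn_convex hCc.closure hint
  have hΦd : ∀ x ∈ closure C,
      HasFDerivWithinAt K.Φ (fderivWithin ℝ K.Φ (closure C) x) (closure C) x := fun x hx =>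
    (K.contDiffOn.differentiableOn one_ne_zero x hx).hasFDerivWithinAt
  have hΦc : ContinuousOn (fderivWithin ℝ K.Φ (closure C)) (closure C) :=
    K.contDiffOn.continuousOn_fderivWithin huniq le_rfl
  obtain ⟨q, hq1, hq⟩ := K.small
  have hq' : ∀ x ∈ closure C,
      ‖(fderivWithin ℝ K.Φ (closure C) x).comp (K.B.symm : Euc d →L[ℝ] Euc d)‖ ≤ q := by
    intro x hx
    refine le_on_closure (f := fun x => ‖(fderivWithin ℝ K.Φ (closure C) x).comp
      (K.B.symm : Euc d →L[ℝ] Euc d)‖) (g := fun _ => q) ?_ ?_ continuousOn_const hx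
    · intro y hy
      have : fderivWithin ℝ K.Φ (closure C) y = fderiv ℝ K.Φ y :=
        fderivWithin_of_mem_nhds (mem_of_superset (hCo.mem_nhds hy) subset_closure)
      simp only [this]
      exact hq y hy
    · exact (hΦc.clm_comp continuousOn_const).norm
  have hq0 : 0 ≤ q := by
    obtain ⟨x, hx⟩ := hne
    exact (norm_nonneg _).trans (hq x hx)
  have hder : ∀ x ∈ closure C, ∀ h, ‖fderivWithin ℝ K.Φ (closure C) x h‖ ≤ q * ‖K.B h‖ := by
    intro x hx h
    have := ((fderivWithin ℝ K.Φ (closure C) x).comp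
      (K.B.symm : Euc d →L[ℝ] Euc d)).le_of_opNorm_le (hq' x hx) (K.B h)
    simpa using this
  -- the perturbation is a contraction with respect to the distance `‖B (x - y)‖`
  have hΦL : ∀ x ∈ closure C, ∀ y ∈ closure C, ‖K.Φ x - K.Φ y‖ ≤ q * ‖K.B (x - y)‖ := by
    intro x hx y hy
    have hconv : Convex ℝ (K.B.symm ⁻¹' closure C) :=
      hCc.closure.linear_preimage (K.B.symm : Euc d →ₗ[ℝ] Euc d)
    have := hconv.norm_image_sub_le_of_norm_hasFDerivWithin_le (𝕜 := ℝ)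
      (f := fun z => K.Φ (K.B.symm z)) (s := K.B.symm ⁻¹' closure C)
      (f' := fun z => (fderivWithin ℝ K.Φ (closure C) (K.B.symm z)).comp
        (K.B.symm : Euc d →L[ℝ] Euc d)) (C := q) (x := K.B y) (y := K.B x)
      (fun z hz => (hΦd _ hz).comp z K.B.symm.hasFDerivWithinAt (mapsTo_preimage _ _))
      (fun z hz => hq' _ hz) (by simpa using hy) (by simpa using hx)
    simpa [map_sub] using this
  obtain ⟨β, hβ, hBβ⟩ : ∃ β > 0, ∀ h, β * ‖h‖ ≤ ‖K.B h‖ := by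
    refine ⟨(‖(K.B.symm : Euc d →L[ℝ] Euc d)‖ + 1)⁻¹, by positivity, fun h => ?_⟩
    rw [inv_mul_le_iff₀ (by positivity)]
    have := (K.B.symm : Euc d →L[ℝ] Euc d).le_opNorm (K.B h)
    simp only [ContinuousLinearEquiv.coe_coe, ContinuousLinearEquiv.symm_apply_apply] at this
    nlinarith [norm_nonneg (K.B h)]
  have hmap : ∀ x y, K.map x - K.map y = K.B (x - y) + (K.Φ x - K.Φ y) := fun x y => by
    simp only [map, map_sub]; abel
  refine ⟨fun x => (K.B : Euc d →L[ℝ] Euc d) + fderivWithin ℝ K.Φ (closure C) x,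
    (1 - q) * β, (1 + q) * ‖(K.B : Euc d →L[ℝ] Euc d)‖,
    hCo, hCc, K.cell.isBounded_interior d, ?_, ?_, by nlinarith, ?_, ?_, ?_⟩
  · intro x hx
    exact (K.B.hasFDerivWithinAt.add_const K.b).add (hΦd x hx)
  · exact continuousOn_const.add hΦc
  · intro x hx y hy
    rw [hmap]
    have h1 := hΦL x hx y hy
    have h2 := norm_sub_le_norm_add (K.B (x - y)) (K.Φ x - K.Φ y)
    have h3 := hBβ (x - y)
    nlinarith
  · intro x hx y hy
    rw [hmap]
    have h1 := hΦL x hx y hy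
    have h2 := norm_add_le (K.B (x - y)) (K.Φ x - K.Φ y)
    have h3 : ‖K.B (x - y)‖ ≤ ‖(K.B : Euc d →L[ℝ] Euc d)‖ * ‖x - y‖ :=
      (K.B : Euc d →L[ℝ] Euc d).le_opNorm (x - y)
    nlinarith
  · intro x hx h
    have h1 := hder x hx h
    have h2 := norm_sub_le_norm_add (K.B h) (fderivWithin ℝ K.Φ (closure C) x h)
    have h3 := hBβ h
    simp only [add_apply, ContinuousLinearEquiv.coe_coe]
    nlinarith

end CurvedElement

/-! ### Mesh faces and their mean curvature -/

/-- The geometric data of a face: a piece `f '' S ∩ O'` of the image of a flat facet `S` of the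
convex set `C` under a regular map `f`. -/
structure RegularFace {d : ℕ} (K F : Set (Euc d)) (f : Euc d → Euc d)
    (A : Euc d → Euc d →L[ℝ] Euc d) (C S O O' : Set (Euc d)) (ν : Euc d) (c κ L : ℝ) : Prop where
  map : RegularMap f A C κ L
  flat : FlatFacet C S O ν c
  isOpen' : IsOpen O'
  domain_eq : K = f '' C
  face_eq : F = f '' S ∩ O'

theorem IsFacetPiece.exists_regularFace {m : ℕ} {K : CurvedElement (m + 1)}
    {F : Set (Euc (m + 1))} (hF : IsFacetPiece K F) :
    ∃ f A C S O O' ν c κ L, RegularFace K.carrier F f A C S O O' ν c κ L := by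
  obtain ⟨hne, _, O', ⟨S, hS, rfl⟩, hO', rfl⟩ := hF
  obtain ⟨O, ν, c, hflat⟩ := hS.exists_flatFacet
  have hC : (K.cell.interior (m + 1)).Nonempty := by
    obtain ⟨_, ⟨p, hp, rfl⟩, -⟩ := hne
    exact closure_nonempty_iff.1 ⟨p, hflat.subset_closure hp⟩
  obtain ⟨A, κ, L, hreg⟩ := K.exists_regularMap hC
  exact ⟨K.map, A, _, S, O, O', ν, c, κ, L, hreg, hflat, hO', rfl, rfl⟩

theorem IsMeshFace.isFacetPiece {d : ℕ} {N M : ℕ} {Γ : Fin N → Set (Euc d)}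
    {T : Fin M → CurvedElement d} {k : Fin M} {F : Set (Euc d)} (hF : IsMeshFace Γ T k F) :
    IsFacetPiece (T k) F := by
  rcases hF with ⟨l, -, h, -⟩ | ⟨h, -⟩ <;> exact h

theorem inner_eq_zero_of_level {d : ℕ} {F : Set (Euc d)} {φ : Euc d → ℝ} {c : ℝ} {x g : Euc d}
    (hφ : ∀ y ∈ F, φ y = c) (hx : x ∈ F) (hg : HasGradientAt φ g x) :
    ∀ t ∈ tangentConeAt ℝ F x, inner ℝ g t = 0 := by
  intro t ht
  have h1 := (hasGradientAt_iff_hasFDerivAt.1 hg).hasFDerivWithinAt (s := F)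
  have h0 : HasFDerivWithinAt φ (0 : Euc d →L[ℝ] ℝ) F x :=
    (hasFDerivWithinAt_const c x F).congr hφ (hφ x hx)
  simpa using h1.unique_on h0 ht

theorem PointsOutward.not_neg {d : ℕ} {K Ω : Set (Euc d)} {x n : Euc d} (hK : K ⊆ Ω)
    (h : PointsOutward K x n) : ¬ PointsOutward Ω x (-n) := by
  intro h'
  obtain ⟨t, ht1, ht2⟩ := (h.and h').exists
  apply ht2.2
  rw [smul_neg, ← sub_eq_add_neg]
  exact hK ht1.1

/-- On a boundary face the normal is `∇φ / ‖∇φ‖`, a `C^1` field near the face. -/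
theorem IsOutwardUnitNormal.exists_extension_of_level {d : ℕ} {Ω K F : Set (Euc d)}
    {n : Euc d → Euc d} (hKΩ : K ⊆ Ω) (hn : IsOutwardUnitNormal K F n)
    (hun : ∀ x ∈ F, ∀ y : Euc d, ‖y‖ = 1 → (∀ t ∈ tangentConeAt ℝ F x, inner ℝ y t = 0) →
      y = n x ∨ y = - n x)
    {D : Set (Euc d)} {φ : Euc d → ℝ} {c : ℝ} (hD : IsOpen D) (hFD : F ⊆ D)
    (hφ : ContDiffOn ℝ 2 φ D) (h : ∀ x ∈ F, φ x = c ∧ gradient φ x ≠ 0 ∧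
      PointsOutward Ω x (‖gradient φ x‖⁻¹ • gradient φ x)) :
    ∃ (U : Set (Euc d)) (N : Euc d → Euc d), IsOpen U ∧ F ⊆ U ∧ ContDiffOn ℝ 1 N U ∧
      (∀ x ∈ U, ‖N x‖ = 1) ∧ (∀ x ∈ F, N x = n x) := by
  have hgC : ContDiffOn ℝ 1 (gradient φ) D := by
    have h1 : ContDiffOn ℝ 1 (fderiv ℝ φ) D := hφ.fderiv_of_isOpen hD (by norm_num)
    exact (InnerProductSpace.toDual ℝ (Euc d)).symm.contDiff.comp_contDiffOn h1
  refine ⟨D ∩ {x | gradient φ x ≠ 0}, fun x => ‖gradient φ x‖⁻¹ • gradient φ x, ?_, ?_, ?_, ?_, ?_⟩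
  · exact hgC.continuousOn.isOpen_inter_preimage hD isOpen_compl_singleton
  · exact fun x hx => ⟨hFD hx, (h x hx).2.1⟩
  · have h2 : ContDiffOn ℝ 1 (gradient φ) (D ∩ {x | gradient φ x ≠ 0}) := hgC.mono inter_subset_left
    exact ((h2.norm ℝ fun x hx => hx.2).inv fun x hx => norm_ne_zero_iff.2 hx.2).smul h2
  · intro x hx
    rw [norm_smul, norm_inv, norm_norm, inv_mul_cancel₀ (norm_ne_zero_iff.2 hx.2)]
  · intro x hx
    obtain ⟨h1, h2, h3⟩ := h x hx
    have hg : HasGradientAt φ (gradient φ x) x :=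
      ((hφ.differentiableOn two_ne_zero).differentiableAt
        (hD.mem_nhds (hFD hx))).hasGradientAt
    have ht : ∀ t ∈ tangentConeAt ℝ F x, inner ℝ (‖gradient φ x‖⁻¹ • gradient φ x) t = 0 := by
      intro t ht
      rw [inner_smul_left, inner_eq_zero_of_level (fun y hy => (h y hy).1) hx hg t ht, mul_zero]
    rcases hun x hx _ (by
      rw [norm_smul, norm_inv, norm_norm, inv_mul_cancel₀ (norm_ne_zero_iff.2 h2)]) ht with h4 | h4
    · exact h4
    · rw [h4] at h3
      exact absurd h3 ((hn x hx).2.2.not_neg hKΩ)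

/-- On a flat face the normal is locally constant, hence extends to a locally constant field. -/
theorem IsOutwardUnitNormal.exists_extension_of_flat {d : ℕ} {K F : Set (Euc d)}
    {n : Euc d → Euc d} (hn : IsOutwardUnitNormal K F n) (hFK : F ⊆ closure K)
    (hcone : ∀ x ∈ F, ∃ r, InteriorCone K x (-n x) r)
    (hun : ∀ x ∈ F, ∀ y : Euc d, ‖y‖ = 1 → (∀ t ∈ tangentConeAt ℝ F x, inner ℝ y t = 0) →
      y = n x ∨ y = - n x) {ν : Euc d} {c : ℝ} (hν : ‖ν‖ = 1) (hF : ∀ x ∈ F, inner ℝ x ν = c) :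
    ∃ (U : Set (Euc d)) (N : Euc d → Euc d), IsOpen U ∧ F ⊆ U ∧ ContDiffOn ℝ 1 N U ∧
      (∀ x ∈ U, ‖N x‖ = 1) ∧ (∀ x ∈ F, N x = n x) := by
  have hor : ∀ x ∈ F, n x = ν ∨ n x = -ν := by
    intro x hx
    have hg : HasGradientAt (fun y : Euc d => inner ℝ y ν) ν x := by
      rw [hasGradientAt_iff_hasFDerivAt]
      have := (innerSL ℝ ν).hasFDerivAt (x := x)
      have h2 : (fun y : Euc d => inner ℝ y ν) = innerSL ℝ ν := by
        ext y; simp [real_inner_comm]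
      rw [h2]
      convert! this using 1
    rcases hun x hx ν hν (inner_eq_zero_of_level hF hx hg) with h | h
    · exact Or.inl h.symm
    · exact Or.inr (by rw [h, neg_neg])
  -- the cones `x - t • n x` at neighbouring points force equal signs
  have hloc : ∀ x ∈ F, ∀ᶠ y in 𝓝 x, y ∈ F → n y ≠ - n x := by
    intro x hx
    obtain ⟨r, hr⟩ := hcone x hx
    filter_upwards [Metric.ball_mem_nhds x hr.pos] with y hy hyF hneg
    have h1 := (hn y hyF).2.2
    rw [hneg] at h1
    have h2 : ∀ᶠ t : ℝ in 𝓝[>] 0, t ∈ Ioc 0 r := Ioc_mem_nhdsGT hr.pos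
    obtain ⟨t, ht1, ht2⟩ := (h1.and h2).exists
    exact ht1.2 (hr.subset y (hFK hyF) hy t ht2.1 ht2.2
      (Metric.mem_closedBall_self (by have := hr.pos; have := ht2.1; positivity)))
  have hνν : ν ≠ -ν := by
    intro h
    have h0 : ν = 0 := by
      have h1 : (2 : ℝ) • ν = 0 := by rw [two_smul]; exact add_eq_zero_iff_eq_neg.2 h
      exact (smul_eq_zero.1 h1).resolve_left two_ne_zero
    rw [h0, norm_zero] at hν
    norm_num at hν
  have hsep : ∀ a : Euc d, a = ν ∨ a = -ν →
      Disjoint (closure {x ∈ F | n x = a}) {x ∈ F | n x = -a} := by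
    intro a ha
    rw [Set.disjoint_left]
    rintro x hx ⟨hxF, hxn⟩
    obtain ⟨y, hy1, hy2⟩ := mem_closure_iff_nhds.1 hx _ (hloc x hxF)
    rw [hxn, neg_neg] at hy1
    exact hy1 hy2.1 hy2.2
  have h1 := hsep ν (Or.inl rfl)
  have h2 := hsep (-ν) (Or.inr rfl)
  rw [neg_neg] at h2
  -- the parts of `F` with normal `ν` and `-ν` are separated sets, hence have disjoint neighbourhoods
  have h3 := CompletelyNormalSpace.completely_normal h1 h2.symm
  obtain ⟨U₁, U₂, hU₁, hU₂, hs₁, hs₂, hdis⟩ := separatedNhds_iff_disjoint.2 h3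
  classical
  refine ⟨U₁ ∪ U₂, fun x => if x ∈ U₁ then ν else -ν, hU₁.union hU₂, ?_, ?_, ?_, ?_⟩
  · intro x hx
    rcases hor x hx with h | h
    · exact Or.inl (hs₁ ⟨hx, h⟩)
    · exact Or.inr (hs₂ ⟨hx, h⟩)
  · intro x hx
    refine ContDiffAt.contDiffWithinAt ?_
    rcases hx with hx | hx
    · refine (contDiffAt_const (c := ν)).congr_of_eventuallyEq ?_
      filter_upwards [hU₁.mem_nhds hx] with y hy
      simp [hy]
    · refine (contDiffAt_const (c := -ν)).congr_of_eventuallyEq ?_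
      filter_upwards [hU₂.mem_nhds hx] with y hy
      simp [Set.disjoint_right.1 hdis hy]
  · intro x _
    dsimp only
    split_ifs <;> simp [hν]
  · intro x hx
    dsimp only
    rcases hor x hx with h | h
    · rw [if_pos (hs₁ ⟨hx, h⟩), h]
    · rw [if_neg (Set.disjoint_right.1 hdis (hs₂ ⟨hx, h⟩)), h]

/-- The normal of a mesh face extends to a `C¹` unit field on a neighbourhood: `∇φ / |∇φ|`, with `φ` the
convex level set function, for a boundary face, and a locally constant field for an interior face. -/
theorem IsMeshFace.exists_isMeanCurvature {m : ℕ} {α : ℝ≥0} {Ω : Set (Euc (m + 1))} {N : ℕ}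
    {Γ : Fin N → Set (Euc (m + 1))} (hΩ : IsPiecewiseConvexDomain 2 α Ω Γ) {M : ℕ}
    {T : Fin M → CurvedElement (m + 1)} (hT : IsMesh Ω T) {k : Fin M} {F : Set (Euc (m + 1))}
    (hF : IsMeshFace Γ T k F) {n : Euc (m + 1) → Euc (m + 1)}
    (hn : IsOutwardUnitNormal (T k).carrier F n) : ∃ H, IsMeanCurvature F n H := by
  obtain ⟨f, A, C, S, O, O', ν, c, κ, L, hR⟩ := hF.isFacetPiece.exists_regularFace
  have hboth : ∀ x ∈ F, (∃ r, InteriorCone (T k).carrier x (-n x) r) ∧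
      ∀ y, ‖y‖ = 1 → (∀ t ∈ tangentConeAt ℝ F x, inner ℝ y t = 0) → y = n x ∨ y = - n x := by
    have h1 := @RegularMap.normal_unique _ f A C κ L S O ν c hR.map hR.flat O' hR.isOpen' n
    rw [← hR.domain_eq, ← hR.face_eq] at h1
    exact fun x hx => h1 hn hx
  suffices h : ∃ (U : Set (Euc (m + 1))) (N : Euc (m + 1) → Euc (m + 1)), IsOpen U ∧ F ⊆ U ∧
      ContDiffOn ℝ 1 N U ∧ (∀ x ∈ U, ‖N x‖ = 1) ∧ (∀ x ∈ F, N x = n x) by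
    obtain ⟨U, N, h1, h2, h3, h4, h5⟩ := h
    exact ⟨fun x => ∑ i, (fderiv ℝ N x (stdVec i)) i, U, N, h1, h2, h3, h4, h5, fun _ _ => rfl⟩
  rcases hF with ⟨l, hkl, hint⟩ | ⟨-, j, hj⟩
  · obtain ⟨ν', c', hν', hF'⟩ := hT.flat k l hkl F hint
    refine hn.exists_extension_of_flat ?_ (fun x hx => (hboth x hx).1)
      (fun x hx => (hboth x hx).2) hν' hF'
    rw [hR.face_eq, hR.domain_eq, hR.map.closure_image]
    exact inter_subset_left.trans (image_mono hR.flat.subset_closure)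
  · obtain ⟨D, φ, c', hD, hΓD, -, hφ, h⟩ := hΩ.convex j
    exact hn.exists_extension_of_level (hT.subset k) (fun x hx => (hboth x hx).2) hD
      (hj.trans hΓD) hφ.1 (fun x hx => h x (hj hx))

/-! ### Surface measure and parametrizations -/

theorem euclideanHausdorffMeasure_image_le {X Y : Type*} [EMetricSpace X] [EMetricSpace Y]
    [MeasurableSpace X] [BorelSpace X] [MeasurableSpace Y] [BorelSpace Y] {K : ℝ≥0} {f : X → Y}
    {s : Set X} (hf : LipschitzOnWith K f s) (m : ℕ) :
    (μHE[m] : Measure Y) (f '' s) ≤ (K : ℝ≥0∞) ^ m * (μHE[m] : Measure X) s := by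
  have h := hf.hausdorffMeasure_image_le (d := (m : ℝ)) (by positivity)
  rw [ENNReal.rpow_natCast] at h
  simp only [Measure.euclideanHausdorffMeasure_def, Measure.smul_apply, ENNReal.smul_def,
    smul_eq_mul]
  rw [mul_left_comm]
  gcongr

/-- A regular bi-Lipschitz parametrization `X` of the whole hypersurface `F` by an open subset `U`
of `ℝ^m`. -/
structure GlobalChart {m : ℕ} (F : Set (Euc (m + 1))) (X : Euc m → Euc (m + 1)) (U : Set (Euc m))
    (κ : ℝ) (L : ℝ≥0) : Prop where
  isOpen : IsOpen U
  contDiffOn : ContDiffOn ℝ 1 X U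
  injective : ∀ p ∈ U, Function.Injective (fderiv ℝ X p)
  image : X '' U = F
  pos : 0 < κ
  lower : ∀ p ∈ U, ∀ q ∈ U, κ * ‖p - q‖ ≤ ‖X p - X q‖
  lipschitz : LipschitzOnWith L X U

/-- Restricting `f` to the hyperplane of the facet, in orthonormal coordinates, parametrizes the face. -/
theorem RegularFace.exists_globalChart {m : ℕ} {K F : Set (Euc (m + 1))}
    {f : Euc (m + 1) → Euc (m + 1)} {A C S O O' ν c κ L}
    (h : RegularFace K F f A C S O O' ν c κ L) : ∃ X U κ' L', GlobalChart F X U κ' L' := by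
  have : Fact (Module.finrank ℝ (Euc (m + 1)) = m + 1) := ⟨by simp⟩
  have hreg := h.map
  have hflat := h.flat
  let b := OrthonormalBasis.fromOrthogonalSpanSingleton (𝕜 := ℝ) m hflat.ne
  let J : Euc m →L[ℝ] Euc (m + 1) :=
    (Submodule.subtypeL (ℝ ∙ ν)ᗮ).comp
      (b.repr.symm.toContinuousLinearEquiv : Euc m →L[ℝ] (ℝ ∙ ν)ᗮ)
  have hJn : ∀ p, ‖J p‖ = ‖p‖ := fun p => b.repr.symm.norm_map p
  have hJν : ∀ p, inner ℝ ν (J p) = 0 := fun p =>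
    Submodule.mem_orthogonal_singleton_iff_inner_right.1 (b.repr.symm p).2
  have hJs : ∀ y, inner ℝ ν y = 0 → ∃ p, J p = y := fun y hy =>
    ⟨b.repr ⟨y, Submodule.mem_orthogonal_singleton_iff_inner_right.2 hy⟩, by
      change ((b.repr.symm (b.repr _) : _) : Euc (m + 1)) = y
      rw [LinearIsometryEquiv.symm_apply_apply]⟩
  have hν := norm_pos_iff.2 hflat.ne
  set x₀ : Euc (m + 1) := (c / ‖ν‖ ^ 2) • ν with hx₀
  have hx₀c : inner ℝ ν x₀ = c := by
    rw [hx₀, inner_smul_right, real_inner_self_eq_norm_sq]; field_simp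
  let ι : Euc m → Euc (m + 1) := fun p => x₀ + J p
  have hιc : Continuous ι := by fun_prop
  have hι : ∀ p, inner ℝ ν (ι p) = c := fun p => by
    change inner ℝ ν (x₀ + J p) = c
    rw [inner_add_right, hJν, hx₀c, add_zero]
  have hιd : ∀ p q, ι p - ι q = J (p - q) := fun p q => by
    simp only [ι, map_sub]; abel
  have hU₀ : IsOpen (ι ⁻¹' O) := hflat.isOpen.preimage hιc
  have hmem : ∀ p ∈ ι ⁻¹' O, ι p ∈ S := fun p hp => by
    rw [hflat.facet]; exact ⟨hp, hι p⟩
  have hmemC : MapsTo ι (ι ⁻¹' O) (closure C) := fun p hp => hflat.subset_closure (hmem p hp)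
  have hcontX : ContinuousOn (fun p => f (ι p)) (ι ⁻¹' O) :=
    hreg.continuousOn.comp hιc.continuousOn hmemC
  have hU := hcontX.isOpen_inter_preimage hU₀ h.isOpen'
  set U := ι ⁻¹' O ∩ (fun p => f (ι p)) ⁻¹' O' with hUdef
  have hder : ∀ p ∈ U, HasFDerivAt (fun p => f (ι p)) ((A (ι p)).comp J) p := by
    intro p hp
    have h1 : HasFDerivWithinAt ι J (ι ⁻¹' O) p := (J.hasFDerivWithinAt).const_add x₀
    exact ((hreg.deriv _ (hmemC hp.1)).comp p h1 hmemC).hasFDerivAt (hU₀.mem_nhds hp.1)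
  refine ⟨fun p => f (ι p), U, κ, L.toNNReal, hU, ?_, ?_, ?_, hreg.pos, ?_, ?_⟩
  · have h01 : (1 : ℕ∞ω) = 0 + 1 := by norm_num
    rw [h01, contDiffOn_succ_iff_fderiv_of_isOpen hU]
    refine ⟨fun p hp => (hder p hp).differentiableAt.differentiableWithinAt, by simp, ?_⟩
    rw [contDiffOn_zero]
    have h2 : ContinuousOn (fun p => (A (ι p)).comp J) U :=
      (hreg.cont.comp hιc.continuousOn (hmemC.mono_left inter_subset_left)).clm_comp
        continuousOn_const
    exact h2.congr fun p hp => (hder p hp).fderiv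
  · intro p hp
    rw [(hder p hp).fderiv, injective_iff_map_eq_zero]
    intro a ha
    have := hreg.lowerA _ (hmemC hp.1) (J a)
    have ha' : A (ι p) (J a) = 0 := ha
    rw [ha', norm_zero, hJn] at this
    by_contra hne
    have := norm_pos_iff.2 hne
    nlinarith [mul_pos hreg.pos this]
  · rw [h.face_eq]
    ext x
    constructor
    · rintro ⟨p, hp, rfl⟩
      exact ⟨mem_image_of_mem f (hmem p hp.1), hp.2⟩
    · rintro ⟨⟨y, hy, rfl⟩, hyO⟩
      have hy' := hy
      rw [hflat.facet] at hy'
      obtain ⟨p, hp⟩ := hJs (y - x₀) (by rw [inner_sub_right, hx₀c, hy'.2, sub_self])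
      have hιp : ι p = y := by simp [ι, hp]
      refine ⟨p, ⟨?_, ?_⟩, ?_⟩
      · rw [mem_preimage, hιp]; exact hy'.1
      · change f (ι p) ∈ O'; rwa [hιp]
      · change f (ι p) = f y; rw [hιp]
  · intro p hp q hq
    have := hreg.lower _ (hmemC hp.1) _ (hmemC hq.1)
    rwa [hιd, hJn] at this
  · refine LipschitzOnWith.of_dist_le_mul fun p hp q hq => ?_
    have := hreg.upper _ (hmemC hp.1) _ (hmemC hq.1)
    rw [hιd, hJn] at this
    rw [dist_eq_norm, dist_eq_norm]
    refine this.trans ?_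
    gcongr
    exact Real.le_coe_toNNReal L

namespace GlobalChart

variable {m : ℕ} {F : Set (Euc (m + 1))} {X : Euc m → Euc (m + 1)} {U : Set (Euc m)}
    {κ : ℝ} {L : ℝ≥0}

theorem injOn (h : GlobalChart F X U κ L) : InjOn X U := by
  intro p hp q hq hpq
  have := h.lower p hp q hq
  rw [hpq, sub_self, norm_zero] at this
  by_contra hne
  have h2 := norm_pos_iff.2 (sub_ne_zero.2 hne)
  nlinarith [mul_pos h.pos h2]

theorem measurableSet (h : GlobalChart F X U κ L) : MeasurableSet F := by
  rw [← h.image]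
  exact h.isOpen.measurableSet.image_of_continuousOn_injOn h.contDiffOn.continuousOn h.injOn

/-- The lower bi-Lipschitz bound puts the parameters of a ball of radius `r` into a ball of radius
`2 r / κ`, so the face has at most `m`-dimensional growth. -/
theorem exists_surf_ball_le (h : GlobalChart F X U κ L) :
    ∃ c : ℝ≥0, ∀ x r, 0 < r → surf F (Metric.ball x r) ≤ c * ENNReal.ofReal r ^ m := by
  have hκ := h.pos
  refine ⟨L ^ m * (2 / κ).toNNReal ^ m *
    (volume (Metric.ball (0 : Euc m) 1)).toNNReal, fun x r hr => ?_⟩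
  rw [surf, Measure.restrict_apply Metric.isOpen_ball.measurableSet]
  have h1 : Metric.ball x r ∩ F = X '' (U ∩ X ⁻¹' Metric.ball x r) := by
    rw [← h.image, image_inter_preimage, inter_comm]
  rw [h1]
  refine (euclideanHausdorffMeasure_image_le (h.lipschitz.mono inter_subset_left) m).trans ?_
  rw [EuclideanSpace.euclideanHausdorffMeasure_eq_volume]
  rcases (U ∩ X ⁻¹' Metric.ball x r).eq_empty_or_nonempty with h0 | ⟨p, hp⟩
  · simp [h0]
  have h2 : U ∩ X ⁻¹' Metric.ball x r ⊆ Metric.closedBall p (2 / κ * r) := by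
    intro q hq
    rw [mem_closedBall_iff_norm]
    have h3 := h.lower q hq.1 p hp.1
    have h4 : ‖X q - X p‖ < 2 * r := by
      rw [← dist_eq_norm]
      have := dist_triangle_right (X q) (X p) x
      have h5 : dist (X q) x < r := hq.2
      have h6 : dist (X p) x < r := hp.2
      linarith
    rw [div_mul_eq_mul_div, le_div_iff₀ hκ]
    linarith
  have h3 := (measure_mono (μ := volume) h2)
  rw [Measure.addHaar_closedBall _ _ (by positivity)] at h3
  simp only [finrank_euclideanSpace, Fintype.card_fin] at h3
  calc _ ≤ (L : ℝ≥0∞) ^ m * (ENNReal.ofReal ((2 / κ * r) ^ m) *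
        volume (Metric.ball (0 : Euc m) 1)) := by gcongr
    _ = _ := by
      rw [ENNReal.ofReal_pow (by positivity), ENNReal.ofReal_mul (by positivity)]
      push_cast
      rw [ENNReal.coe_toNNReal measure_ball_lt_top.ne]
      simp only [ENNReal.ofReal]
      ring

/-- The chart maps null sets to null sets of the surface measure. -/
theorem ae_surf_of_ae (h : GlobalChart F X U κ L) {P : Euc (m + 1) → Prop}
    (hP : ∀ᵐ p ∂(volume.restrict U), P (X p)) : ∀ᵐ x ∂(surf F), P x := by
  rw [ae_restrict_iff' h.isOpen.measurableSet] at hP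
  rw [surf, ae_restrict_iff' h.measurableSet]
  rw [ae_iff] at hP ⊢
  have h1 : {x | ¬(x ∈ F → P x)} = X '' (U ∩ {p | ¬(p ∈ U → P (X p))}) := by
    ext x
    simp only [← h.image]
    constructor
    · intro hx
      simp only [mem_ofPred, Classical.not_imp] at hx
      obtain ⟨⟨p, hp, rfl⟩, hx2⟩ := hx
      exact ⟨p, ⟨hp, fun h' => hx2 (h' hp)⟩, rfl⟩
    · rintro ⟨p, ⟨hp, hp2⟩, rfl⟩ h'
      exact hp2 fun _ => h' (mem_image_of_mem X hp)
  rw [h1]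
  refine nonpos_iff_eq_zero.1
    ((euclideanHausdorffMeasure_image_le (h.lipschitz.mono inter_subset_left) m).trans ?_)
  rw [EuclideanSpace.euclideanHausdorffMeasure_eq_volume,
    measure_mono_null inter_subset_right hP, mul_zero]

end GlobalChart

/-- Any regular `C^1` map into `F` is locally bi-Lipschitz, so that Lebesgue measure is locally
dominated by the pullback of the surface measure. -/
theorem exists_ball_map_le_surf {m : ℕ} {F : Set (Euc (m + 1))}
    {U : Set (Euc m)} {X : Euc m → Euc (m + 1)} (hU : IsOpen U) (hX : ContDiffOn ℝ 1 X U)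
    (hinj : ∀ p ∈ U, Function.Injective (fderiv ℝ X p)) (hXF : MapsTo X U F) {p₀ : Euc m}
    (hp₀ : p₀ ∈ U) : ∃ r > 0, Metric.ball p₀ r ⊆ U ∧
      (∃ c : ℝ≥0, (volume.restrict (Metric.ball p₀ r)).map X ≤ c • surf F) ∧
      ∃ B, ∀ p ∈ Metric.ball p₀ r, ‖fderiv ℝ X p‖ ≤ B := by
  have hst : HasStrictFDerivAt X (fderiv ℝ X p₀) p₀ :=
    (hX.contDiffAt (hU.mem_nhds hp₀)).hasStrictFDerivAt one_ne_zero
  obtain ⟨k, hk, hanti⟩ := LinearMap.exists_antilipschitzWith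
    (fderiv ℝ X p₀ : Euc m →ₗ[ℝ] Euc (m + 1)) (LinearMap.ker_eq_bot.2 (hinj p₀ hp₀))
  obtain ⟨s, hs, happ⟩ := hst.approximates_deriv_on_nhds (c := (2 * k)⁻¹)
    (Or.inr (by positivity))
  have hcontd : ContinuousAt (fderiv ℝ X) p₀ :=
    (hX.continuousOn_fderiv_of_isOpen hU le_rfl).continuousAt (hU.mem_nhds hp₀)
  have hb : ∀ᶠ p in 𝓝 p₀, ‖fderiv ℝ X p‖ < ‖fderiv ℝ X p₀‖ + 1 :=
    hcontd.norm.eventually_lt_const (by linarith)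
  obtain ⟨r, hr, hball⟩ := Metric.mem_nhds_iff.1 (inter_mem (inter_mem hs (hU.mem_nhds hp₀)) hb)
  have hV : Metric.ball p₀ r ⊆ U := fun p hp => (hball hp).1.2
  refine ⟨r, hr, hV, ?_, ‖fderiv ℝ X p₀‖ + 1, fun p hp => le_of_lt (hball hp).2⟩
  have hlow : ∀ p ∈ Metric.ball p₀ r, ∀ q ∈ Metric.ball p₀ r,
      dist p q ≤ (2 * k : ℝ≥0) * dist (X p) (X q) := by
    intro p hp q hq
    have h1 := happ p (hball hp).1.1 q (hball hq).1.1
    have h2 : ‖p - q‖ ≤ k * ‖fderiv ℝ X p₀ (p - q)‖ := by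
      have := hanti.le_mul_dist p q
      rw [dist_eq_norm, dist_eq_norm, ← map_sub] at this
      exact this
    have h3 := norm_sub_norm_le (fderiv ℝ X p₀ (p - q)) (X p - X q)
    rw [norm_sub_rev _ (X p - X q)] at h3
    have hk' : (0 : ℝ) < k := hk
    have h5 : ‖fderiv ℝ X p₀ (p - q)‖ ≤ ‖X p - X q‖ + (2 * k : ℝ)⁻¹ * ‖p - q‖ := by
      have : ((2 * k)⁻¹ : ℝ≥0) = ((2 * k : ℝ)⁻¹ : ℝ) := by push_cast; rfl
      rw [this] at h1
      linarith
    rw [dist_eq_norm, dist_eq_norm]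
    push_cast
    have h6 : (k : ℝ) * ‖fderiv ℝ X p₀ (p - q)‖ ≤ k * (‖X p - X q‖ + (2 * k : ℝ)⁻¹ * ‖p - q‖) := by
      gcongr
    have h7 : (k : ℝ) * (‖X p - X q‖ + (2 * k : ℝ)⁻¹ * ‖p - q‖) =
        k * ‖X p - X q‖ + ‖p - q‖ / 2 := by field_simp
    linarith
  have hinjV : InjOn X (Metric.ball p₀ r) := by
    intro p hp q hq hpq
    have := hlow p hp q hq
    rw [hpq, dist_self, mul_zero] at this
    exact dist_le_zero.1 this
  obtain ⟨g, hg⟩ : ∃ g : Euc (m + 1) → Euc m, LeftInvOn g X (Metric.ball p₀ r) :=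
    ⟨Function.invFunOn X (Metric.ball p₀ r), hinjV.leftInvOn_invFunOn⟩
  have hglip : LipschitzOnWith (2 * k) g (X '' Metric.ball p₀ r) := by
    refine LipschitzOnWith.of_dist_le_mul ?_
    rintro _ ⟨p, hp, rfl⟩ _ ⟨q, hq, rfl⟩
    rw [hg hp, hg hq]
    exact hlow p hp q hq
  refine ⟨(2 * k) ^ m, Measure.le_iff.2 fun s hs => ?_⟩
  have hXm : AEMeasurable X (volume.restrict (Metric.ball p₀ r)) :=
    (hX.continuousOn.mono hV).aemeasurable Metric.isOpen_ball.measurableSet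
  rw [Measure.map_apply_of_aemeasurable hXm hs,
    Measure.restrict_apply' Metric.isOpen_ball.measurableSet, Measure.smul_apply, surf,
    Measure.restrict_apply hs, ENNReal.smul_def, smul_eq_mul]
  have h1 : X ⁻¹' s ∩ Metric.ball p₀ r = g '' (X '' (X ⁻¹' s ∩ Metric.ball p₀ r)) := by
    rw [← image_comp]
    refine (EqOn.image_eq_self fun p hp => ?_).symm
    exact hg hp.2
  rw [h1, ← EuclideanSpace.euclideanHausdorffMeasure_eq_volume]
  refine (euclideanHausdorffMeasure_image_le
    (hglip.mono (image_mono inter_subset_right)) m).trans ?_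
  push_cast
  gcongr
  rintro _ ⟨p, hp, rfl⟩
  exact ⟨hp.1, hXF (hV hp.2)⟩

/-! ### Fractional norms -/

theorem ofReal_sq_eq_enorm_sq (x : ℝ) : ENNReal.ofReal (x ^ 2) = ‖x‖ₑ ^ 2 := by
  rw [Real.enorm_eq_ofReal_abs, ← ENNReal.ofReal_pow (abs_nonneg x), sq_abs]

theorem ENNReal.add_sq_le_two_mul (a b : ℝ≥0∞) : (a + b) ^ 2 ≤ 2 * a ^ 2 + 2 * b ^ 2 := by
  have := ENNReal.rpow_add_le_mul_rpow_add_rpow a b (p := 2) (by norm_num)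
  norm_num at this
  rw [← mul_add]
  exact_mod_cast this

theorem eLpNorm_two_sq {α : Type*} [MeasurableSpace α] (f : α → ℝ) (μ : Measure α) :
    eLpNorm f 2 μ ^ 2 = ∫⁻ x, ‖f x‖ₑ ^ 2 ∂μ := by
  have := eLpNorm_nnreal_pow_eq_lintegral (f := f) (μ := μ) (p := 2) (by norm_num)
  simpa using this

/-- The difference quotient whose `L²` norm is the Gagliardo seminorm. -/
def diffQuot {d : ℕ} (σ : ℝ) (v : Euc d → ℝ) (p : Euc d × Euc d) : ℝ :=
  (v p.1 - v p.2) * ‖p.1 - p.2‖ ^ (-(((d : ℝ) + 2 * σ) / 2))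

theorem diffQuot_sq {d : ℕ} (σ : ℝ) (v : Euc d → ℝ) (x y : Euc d) :
    diffQuot σ v (x, y) ^ 2 = (v x - v y) ^ 2 / ‖x - y‖ ^ ((d : ℝ) + 2 * σ) := by
  have h : (‖x - y‖ ^ (-(((d : ℝ) + 2 * σ) / 2))) ^ 2 = (‖x - y‖ ^ ((d : ℝ) + 2 * σ))⁻¹ := by
    rw [← Real.rpow_natCast (_ ^ _), ← Real.rpow_mul (norm_nonneg _),
      ← Real.rpow_neg (norm_nonneg _)]
    congr 1
    push_cast
    ring
  rw [diffQuot, mul_pow, h, div_eq_mul_inv]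

theorem measurable_norm_sub_rpow {d : ℕ} (a : ℝ) :
    Measurable fun p : Euc d × Euc d => ‖p.1 - p.2‖ ^ a := by
  fun_prop

theorem AEMeasurable.diffQuot {d : ℕ} {μ : Measure (Euc d)} [SFinite μ] {v : Euc d → ℝ}
    (hv : AEMeasurable v μ) (σ : ℝ) : AEMeasurable (diffQuot σ v) (μ.prod μ) :=
  ((hv.comp_fst).sub (hv.comp_snd)).mul (measurable_norm_sub_rpow _).aemeasurable

theorem gagliardoSq_eq_lintegral_prod {d : ℕ} {U : Set (Euc d)} {v : Euc d → ℝ}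
    (hv : AEMeasurable v (volume.restrict U)) (σ : ℝ) :
    gagliardoSq U σ v =
      ∫⁻ p, ‖diffQuot σ v p‖ₑ ^ 2 ∂((volume.restrict U).prod (volume.restrict U)) := by
  rw [lintegral_prod _ ((hv.diffQuot σ).enorm.pow_const 2)]
  simp only [gagliardoSq, ← diffQuot_sq, ofReal_sq_eq_enorm_sq]

theorem gagliardoSq_congr_ae {d : ℕ} {U : Set (Euc d)} {v w : Euc d → ℝ} (σ : ℝ)
    (h : v =ᵐ[volume.restrict U] w) : gagliardoSq U σ v = gagliardoSq U σ w := by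
  refine lintegral_congr_ae ?_
  filter_upwards [h] with x hx
  refine lintegral_congr_ae ?_
  filter_upwards [h] with y hy
  rw [hx, hy]

theorem fracNormSq_congr_ae {d : ℕ} {U : Set (Euc d)} {v w : Euc d → ℝ} (σ : ℝ)
    (h : v =ᵐ[volume.restrict U] w) : fracNormSq U σ v = fracNormSq U σ w := by
  rw [fracNormSq, fracNormSq, gagliardoSq_congr_ae σ h]
  congr 1
  refine lintegral_congr_ae ?_
  filter_upwards [h] with x hx
  rw [hx]

theorem gagliardoSq_mono_set {d : ℕ} {U V : Set (Euc d)} (h : U ⊆ V) (σ : ℝ) (v : Euc d → ℝ) :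
    gagliardoSq U σ v ≤ gagliardoSq V σ v :=
  (lintegral_mono_set h).trans (lintegral_mono fun _ => lintegral_mono_set h)

theorem fracNormSq_mono_set {d : ℕ} {U V : Set (Euc d)} (h : U ⊆ V) (σ : ℝ) (v : Euc d → ℝ) :
    fracNormSq U σ v ≤ fracNormSq V σ v :=
  add_le_add (lintegral_mono_set h) (gagliardoSq_mono_set h σ v)

theorem fracNormSq_neg {d : ℕ} (U : Set (Euc d)) (σ : ℝ) (v : Euc d → ℝ) :
    fracNormSq U σ (fun x => - v x) = fracNormSq U σ v := by
  have : ∀ x y, (-v x - -v y) ^ 2 = (v x - v y) ^ 2 := fun x y => by ring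
  simp only [fracNormSq, gagliardoSq, this, neg_sq]

theorem fracNormSq_sub_comm {d : ℕ} (U : Set (Euc d)) (σ : ℝ) (v w : Euc d → ℝ) :
    fracNormSq U σ (fun x => v x - w x) = fracNormSq U σ (fun x => w x - v x) := by
  rw [← fracNormSq_neg]
  simp

theorem lintegral_enorm_add_sq_le {α : Type*} [MeasurableSpace α] {μ : Measure α} {f g : α → ℝ}
    (hf : AEMeasurable f μ) :
    ∫⁻ x, ‖f x + g x‖ₑ ^ 2 ∂μ ≤ 2 * ∫⁻ x, ‖f x‖ₑ ^ 2 ∂μ + 2 * ∫⁻ x, ‖g x‖ₑ ^ 2 ∂μ := by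
  rw [← lintegral_const_mul'' _ (hf.enorm.pow_const 2),
    ← lintegral_const_mul' _ _ ENNReal.ofNat_ne_top,
    ← lintegral_add_left' ((hf.enorm.pow_const 2).const_mul 2)]
  refine lintegral_mono fun x => ?_
  refine le_trans ?_ (ENNReal.add_sq_le_two_mul _ _)
  gcongr
  exact enorm_add_le _ _

theorem fracNormSq_add_le {d : ℕ} {U : Set (Euc d)} {v w : Euc d → ℝ}
    (hv : AEMeasurable v (volume.restrict U)) (hw : AEMeasurable w (volume.restrict U)) (σ : ℝ) :
    fracNormSq U σ (fun x => v x + w x) ≤ 2 * fracNormSq U σ v + 2 * fracNormSq U σ w := by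
  have hvw : AEMeasurable (fun x => v x + w x) (volume.restrict U) := hv.add hw
  simp only [fracNormSq, gagliardoSq_eq_lintegral_prod hv, gagliardoSq_eq_lintegral_prod hw,
    gagliardoSq_eq_lintegral_prod hvw, ofReal_sq_eq_enorm_sq, mul_add]
  have h1 := lintegral_enorm_add_sq_le (g := w) hv
  have h2 := lintegral_enorm_add_sq_le (g := diffQuot σ w) (hv.diffQuot σ)
  have h3 : ∀ p, diffQuot σ (fun x => v x + w x) p = diffQuot σ v p + diffQuot σ w p := fun p => by
    simp only [diffQuot]; ring
  simp only [h3]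
  refine (add_le_add h1 h2).trans (le_of_eq ?_)
  ring

theorem fracNormSq_sub_le {d : ℕ} {U : Set (Euc d)} {v w u : Euc d → ℝ}
    (hv : AEMeasurable v (volume.restrict U)) (hw : AEMeasurable w (volume.restrict U))
    (hu : AEMeasurable u (volume.restrict U)) (σ : ℝ) :
    fracNormSq U σ (fun x => v x - w x) ≤
      2 * fracNormSq U σ (fun x => v x - u x) + 2 * fracNormSq U σ (fun x => u x - w x) := by
  have := fracNormSq_add_le (v := fun x => v x - u x) (w := fun x => u x - w x)
    (hv.sub hu) (hu.sub hw) σ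
  simpa using this

/-- On bounded sets the fractional norms increase with the order, up to a constant. -/
theorem exists_fracNormSq_le_of_le {d : ℕ} {U : Set (Euc d)} (hU : Bornology.IsBounded U)
    (hUm : MeasurableSet U) {σ τ : ℝ} (hτ : τ ≤ σ) :
    ∃ c : ℝ≥0, ∀ v : Euc d → ℝ, fracNormSq U τ v ≤ c * fracNormSq U σ v := by
  obtain ⟨R, hR⟩ := hU.exists_norm_le
  set D : ℝ := 2 * max R 0 with hD
  have hD0 : 0 ≤ D := by positivity
  set c₀ : ℝ := D ^ (2 * (σ - τ)) with hc₀
  have hc₀0 : 0 ≤ c₀ := by positivity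
  have key : ∀ x ∈ U, ∀ y ∈ U, ∀ v : Euc d → ℝ,
      ENNReal.ofReal ((v x - v y) ^ 2 / ‖x - y‖ ^ ((d : ℝ) + 2 * τ)) ≤
        ENNReal.ofReal c₀ *
          ENNReal.ofReal ((v x - v y) ^ 2 / ‖x - y‖ ^ ((d : ℝ) + 2 * σ)) := by
    intro x hx y hy v
    rw [← ENNReal.ofReal_mul hc₀0]
    refine ENNReal.ofReal_le_ofReal ?_
    rcases eq_or_ne x y with rfl | hxy
    · simp
    have hpos : 0 < ‖x - y‖ := norm_pos_iff.2 (sub_ne_zero.2 hxy)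
    have hle : ‖x - y‖ ≤ D := (norm_sub_le _ _).trans (by
      have h1 := hR x hx
      have h2 := hR y hy
      have := le_max_left R 0
      linarith)
    have h1 : ‖x - y‖ ^ ((d : ℝ) + 2 * σ) =
        ‖x - y‖ ^ ((d : ℝ) + 2 * τ) * ‖x - y‖ ^ (2 * (σ - τ)) := by
      rw [← Real.rpow_add hpos]; ring_nf
    have h2 : ‖x - y‖ ^ (2 * (σ - τ)) ≤ c₀ :=
      Real.rpow_le_rpow hpos.le hle (by linarith)
    have hp1 : 0 < ‖x - y‖ ^ ((d : ℝ) + 2 * τ) := Real.rpow_pos_of_pos hpos _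
    have hp2 : 0 < ‖x - y‖ ^ (2 * (σ - τ)) := Real.rpow_pos_of_pos hpos _
    rw [h1, mul_div_assoc', div_le_div_iff₀ hp1 (by positivity)]
    nlinarith [mul_nonneg (mul_nonneg (sq_nonneg (v x - v y)) hp1.le) (sub_nonneg.2 h2)]
  refine ⟨max 1 c₀.toNNReal, fun v => ?_⟩
  rw [fracNormSq, fracNormSq, mul_add]
  refine add_le_add ?_ ?_
  · refine le_mul_of_one_le_left' ?_
    exact_mod_cast le_max_left (1 : ℝ≥0) c₀.toNNReal
  · calc gagliardoSq U τ v ≤ ENNReal.ofReal c₀ * gagliardoSq U σ v := by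
          simp only [gagliardoSq]
          rw [← lintegral_const_mul' _ _ ENNReal.ofReal_ne_top]
          refine setLIntegral_mono' hUm fun x hx => ?_
          rw [← lintegral_const_mul' _ _ ENNReal.ofReal_ne_top]
          exact setLIntegral_mono' hUm fun y hy => key x hx y hy v
      _ ≤ _ := by
          gcongr
          exact ENNReal.coe_le_coe.2 (le_max_right (1 : ℝ≥0) c₀.toNNReal)

theorem exists_lintegral_rpow_norm_le {d : ℕ} (hd : 0 < d) {a : ℝ} (ha : a < d) (R : ℝ) :
    ∃ c : ℝ≥0, ∀ x : Euc d,
      ∫⁻ y in Metric.ball x R, ENNReal.ofReal (‖x - y‖ ^ (-a)) ≤ c := by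
  rcases le_or_gt R 0 with hR | hR
  · exact ⟨0, fun x => by simp [Metric.ball_eq_empty.2 hR]⟩
  have : Nonempty (Fin d) := ⟨⟨0, hd⟩⟩
  have : Nontrivial (Euc d) := inferInstance
  have hint : IntegrableOn (fun y : Euc d => ‖y‖ ^ (-a)) (Metric.ball 0 R) volume := by
    rw [integrableOn_fun_norm_addHaar (μ := volume) (f := fun t : ℝ => t ^ (-a))]
    simp only [finrank_euclideanSpace, Fintype.card_fin, smul_eq_mul]
    have h1 : IntegrableOn (fun t : ℝ => t ^ ((d : ℝ) - 1 - a)) (Ioo 0 R) :=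
      (intervalIntegral.integrableOn_Ioo_rpow_iff hR).2 (by linarith)
    refine h1.congr_fun (fun t ht => ?_) measurableSet_Ioo
    dsimp only
    rw [sub_eq_add_neg _ a, Real.rpow_add ht.1, ← Real.rpow_natCast, Nat.cast_sub hd,
      Nat.cast_one]
  have hlt := hint.lintegral_lt_top
  refine ⟨(∫⁻ y in Metric.ball (0 : Euc d) R, ENNReal.ofReal (‖y‖ ^ (-a))).toNNReal, fun x => ?_⟩
  rw [ENNReal.coe_toNNReal hlt.ne, ← lintegral_indicator Metric.isOpen_ball.measurableSet,
    ← lintegral_indicator Metric.isOpen_ball.measurableSet, ← lintegral_sub_right_eq_self (indicator (Metric.ball 0 R) _) x]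
  refine le_of_eq (lintegral_congr fun y => ?_)
  simp only [indicator, Metric.mem_ball, dist_eq_norm, sub_zero, norm_sub_rev x y]

/-- Multiplication by a bounded Lipschitz function is bounded in the fractional norms of order less
than one on a bounded set. -/
theorem exists_fracNormSq_mul_le {d : ℕ} (hd : 0 < d) {U : Set (Euc d)}
    (hU : Bornology.IsBounded U) (hUm : MeasurableSet U) {σ : ℝ} (hσ : σ < 1) {χ : Euc d → ℝ} {b : ℝ} {l : ℝ≥0}
    (hχb : ∀ x, |χ x| ≤ b) (hχl : LipschitzWith l χ) :
    ∃ c : ℝ≥0, ∀ v : Euc d → ℝ, AEMeasurable v (volume.restrict U) →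
      fracNormSq U σ (fun x => χ x * v x) ≤ c * fracNormSq U σ v := by
  obtain ⟨R, hR⟩ := hU.exists_norm_le
  have hUb : ∀ x ∈ U, U ⊆ Metric.ball x (2 * R + 1) := fun x hx y hy => by
    rw [mem_ball_iff_norm]
    have h1 := hR x hx
    have h2 := hR y hy
    have := norm_sub_le y x
    linarith
  have hb : 0 ≤ b := (abs_nonneg _).trans (hχb 0)
  obtain ⟨c₁, hc₁⟩ := exists_lintegral_rpow_norm_le hd (a := (d : ℝ) + 2 * σ - 2) (by linarith)
    (2 * R + 1)
  have hχb2 : ∀ x, χ x ^ 2 ≤ b ^ 2 := fun x => sq_le_sq' (by linarith [abs_le.1 (hχb x)])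
    (abs_le.1 (hχb x)).2
  have key : ∀ (v : Euc d → ℝ) (x y : Euc d),
      ENNReal.ofReal ((χ x * v x - χ y * v y) ^ 2 / ‖x - y‖ ^ ((d : ℝ) + 2 * σ)) ≤
        ENNReal.ofReal (2 * b ^ 2) *
          ENNReal.ofReal ((v x - v y) ^ 2 / ‖x - y‖ ^ ((d : ℝ) + 2 * σ)) +
        ENNReal.ofReal (2 * l ^ 2 * v x ^ 2) *
          ENNReal.ofReal (‖x - y‖ ^ (-((d : ℝ) + 2 * σ - 2))) := by
    intro v x y
    rw [← ENNReal.ofReal_mul (by positivity), ← ENNReal.ofReal_mul (by positivity),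
      ← ENNReal.ofReal_add (by positivity) (by positivity)]
    refine ENNReal.ofReal_le_ofReal ?_
    rcases eq_or_ne x y with rfl | hxy
    · simp only [sub_self]
      norm_num
      positivity
    have hpos : 0 < ‖x - y‖ := norm_pos_iff.2 (sub_ne_zero.2 hxy)
    have h1 : ‖x - y‖ ^ (-((d : ℝ) + 2 * σ - 2)) = ‖x - y‖ ^ 2 / ‖x - y‖ ^ ((d : ℝ) + 2 * σ) := by
      rw [eq_div_iff (by positivity), ← Real.rpow_add hpos, ← Real.rpow_natCast]
      congr 1
      push_cast
      ring
    rw [h1, mul_div_assoc', mul_div_assoc', ← add_div]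
    refine div_le_div_of_nonneg_right ?_ (by positivity)
    have h2 : (χ x - χ y) ^ 2 ≤ l ^ 2 * ‖x - y‖ ^ 2 := by
      have := hχl.dist_le_mul x y
      rw [Real.dist_eq, dist_eq_norm] at this
      rw [← mul_pow]
      exact sq_le_sq' (by linarith [neg_abs_le (χ x - χ y)]) ((le_abs_self _).trans this)
    have h3 : (χ x * v x - χ y * v y) ^ 2 ≤
        2 * (χ y ^ 2 * (v x - v y) ^ 2) + 2 * (v x ^ 2 * (χ x - χ y) ^ 2) := by
      nlinarith [sq_nonneg (χ y * (v x - v y) - v x * (χ x - χ y))]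
    have h4 := mul_le_mul_of_nonneg_right (hχb2 y) (sq_nonneg (v x - v y))
    have h5 := mul_le_mul_of_nonneg_left h2 (sq_nonneg (v x))
    linarith
  refine ⟨(b ^ 2).toNNReal + (2 * b ^ 2).toNNReal + 2 * l ^ 2 * c₁, fun v hv => ?_⟩
  have hL2 : ∫⁻ x in U, ENNReal.ofReal ((χ x * v x) ^ 2) ≤
      ENNReal.ofReal (b ^ 2) * ∫⁻ x in U, ENNReal.ofReal (v x ^ 2) := by
    rw [← lintegral_const_mul' _ _ ENNReal.ofReal_ne_top]
    refine lintegral_mono fun x => ?_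
    dsimp only
    rw [← ENNReal.ofReal_mul (by positivity), mul_pow]
    exact ENNReal.ofReal_le_ofReal (mul_le_mul_of_nonneg_right (hχb2 x) (sq_nonneg _))
  have hG : gagliardoSq U σ (fun x => χ x * v x) ≤
      ENNReal.ofReal (2 * b ^ 2) * gagliardoSq U σ v +
        (2 * l ^ 2 * c₁ : ℝ≥0) * ∫⁻ x in U, ENNReal.ofReal (v x ^ 2) := by
    simp only [gagliardoSq]
    rw [← lintegral_const_mul' _ _ ENNReal.ofReal_ne_top,
      ← lintegral_const_mul' _ _ ENNReal.coe_ne_top,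
      ← lintegral_add_right' _ ((hv.pow_const 2).ennreal_ofReal.const_mul _)]
    refine lintegral_mono_ae ((ae_restrict_mem hUm).mono fun x hx => ?_)
    calc _ ≤ ∫⁻ y in U, (ENNReal.ofReal (2 * b ^ 2) *
          ENNReal.ofReal ((v x - v y) ^ 2 / ‖x - y‖ ^ ((d : ℝ) + 2 * σ)) +
        ENNReal.ofReal (2 * l ^ 2 * v x ^ 2) *
          ENNReal.ofReal (‖x - y‖ ^ (-((d : ℝ) + 2 * σ - 2)))) := lintegral_mono fun y => key v x y
      _ = ENNReal.ofReal (2 * b ^ 2) *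
          (∫⁻ y in U, ENNReal.ofReal ((v x - v y) ^ 2 / ‖x - y‖ ^ ((d : ℝ) + 2 * σ))) +
        ENNReal.ofReal (2 * l ^ 2 * v x ^ 2) *
          ∫⁻ y in U, ENNReal.ofReal (‖x - y‖ ^ (-((d : ℝ) + 2 * σ - 2))) := by
        rw [lintegral_add_right _ (by fun_prop), lintegral_const_mul' _ _ ENNReal.ofReal_ne_top,
          lintegral_const_mul' _ _ ENNReal.ofReal_ne_top]
      _ ≤ _ := by
        refine add_le_add le_rfl ?_
        calc _ ≤ ENNReal.ofReal (2 * l ^ 2 * v x ^ 2) * c₁ := by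
              gcongr
              exact (lintegral_mono_set (hUb x hx)).trans (hc₁ x)
          _ = _ := by
              rw [ENNReal.ofReal_mul (by positivity)]
              have : ENNReal.ofReal (2 * (l : ℝ) ^ 2) = ((2 * l ^ 2 : ℝ≥0) : ℝ≥0∞) := by
                rw [← ENNReal.ofReal_coe_nnreal]
                push_cast
                rfl
              rw [this]
              push_cast
              ring
  rw [fracNormSq, fracNormSq]
  set I := ∫⁻ x in U, ENNReal.ofReal (v x ^ 2)
  set G := gagliardoSq U σ v
  calc _ ≤ ENNReal.ofReal (b ^ 2) * I + (ENNReal.ofReal (2 * b ^ 2) * G +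
        (2 * l ^ 2 * c₁ : ℝ≥0) * I) := add_le_add hL2 hG
    _ ≤ ENNReal.ofReal (b ^ 2) * (I + G) + (ENNReal.ofReal (2 * b ^ 2) * (I + G) +
        (2 * l ^ 2 * c₁ : ℝ≥0) * (I + G)) := by
      gcongr
      · exact le_self_add
      · exact le_add_self
      · exact le_self_add
    _ = _ := by
      rw [ENNReal.coe_add, ENNReal.coe_add, add_mul, add_mul, add_assoc]
      rfl

theorem fracNormSq_lt_top_of_lipschitz {d : ℕ} (hd : 0 < d) {U : Set (Euc d)}
    (hU : Bornology.IsBounded U) (hUm : MeasurableSet U) {σ : ℝ} (hσ : σ < 1) {χ : Euc d → ℝ}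
    {b : ℝ} {l : ℝ≥0} (hχb : ∀ x, |χ x| ≤ b) (hχl : LipschitzWith l χ) :
    fracNormSq U σ χ < ⊤ := by
  obtain ⟨c, hc⟩ := exists_fracNormSq_mul_le hd hU hUm hσ hχb hχl
  have h1 := hc (fun _ => 1) aemeasurable_const
  simp only [mul_one] at h1
  refine h1.trans_lt (ENNReal.mul_lt_top ENNReal.coe_lt_top ?_)
  simp [fracNormSq, gagliardoSq, hU.measure_lt_top]

theorem HasCompactSupport.exists_bound_lipschitz {d : ℕ} {φ : Euc d → ℝ} (hφ : ContDiff ℝ ∞ φ)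
    (hc : HasCompactSupport φ) : ∃ (b : ℝ) (l : ℝ≥0), (∀ x, |φ x| ≤ b) ∧ LipschitzWith l φ := by
  obtain ⟨b, hb⟩ := hc.exists_bound_of_continuous hφ.continuous
  obtain ⟨l, hl⟩ := (hφ.of_le (by norm_num)).lipschitzWith_of_hasCompactSupport hc one_ne_zero
  exact ⟨b, l, hb, hl⟩

/-! ### Averages along cones -/

/-- A smooth compactly supported probability density. -/
structure IsMollifier {d : ℕ} (η : Euc d → ℝ) : Prop where
  contDiff : ContDiff ℝ ∞ η
  nonneg : ∀ z, 0 ≤ η z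
  hasCompactSupport : HasCompactSupport η
  integral : ∫ z, η z = 1

namespace IsMollifier

variable {d : ℕ} {η : Euc d → ℝ}

theorem integrable (h : IsMollifier η) : Integrable η :=
  h.contDiff.continuous.integrable_of_hasCompactSupport h.hasCompactSupport

theorem measurable (h : IsMollifier η) : Measurable η := h.contDiff.continuous.measurable

theorem lintegral (h : IsMollifier η) : ∫⁻ z, ENNReal.ofReal (η z) = 1 := by
  rw [← ofReal_integral_eq_lintegral_ofReal h.integrable (Eventually.of_forall h.nonneg),
    h.integral, ENNReal.ofReal_one]

/-- Jensen's inequality for the square of a weighted average. -/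
theorem enorm_integral_mul_sq_le (h : IsMollifier η) {g : Euc d → ℝ} (hg : Measurable g) :
    ‖∫ z, η z * g z‖ₑ ^ 2 ≤ ∫⁻ z, ENNReal.ofReal (η z) * ‖g z‖ₑ ^ 2 := by
  have hm : Measurable fun z => ENNReal.ofReal (η z) := h.measurable.ennreal_ofReal
  have hprob : IsProbabilityMeasure (volume.withDensity fun z => ENNReal.ofReal (η z)) :=
    ⟨by rw [withDensity_apply _ MeasurableSet.univ, setLIntegral_univ, h.lintegral]⟩
  have h1 : ‖∫ z, η z * g z‖ₑ ≤
      eLpNorm g 1 (volume.withDensity fun z => ENNReal.ofReal (η z)) := by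
    rw [eLpNorm_one_eq_lintegral_enorm, lintegral_withDensity_eq_lintegral_mul _ hm hg.enorm]
    refine (enorm_integral_le_lintegral_enorm _).trans (le_of_eq (lintegral_congr fun z => ?_))
    rw [enorm_mul, Real.enorm_of_nonneg (h.nonneg z)]
    rfl
  have h2 := eLpNorm_le_eLpNorm_of_exponent_le (μ := volume.withDensity fun z =>
    ENNReal.ofReal (η z)) (f := g) (p := 1) (q := 2) (by norm_num) hg.aestronglyMeasurable
  calc _ ≤ eLpNorm g 2 (volume.withDensity fun z => ENNReal.ofReal (η z)) ^ 2 := by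
        gcongr; exact h1.trans h2
    _ = _ := by
        rw [eLpNorm_two_sq, lintegral_withDensity_eq_lintegral_mul _ hm (hg.enorm.pow_const 2)]
        rfl

end IsMollifier

/-- Translations act continuously on `L²`. -/
theorem tendsto_eLpNorm_translate {V : Type*} [NormedAddCommGroup V] [NormedSpace ℝ V]
    [FiniteDimensional ℝ V] [MeasurableSpace V] [BorelSpace V] {μ : Measure V} [μ.IsAddHaarMeasure]
    {h : V → ℝ} (hh : MemLp h 2 μ) :
    Tendsto (fun v => eLpNorm (fun x => h (x + v) - h x) 2 μ) (𝓝 0) (𝓝 0) := by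
  have : Fact ((2 : ℝ≥0∞) ≠ ⊤) := ⟨by norm_num⟩
  have hcont : Continuous fun v : V => (DomAddAct.mk v +ᵥ hh.toLp : Lp ℝ 2 μ) :=
    (show Continuous fun v : V => DomAddAct.mk v from
      DomAddAct.mkHomeomorph.continuous).vadd continuous_const
  have h1 := (hcont.tendsto 0).edist (tendsto_const_nhds (x := hh.toLp))
  have h0 : (DomAddAct.mk (0 : V) +ᵥ hh.toLp : Lp ℝ 2 μ) = hh.toLp := by
    rw [DomAddAct.mk_vadd_toLp]
    simp
  rw [h0, edist_self] at h1
  refine h1.congr fun v => ?_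
  rw [DomAddAct.mk_vadd_toLp, Lp.edist_toLp_toLp]
  congr 1
  ext x
  simp [add_comm]

/-- Averages against `η (z) dz` of translates by `t • ι z` converge in `L²` as `t → 0`. With `ι` the
identity this concerns a function, with `ι z = (z, z)` its difference quotient. -/
theorem tendsto_lintegral_average {V : Type*} [NormedAddCommGroup V] [NormedSpace ℝ V]
    [FiniteDimensional ℝ V] [MeasurableSpace V] [BorelSpace V] {μ : Measure V} [μ.IsAddHaarMeasure]
    {d : ℕ} {η : Euc d → ℝ} (hη : IsMollifier η) (ι : Euc d →L[ℝ] V) {h : V → ℝ}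
    (hm : Measurable h) (hh : MemLp h 2 μ) :
    Tendsto (fun t : ℝ => ∫⁻ x, ‖∫ z, η z * (h (x + t • ι z) - h x)‖ₑ ^ 2 ∂μ) (𝓝 0) (𝓝 0) := by
  have : SecondCountableTopology V := inferInstance
  have hmeas : ∀ t : ℝ, Measurable fun p : V × Euc d => h (p.1 + t • ι p.2) - h p.1 := fun t => by
    have : Measurable fun p : V × Euc d => p.1 + t • ι p.2 :=
      (by fun_prop : Continuous fun p : V × Euc d => p.1 + t • ι p.2).measurable
    exact (hm.comp this).sub (hm.comp measurable_fst)
  have hle : ∀ t : ℝ, ∫⁻ x, ‖∫ z, η z * (h (x + t • ι z) - h x)‖ₑ ^ 2 ∂μ ≤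
      ∫⁻ z, ENNReal.ofReal (η z) * eLpNorm (fun x => h (x + t • ι z) - h x) 2 μ ^ 2 := by
    intro t
    calc _ ≤ ∫⁻ x, ∫⁻ z, ENNReal.ofReal (η z) * ‖h (x + t • ι z) - h x‖ₑ ^ 2 ∂volume ∂μ := by
          refine lintegral_mono fun x => hη.enorm_integral_mul_sq_le ?_
          exact (hmeas t).comp measurable_prodMk_left
      _ = ∫⁻ z, ∫⁻ x, ENNReal.ofReal (η z) * ‖h (x + t • ι z) - h x‖ₑ ^ 2 ∂μ := by
          refine lintegral_lintegral_swap ?_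
          exact (((hη.measurable.comp measurable_snd).ennreal_ofReal).mul
            ((hmeas t).enorm.pow_const 2)).aemeasurable
      _ = _ := by
          refine lintegral_congr fun z => ?_
          rw [lintegral_const_mul' _ _ ENNReal.ofReal_ne_top, eLpNorm_two_sq]
  obtain ⟨R, hR⟩ := hη.hasCompactSupport.isCompact.isBounded.exists_norm_le
  rw [ENNReal.tendsto_nhds_zero]
  intro ε hε
  have h1 : Tendsto (fun v => eLpNorm (fun x => h (x + v) - h x) 2 μ ^ 2) (𝓝 0) (𝓝 0) := by
    have := (ENNReal.continuous_pow 2).tendsto 0 |>.comp (tendsto_eLpNorm_translate hh)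
    simpa using! this
  obtain ⟨δ, hδ, hball⟩ := Metric.eventually_nhds_iff.1 (ENNReal.tendsto_nhds_zero.1 h1 ε hε)
  have hMpos : 0 < ‖ι‖ * max R 0 + 1 := by positivity
  filter_upwards [Metric.ball_mem_nhds (0 : ℝ) (show 0 < δ / (‖ι‖ * max R 0 + 1) by positivity)]
    with t ht
  rw [mem_ball_zero_iff, lt_div_iff₀ hMpos] at ht
  refine (hle t).trans ?_
  calc _ ≤ ∫⁻ z, ENNReal.ofReal (η z) * ε := by
        refine lintegral_mono fun z => ?_
        by_cases hz : z ∈ tsupport η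
        · gcongr
          refine hball ?_
          rw [dist_zero_right, norm_smul]
          have h2 := ι.le_opNorm z
          have h3 : ‖z‖ ≤ max R 0 := (hR z hz).trans (le_max_left _ _)
          have h4 : ‖ι z‖ ≤ ‖ι‖ * max R 0 := h2.trans (by gcongr)
          have h5 : ‖t‖ * ‖ι z‖ ≤ ‖t‖ * (‖ι‖ * max R 0 + 1) := by gcongr; linarith
          linarith
        · simp [image_eq_zero_of_notMem_tsupport hz]
    _ = ε := by rw [lintegral_mul_const _ hη.measurable.ennreal_ofReal, hη.lintegral, one_mul]

/-- The average of `f` over the points `x + t • z`, weighted by `η z`. When `η` is supported in a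
ball, this mollifies `f` with values taken in the part of a cone with vertex `x`. -/
def coneAvg {d : ℕ} (η : Euc d → ℝ) (t : ℝ) (f : Euc d → ℝ) (x : Euc d) : ℝ :=
  ∫ z, η z * f (x + t • z)

namespace IsMollifier

variable {d : ℕ} {η : Euc d → ℝ}

theorem integrable_mul_comp (hη : IsMollifier η) {f : Euc d → ℝ} (hf : MemLp f 2 volume)
    (x : Euc d) {t : ℝ} (ht : t ≠ 0) : Integrable fun z => η z * f (x + t • z) := by
  have hηL : MemLp η 2 volume :=
    hη.contDiff.continuous.memLp_of_hasCompactSupport hη.hasCompactSupport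
  have h1 : MemLp (fun z => f (x + z)) 2 volume :=
    hf.comp_measurePreserving (measurePreserving_add_left volume x)
  have h2 : MemLp (fun z => f (x + t • z)) 2 volume := by
    have hqmp : Measure.QuasiMeasurePreserving (fun z : Euc d => t • z) volume volume := by
      refine ⟨by fun_prop, ?_⟩
      rw [Measure.map_addHaar_smul _ ht]
      exact Measure.smul_absolutelyContinuous
    have hae : AEStronglyMeasurable (fun z => f (x + t • z)) volume :=
      h1.aestronglyMeasurable.comp_quasiMeasurePreserving hqmp
    rw [memLp_two_iff_integrable_sq hae]
    exact ((memLp_two_iff_integrable_sq h1.aestronglyMeasurable).1 h1).comp_smul ht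
  exact hηL.integrable_mul h2

theorem integral_mul_const (hη : IsMollifier η) (c : ℝ) : ∫ z, η z * c = c := by
  rw [MeasureTheory.integral_mul_const, hη.integral, one_mul]

/-- Averages over cones of vanishing height converge in the fractional norms. -/
theorem tendsto_fracNormSq_coneAvg (hη : IsMollifier η) {K E : Set (Euc d)}
    (hK : MeasurableSet K) (hE : MeasurableSet E) (hEK : E ⊆ K)
    (hcone : ∀ᶠ t : ℝ in 𝓝[>] 0, ∀ x ∈ E, ∀ z ∈ tsupport η, x + t • z ∈ K)
    {f : Euc d → ℝ} (hfm : Measurable f) (hf : MemLp f 2 volume) {σ : ℝ}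
    (hfσ : fracNormSq K σ f < ⊤) :
    Tendsto (fun t => fracNormSq E σ (fun x => coneAvg η t f x - f x)) (𝓝[>] 0) (𝓝 0) := by
  set h : Euc d × Euc d → ℝ := indicator (K ×ˢ K) (diffQuot σ f) with hh
  have hdm : Measurable (diffQuot σ f) :=
    ((hfm.comp measurable_fst).sub (hfm.comp measurable_snd)).mul (measurable_norm_sub_rpow _)
  have hhm : Measurable h := hdm.indicator (hK.prod hK)
  have hhL : MemLp h 2 ((volume : Measure (Euc d)).prod (volume : Measure (Euc d))) := by
    refine ⟨hhm.aestronglyMeasurable, ?_⟩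
    have h1 : gagliardoSq K σ f < ⊤ := lt_of_le_of_lt le_add_self hfσ
    rw [gagliardoSq_eq_lintegral_prod hfm.aemeasurable, ← eLpNorm_two_sq,
      Measure.prod_restrict] at h1
    rw [hh, eLpNorm_indicator_eq_eLpNorm_restrict (hK.prod hK)]
    by_contra hcon
    rw [not_lt, top_le_iff] at hcon
    rw [hcon] at h1
    simp at h1
  have hL := tendsto_lintegral_average hη (ContinuousLinearMap.id ℝ (Euc d)) hfm hf
  have hG := tendsto_lintegral_average hη
    ((ContinuousLinearMap.id ℝ (Euc d)).prod (ContinuousLinearMap.id ℝ (Euc d))) hhm hhL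
  have hsum := (hL.add hG).mono_left (nhdsWithin_le_nhds (s := Ioi (0 : ℝ)))
  rw [add_zero] at hsum
  refine tendsto_of_tendsto_of_tendsto_of_le_of_le' tendsto_const_nhds hsum
    (Eventually.of_forall fun _ => zero_le) ?_
  filter_upwards [hcone, self_mem_nhdsWithin] with t ht ht0
  have ht0' : t ≠ 0 := (ne_of_gt ht0)
  have hrep : ∀ x, coneAvg η t f x - f x = ∫ z, η z * (f (x + t • z) - f x) := by
    intro x
    simp only [mul_sub]
    rw [integral_sub (hη.integrable_mul_comp hf x ht0') (hη.integrable.mul_const _),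
      hη.integral_mul_const, coneAvg]
  have hmm : Measurable fun x => coneAvg η t f x - f x := by
    refine Measurable.sub ?_ hfm
    have : StronglyMeasurable fun p : Euc d × Euc d => η p.2 * f (p.1 + t • p.2) := by
      refine Measurable.stronglyMeasurable ?_
      exact (hη.measurable.comp measurable_snd).mul (hfm.comp (by fun_prop))
    exact this.integral_prod_right.measurable
  rw [fracNormSq, gagliardoSq_eq_lintegral_prod hmm.aemeasurable, Measure.prod_restrict]
  refine add_le_add ?_ ?_
  · refine (lintegral_mono fun x => ?_).trans (setLIntegral_le_lintegral E _)
    rw [ofReal_sq_eq_enorm_sq, hrep]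
    rfl
  · refine (setLIntegral_mono' (hE.prod hE) ?_).trans (setLIntegral_le_lintegral (E ×ˢ E) _)
    rintro ⟨x, y⟩ ⟨hx, hy⟩
    refine le_of_eq ?_
    congr 2
    have h1 : ∀ z, η z * (h ((x, y) + t • ((ContinuousLinearMap.id ℝ (Euc d)).prod
        (ContinuousLinearMap.id ℝ (Euc d))) z) - h (x, y)) =
        (η z * (f (x + t • z) - f x) - η z * (f (y + t • z) - f y)) *
          ‖x - y‖ ^ (-(((d : ℝ) + 2 * σ) / 2)) := by
      intro z
      by_cases hz : z ∈ tsupport η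
      · have h2 : (x + t • z, y + t • z) ∈ K ×ˢ K := ⟨ht x hx z hz, ht y hy z hz⟩
        have h3 : (x, y) ∈ K ×ˢ K := ⟨hEK hx, hEK hy⟩
        have h4 : (x, y) + t • ((ContinuousLinearMap.id ℝ (Euc d)).prod
          (ContinuousLinearMap.id ℝ (Euc d))) z = (x + t • z, y + t • z) := rfl
        rw [h4, hh, indicator_of_mem h2, indicator_of_mem h3]
        simp only [diffQuot, add_sub_add_right_eq_sub]
        ring
      · simp [image_eq_zero_of_notMem_tsupport hz]
    have hint : ∀ x, Integrable fun z => η z * (f (x + t • z) - f x) := fun x => by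
      simp only [mul_sub]
      exact (hη.integrable_mul_comp hf x ht0').sub (hη.integrable.mul_const _)
    simp only [h1]
    rw [MeasureTheory.integral_mul_const, integral_sub (hint x) (hint y), ← hrep, ← hrep, diffQuot]

/-- The convolution kernel that produces `coneAvg η t`. -/
theorem coneAvg_eq_convolution (t : ℝ) (ht : 0 < t) (f : Euc d → ℝ) :
    coneAvg η t f = convolution f (fun u => t⁻¹ ^ d * η (-(t⁻¹ • u)))
      (ContinuousLinearMap.mul ℝ ℝ) volume := by
  ext x
  rw [convolution_def, coneAvg]
  have h1 := Measure.integral_comp_smul (volume : Measure (Euc d))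
    (fun z => η (t⁻¹ • z) * f (x + z)) t
  have h2 : ∀ z : Euc d, η (t⁻¹ • t • z) * f (x + t • z) = η z * f (x + t • z) := fun z => by
    rw [smul_smul, inv_mul_cancel₀ ht.ne', one_smul]
  simp only [h2] at h1
  have h3 : |(t ^ Module.finrank ℝ (Euc d))⁻¹| = t⁻¹ ^ d := by
    rw [abs_of_pos (by positivity), finrank_euclideanSpace, Fintype.card_fin, inv_pow]
  have h4 := integral_add_left_eq_self (μ := (volume : Measure (Euc d)))
    (fun y => (ContinuousLinearMap.mul ℝ ℝ) (f y) (t⁻¹ ^ d * η (-(t⁻¹ • (x - y))))) x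
  rw [h1, h3, smul_eq_mul, ← integral_const_mul, ← h4]
  refine integral_congr_ae (Eventually.of_forall fun z => ?_)
  simp only [ContinuousLinearMap.mul_apply', sub_add_cancel_left, smul_neg, neg_neg]
  ring

end IsMollifier

theorem exists_isMollifier {d : ℕ} (w : Euc d) {r : ℝ} (hr : 0 < r) :
    ∃ η : Euc d → ℝ, IsMollifier η ∧ tsupport η ⊆ Metric.closedBall w r := by
  let b : ContDiffBump w := ⟨r / 2, r, by positivity, by linarith⟩
  exact ⟨b.normed volume, ⟨b.contDiff_normed, b.nonneg_normed, b.hasCompactSupport_normed,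
    b.integral_normed⟩, b.tsupport_normed_eq.subset⟩

namespace IsMollifier

variable {d : ℕ} {η : Euc d → ℝ}

theorem contDiff_kernel (hη : IsMollifier η) (t : ℝ) :
    ContDiff ℝ ∞ fun u : Euc d => t⁻¹ ^ d * η (-(t⁻¹ • u)) :=
  contDiff_const.mul (hη.contDiff.comp (contDiff_id.const_smul t⁻¹).neg)

theorem hasCompactSupport_kernel (hη : IsMollifier η) {t : ℝ} (ht : 0 < t) :
    HasCompactSupport fun u : Euc d => t⁻¹ ^ d * η (-(t⁻¹ • u)) := by
  have h1 : HasCompactSupport fun u : Euc d => η ((-t⁻¹) • u) :=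
    hη.hasCompactSupport.comp_smul (by simpa using ht.ne')
  have h2 : HasCompactSupport fun u : Euc d => η (-(t⁻¹ • u)) := by simpa using h1
  exact h2.mul_left

theorem contDiff_coneAvg (hη : IsMollifier η) {t : ℝ} (ht : 0 < t) {f : Euc d → ℝ}
    (hf : LocallyIntegrable f volume) : ContDiff ℝ ∞ (coneAvg η t f) := by
  rw [coneAvg_eq_convolution t ht]
  exact (hη.hasCompactSupport_kernel ht).contDiff_convolution_right _ hf (hη.contDiff_kernel t)

theorem hasCompactSupport_coneAvg (hη : IsMollifier η) {t : ℝ} (ht : 0 < t) {f : Euc d → ℝ}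
    (hf : HasCompactSupport f) : HasCompactSupport (coneAvg η t f) := by
  rw [coneAvg_eq_convolution t ht]
  exact hf.convolution _ (hη.hasCompactSupport_kernel ht)

/-- Averaging over cones commutes with weak derivatives wherever the cone lies in the domain. -/
theorem fderiv_coneAvg (hη : IsMollifier η) {t : ℝ} (ht : 0 < t) {K : Set (Euc d)} {i : Fin d}
    {f w : Euc d → ℝ} (hf : LocallyIntegrable f volume) (hfw : HasWeakPartial K i f w)
    (hf0 : ∀ x ∉ K, f x = 0) (hw0 : ∀ x ∉ K, w x = 0) {x : Euc d}
    (hx : ∀ z ∈ tsupport η, x + t • z ∈ K) :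
    fderiv ℝ (coneAvg η t f) x (stdVec i) = coneAvg η t w x := by
  set k : Euc d → ℝ := fun u => t⁻¹ ^ d * η (-(t⁻¹ • u)) with hk
  have hkc := hη.hasCompactSupport_kernel ht
  have hkd : ContDiff ℝ ∞ k := hη.contDiff_kernel t
  have h1 := hkc.hasFDerivAt_convolution_right (ContinuousLinearMap.mul ℝ ℝ) hf
    (hkd.of_le (by norm_num)) x
  have hint : Integrable fun y => (ContinuousLinearMap.precompR (Euc d)
      (ContinuousLinearMap.mul ℝ ℝ)) (f y) (fderiv ℝ k (x - y)) := by
    exact (HasCompactSupport.convolutionExists_right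
      (ContinuousLinearMap.precompR (Euc d) (ContinuousLinearMap.mul ℝ ℝ))
      (hkc.fderiv ℝ) hf (hkd.continuous_fderiv (by norm_num)) x)
  have h2 : fderiv ℝ (coneAvg η t f) x (stdVec i) =
      ∫ y, f y * fderiv ℝ k (x - y) (stdVec i) := by
    rw [coneAvg_eq_convolution t ht, h1.fderiv, convolution_def,
      ContinuousLinearMap.integral_apply hint]
    rfl
  have hφd : ContDiff ℝ ∞ fun y => k (x - y) := hkd.comp (contDiff_const.sub contDiff_id)
  have hφk : ∀ y, k (x - y) = t⁻¹ ^ d * η (t⁻¹ • (y - x)) := fun y => by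
    simp only [hk, ← smul_neg, neg_sub]
  have hφs : tsupport (fun y => k (x - y)) ⊆ (fun z => x + t • z) '' tsupport η := by
    refine closure_minimal (fun y hy => ?_)
      (hη.hasCompactSupport.isCompact.image (by fun_prop)).isClosed
    rw [Function.mem_support, hφk] at hy
    refine ⟨t⁻¹ • (y - x), subset_closure (right_ne_zero_of_mul hy), ?_⟩
    simp only [smul_smul, mul_inv_cancel₀ ht.ne', one_smul]
    abel
  have hφc : HasCompactSupport fun y => k (x - y) :=
    HasCompactSupport.of_support_subset_isCompact
      (hη.hasCompactSupport.isCompact.image (by fun_prop : Continuous fun z => x + t • z))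
      (subset_closure.trans hφs)
  have hφK : tsupport (fun y => k (x - y)) ⊆ K := by
    refine hφs.trans ?_
    rintro _ ⟨z, hz, rfl⟩
    exact hx z hz
  have h3 := hfw.2.2 _ hφd hφc hφK
  have h4 : ∀ y, fderiv ℝ (fun y => k (x - y)) y (stdVec i) =
      - fderiv ℝ k (x - y) (stdVec i) := by
    intro y
    have hd : HasFDerivAt (fun y : Euc d => x - y) (-(ContinuousLinearMap.id ℝ (Euc d))) y :=
      (hasFDerivAt_id y).const_sub x
    have hkd' : HasFDerivAt k (fderiv ℝ k (x - y)) (x - y) :=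
      (hkd.differentiable (by norm_num) _).hasFDerivAt
    have := (hkd'.comp y hd).fderiv
    rw [Function.comp_def] at this
    rw [this]
    simp
  simp only [h4, mul_neg] at h3
  rw [integral_neg, neg_inj] at h3
  have hset : ∀ g : Euc d → ℝ, (∀ y ∉ K, g y = 0) → ∫ y in K, g y = ∫ y, g y := fun g hg =>
    setIntegral_eq_integral_of_forall_compl_eq_zero hg
  rw [hset _ (fun y hy => by rw [hf0 y hy, zero_mul]),
    hset _ (fun y hy => by rw [hw0 y hy, zero_mul])] at h3
  rw [h2, h3, coneAvg_eq_convolution t ht, convolution_def]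
  rfl

end IsMollifier

/-! ### Weak partial derivatives -/

namespace HasWeakPartial

variable {d : ℕ} {U : Set (Euc d)} {i : Fin d} {v w v' w' : Euc d → ℝ}

theorem congr_ae (h : HasWeakPartial U i v w) (hv : v =ᵐ[volume.restrict U] v')
    (hw : w =ᵐ[volume.restrict U] w') : HasWeakPartial U i v' w' := by
  obtain ⟨h1, h2, h3⟩ := h
  have hloc : ∀ {f g : Euc d → ℝ}, f =ᵐ[volume.restrict U] g → LocallyIntegrableOn f U volume →
      LocallyIntegrableOn g U volume := by
    intro f g hfg hf x hx
    obtain ⟨s, hs, hfs⟩ := hf x hx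
    refine ⟨s ∩ U, inter_mem hs self_mem_nhdsWithin, ?_⟩
    exact (hfs.mono_set inter_subset_left).congr
      (ae_restrict_of_ae_restrict_of_subset inter_subset_right hfg)
  refine ⟨hloc hv h1, hloc hw h2, fun φ hφ hc hs => ?_⟩
  have e1 : ∫ x in U, v' x * fderiv ℝ φ x (stdVec i) = ∫ x in U, v x * fderiv ℝ φ x (stdVec i) :=
    integral_congr_ae (hv.mono fun x hx => by simp only [hx])
  have e2 : ∫ x in U, w' x * φ x = ∫ x in U, w x * φ x :=
    integral_congr_ae (hw.mono fun x hx => by simp only [hx])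
  rw [e1, e2, h3 φ hφ hc hs]

theorem integrable_mul {f φ : Euc d → ℝ} (hf : LocallyIntegrableOn f U volume)
    (hφ : Continuous φ) (hc : HasCompactSupport φ) (hs : tsupport φ ⊆ U) :
    Integrable (fun x => f x * φ x) (volume.restrict U) := by
  have h1 : IntegrableOn f (tsupport φ) volume := hf.integrableOn_compact_subset hs hc
  have h2 : IntegrableOn (fun x => f x * φ x) (tsupport φ) volume :=
    h1.mul_continuousOn hφ.continuousOn hc
  have h3 : Function.support (fun x => f x * φ x) ⊆ tsupport φ := fun x hx =>
    subset_closure (right_ne_zero_of_mul (Function.mem_support.1 hx))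
  exact ((integrableOn_iff_integrable_of_support_subset h3).1 h2).integrableOn

theorem unique (hU : IsOpen U) (h : HasWeakPartial U i v w) (h' : HasWeakPartial U i v w') :
    w =ᵐ[volume.restrict U] w' := by
  have h1 : ∀ᵐ x, x ∈ U → w x - w' x = 0 := by
    refine hU.ae_eq_zero_of_integral_contDiff_smul_eq_zero (h.2.1.sub h'.2.1) fun φ hφ hc hs => ?_
    have h2 := h.2.2 φ hφ hc hs
    rw [h'.2.2 φ hφ hc hs, neg_inj] at h2
    have h3 : ∫ x, φ x • (w x - w' x) = ∫ x in U, (w x * φ x - w' x * φ x) := by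
      rw [setIntegral_eq_integral_of_forall_compl_eq_zero]
      · congr 1; ext x; simp only [smul_eq_mul]; ring
      · intro x hx
        rw [image_eq_zero_of_notMem_tsupport fun h => hx (hs h)]
        ring
    change ∫ x, φ x • (w x - w' x) = 0
    rw [h3, integral_sub (integrable_mul h.2.1 hφ.continuous hc hs)
      (integrable_mul h'.2.1 hφ.continuous hc hs), h2, sub_self]
  rw [Filter.EventuallyEq, ae_restrict_iff' hU.measurableSet]
  filter_upwards [h1] with x hx hxU
  exact sub_eq_zero.1 (hx hxU)

end HasWeakPartial

/-! ### The trace inequality -/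

theorem enorm_integral_sub_integral_sq_le {α : Type*} [MeasurableSpace α] {P Q : Measure α}
    [IsProbabilityMeasure P] [IsProbabilityMeasure Q] {φ : α → ℝ} (hm : Measurable φ)
    (hP : Integrable φ P) (hQ : Integrable φ Q) :
    ‖∫ x, φ x ∂P - ∫ y, φ y ∂Q‖ₑ ^ 2 ≤ ∫⁻ x, ∫⁻ y, ‖φ x - φ y‖ₑ ^ 2 ∂Q ∂P := by
  have hmeas : Measurable fun p : α × α => φ p.1 - φ p.2 :=
    (hm.comp measurable_fst).sub (hm.comp measurable_snd)
  have h1 : ∫ x, φ x ∂P - ∫ y, φ y ∂Q = ∫ p, (φ p.1 - φ p.2) ∂(P.prod Q) := by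
    rw [integral_sub (hP.comp_fst Q) (hQ.comp_snd P), integral_fun_fst, integral_fun_snd]
    simp
  have h2 : ‖∫ x, φ x ∂P - ∫ y, φ y ∂Q‖ₑ ≤ eLpNorm (fun p : α × α => φ p.1 - φ p.2) 2
      (P.prod Q) := by
    rw [h1]
    refine (enorm_integral_le_lintegral_enorm _).trans ?_
    rw [← eLpNorm_one_eq_lintegral_enorm]
    exact eLpNorm_le_eLpNorm_of_exponent_le (by norm_num) hmeas.aestronglyMeasurable
  calc _ ≤ eLpNorm (fun p : α × α => φ p.1 - φ p.2) 2 (P.prod Q) ^ 2 := by gcongr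
    _ = _ := by rw [eLpNorm_two_sq, lintegral_prod _ (hmeas.enorm.pow_const 2).aemeasurable]

theorem lintegral_lintegral_ball_le {d : ℕ} {μ : Measure (Euc d)} [SFinite μ] {E : Set (Euc d)}
    {r : ℝ} {c : ℝ≥0∞} (hμ : ∀ x, μ (Metric.ball x r) ≤ c)
    {g : Euc d → ℝ≥0∞} (hg : Measurable g) :
    ∫⁻ p, (∫⁻ x in E ∩ Metric.ball p r, g x) ∂μ ≤ c * ∫⁻ x in E, g x := by
  have hS : MeasurableSet {q : Euc d × Euc d | dist q.2 q.1 < r} :=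
    (isOpen_lt (by fun_prop) continuous_const).measurableSet
  have h1 : ∀ p, ∫⁻ x in E ∩ Metric.ball p r, g x =
      ∫⁻ x in E, {q : Euc d × Euc d | dist q.2 q.1 < r}.indicator (fun q => g q.2) (p, x) := by
    intro p
    rw [inter_comm, ← Measure.restrict_restrict Metric.isOpen_ball.measurableSet,
      ← lintegral_indicator Metric.isOpen_ball.measurableSet]
    rfl
  simp only [h1]
  rw [lintegral_lintegral_swap (f := fun p x =>
    {q : Euc d × Euc d | dist q.2 q.1 < r}.indicator (fun q => g q.2) (p, x)) (((hg.comp measurable_snd).indicator hS).aemeasurable),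
    ← lintegral_const_mul _ hg]
  refine lintegral_mono fun x => ?_
  calc _ = ∫⁻ p, (Metric.ball x r).indicator (fun _ => g x) p ∂μ := by
        refine lintegral_congr fun p => ?_
        simp only [indicator, Metric.mem_ball, mem_ofPred_eq, dist_comm]
    _ = g x * μ (Metric.ball x r) := by
        rw [lintegral_indicator Metric.isOpen_ball.measurableSet, setLIntegral_const]
    _ ≤ c * g x := by rw [mul_comm]; gcongr; exact hμ x

theorem lintegral_cond_le {d : ℕ} {S : Set (Euc d)} {a : ℝ} (ha : 0 < a)
    (h : ENNReal.ofReal a ≤ volume S) (g : Euc d → ℝ≥0∞) :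
    ∫⁻ x, g x ∂(ProbabilityTheory.cond volume S) ≤ ENNReal.ofReal a⁻¹ * ∫⁻ x in S, g x := by
  rw [ProbabilityTheory.cond, lintegral_smul_measure, smul_eq_mul, ENNReal.ofReal_inv_of_pos ha]
  gcongr

/-- The averages of `φ` over the parts of `E` near `p`. -/
def localAvg {d : ℕ} (E : Set (Euc d)) (φ : Euc d → ℝ) (r : ℝ) (p : Euc d) : ℝ :=
  ∫ x, φ x ∂(ProbabilityTheory.cond volume (E ∩ Metric.ball p r))

theorem measurable_localAvg {d : ℕ} {E : Set (Euc d)} {φ : Euc d → ℝ}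
    (hφ : Measurable φ) (r : ℝ) : Measurable (localAvg E φ r) := by
  have hS : MeasurableSet {q : Euc d × Euc d | dist q.2 q.1 < r} :=
    (isOpen_lt (by fun_prop) continuous_const).measurableSet
  have h1 : ∀ p, localAvg E φ r p = (volume (E ∩ Metric.ball p r))⁻¹.toReal *
      ∫ x in E, {q : Euc d × Euc d | dist q.2 q.1 < r}.indicator (fun q => φ q.2) (p, x) := by
    intro p
    rw [localAvg, ProbabilityTheory.cond, integral_smul_measure, smul_eq_mul]
    congr 1
    rw [inter_comm, ← Measure.restrict_restrict Metric.isOpen_ball.measurableSet,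
      ← integral_indicator Metric.isOpen_ball.measurableSet]
    rfl
  rw [show localAvg E φ r = _ from funext h1]
  refine Measurable.mul ?_ ?_
  · refine Measurable.ennreal_toReal (Measurable.inv ?_)
    have h2 : ∀ p, volume (E ∩ Metric.ball p r) = (volume.restrict E)
        (Prod.mk p ⁻¹' {q : Euc d × Euc d | dist q.2 q.1 < r}) := fun p => by
      rw [inter_comm, ← Measure.restrict_apply Metric.isOpen_ball.measurableSet]
      rfl
    simp only [h2]
    exact measurable_measure_prodMk_left hS
  · exact (((hφ.comp measurable_snd).indicator hS).stronglyMeasurable.integral_prod_right').measurable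

theorem integrable_of_continuous_hasCompactSupport {d : ℕ} {φ : Euc d → ℝ} (hφ : Continuous φ)
    (hc : HasCompactSupport φ) (ν : Measure (Euc d)) [IsFiniteMeasure ν] : Integrable φ ν :=
  hφ.integrable_of_hasCompactSupport hc

/-- One dyadic step in the trace inequality. -/
theorem enorm_localAvg_sub_sq_le {d : ℕ} {E : Set (Euc d)} {φ : Euc d → ℝ}
    (hφ : Continuous φ) (hc : HasCompactSupport φ) {σ c r : ℝ} (hσ : 0 < σ) (hr : 0 < r)
    (hcpos : 0 < c) {p : Euc d}
    (h1 : ENNReal.ofReal (c * (r / 2) ^ d) ≤ volume (E ∩ Metric.ball p (r / 2)))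
    (h2 : ENNReal.ofReal (c * r ^ d) ≤ volume (E ∩ Metric.ball p r)) :
    ‖localAvg E φ (r / 2) p - localAvg E φ r p‖ₑ ^ 2 ≤
      ENNReal.ofReal ((c * (r / 2) ^ d)⁻¹ * (c * r ^ d)⁻¹ * (2 * r) ^ ((d : ℝ) + 2 * σ)) *
      ∫⁻ x in E ∩ Metric.ball p r, ∫⁻ y in E,
        ENNReal.ofReal ((φ x - φ y) ^ 2 / ‖x - y‖ ^ ((d : ℝ) + 2 * σ)) := by
  have hne : ∀ {s : ℝ}, 0 < s → ENNReal.ofReal (c * s ^ d) ≤ volume (E ∩ Metric.ball p s) →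
      IsProbabilityMeasure (ProbabilityTheory.cond volume (E ∩ Metric.ball p s)) := by
    intro s hs h
    have h3 : 0 < volume (E ∩ Metric.ball p s) :=
      lt_of_lt_of_le (ENNReal.ofReal_pos.2 (by positivity)) h
    have h4 : volume (E ∩ Metric.ball p s) ≠ ⊤ :=
      ((measure_mono inter_subset_right).trans_lt measure_ball_lt_top).ne
    exact ProbabilityTheory.cond_isProbabilityMeasure_of_finite h3.ne' h4
  have := hne (by positivity) h1
  have := hne hr h2
  refine (enorm_integral_sub_integral_sq_le hφ.measurable
    (integrable_of_continuous_hasCompactSupport hφ hc _)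
    (integrable_of_continuous_hasCompactSupport hφ hc _)).trans ?_
  have hsub : E ∩ Metric.ball p (r / 2) ⊆ E ∩ Metric.ball p r :=
    inter_subset_inter_right _ (Metric.ball_subset_ball (by linarith))
  have hball : MeasurableSet (Metric.ball p r) := Metric.isOpen_ball.measurableSet
  have hrestr : volume.restrict (E ∩ Metric.ball p r) =
      (volume.restrict E).restrict (Metric.ball p r) := by
    rw [Measure.restrict_restrict hball, inter_comm]
  calc _ ≤ ∫⁻ x, ENNReal.ofReal (c * r ^ d)⁻¹ * (∫⁻ y in E ∩ Metric.ball p r,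
          ‖φ x - φ y‖ₑ ^ 2) ∂(ProbabilityTheory.cond volume (E ∩ Metric.ball p (r / 2))) :=
        lintegral_mono fun x => lintegral_cond_le (by positivity) h2 _
    _ ≤ ENNReal.ofReal (c * (r / 2) ^ d)⁻¹ * ∫⁻ x in E ∩ Metric.ball p (r / 2),
          ENNReal.ofReal (c * r ^ d)⁻¹ * (∫⁻ y in E ∩ Metric.ball p r, ‖φ x - φ y‖ₑ ^ 2) :=
        lintegral_cond_le (by positivity) h1 _
    _ ≤ ENNReal.ofReal (c * (r / 2) ^ d)⁻¹ * ∫⁻ x in E ∩ Metric.ball p r,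
          ENNReal.ofReal (c * r ^ d)⁻¹ * (∫⁻ y in E ∩ Metric.ball p r, ‖φ x - φ y‖ₑ ^ 2) := by
        gcongr
    _ ≤ ENNReal.ofReal (c * (r / 2) ^ d)⁻¹ * ∫⁻ x in E ∩ Metric.ball p r,
          ENNReal.ofReal (c * r ^ d)⁻¹ * (ENNReal.ofReal ((2 * r) ^ ((d : ℝ) + 2 * σ)) *
          ∫⁻ y in E, ENNReal.ofReal ((φ x - φ y) ^ 2 / ‖x - y‖ ^ ((d : ℝ) + 2 * σ))) := by
        refine mul_le_mul_right (?_ : _ ≤ _) _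
        rw [hrestr]
        refine setLIntegral_mono' hball fun x hx => ?_
        refine mul_le_mul_right (?_ : _ ≤ _) _
        rw [← lintegral_const_mul' _ _ ENNReal.ofReal_ne_top]
        refine (setLIntegral_mono' hball fun y hy => ?_).trans (setLIntegral_le_lintegral _ _)
        rw [← ENNReal.ofReal_mul (by positivity), ← ofReal_sq_eq_enorm_sq]
        refine ENNReal.ofReal_le_ofReal ?_
        rcases eq_or_ne x y with rfl | hxy
        · simp
        have hpos : 0 < ‖x - y‖ := norm_pos_iff.2 (sub_ne_zero.2 hxy)
        have hle : ‖x - y‖ ≤ 2 * r := by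
          rw [← dist_eq_norm]
          have h3 := dist_triangle_right x y p
          have h4 : dist x p < r := hx
          have h5 : dist y p < r := hy
          linarith
        rw [mul_div_assoc', le_div_iff₀ (by positivity), mul_comm]
        gcongr
    _ = _ := by
        have hc1 : (0 : ℝ) ≤ (c * (r / 2) ^ d)⁻¹ := by positivity
        have hc2 : (0 : ℝ) ≤ (c * r ^ d)⁻¹ := by positivity
        simp only [← mul_assoc]
        rw [lintegral_const_mul' _ _ (ENNReal.mul_ne_top ENNReal.ofReal_ne_top
          ENNReal.ofReal_ne_top), ENNReal.ofReal_mul (mul_nonneg hc1 hc2),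
          ENNReal.ofReal_mul hc1]
        ring

theorem tendsto_localAvg {d : ℕ} {E : Set (Euc d)} {φ : Euc d → ℝ}
    (hφ : Continuous φ) (hc : HasCompactSupport φ) {p : Euc d} {r : ℕ → ℝ}
    (hr : Tendsto r atTop (𝓝 0))
    (hpos : ∀ j, volume (E ∩ Metric.ball p (r j)) ≠ 0) (hE : MeasurableSet E) :
    Tendsto (fun j => localAvg E φ (r j) p) atTop (𝓝 (φ p)) := by
  rw [Metric.tendsto_atTop]
  intro ε hε
  obtain ⟨δ, hδ, hball⟩ := Metric.continuousAt_iff.1 hφ.continuousAt (ε / 2) (by positivity)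
  obtain ⟨N, hN⟩ := (Metric.tendsto_atTop.1 hr) δ hδ
  refine ⟨N, fun j hj => ?_⟩
  have hrj : r j < δ := by
    have := hN j hj
    rw [Real.dist_eq, sub_zero] at this
    exact (le_abs_self _).trans_lt this
  have h4 : volume (E ∩ Metric.ball p (r j)) ≠ ⊤ :=
    ((measure_mono inter_subset_right).trans_lt measure_ball_lt_top).ne
  have := ProbabilityTheory.cond_isProbabilityMeasure_of_finite (hpos j) h4
  have h5 : localAvg E φ (r j) p - φ p =
      ∫ x, (φ x - φ p) ∂(ProbabilityTheory.cond volume (E ∩ Metric.ball p (r j))) := by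
    rw [integral_sub (integrable_of_continuous_hasCompactSupport hφ hc _) (integrable_const _),
      localAvg]
    simp
  rw [Real.dist_eq, h5, ← Real.norm_eq_abs]
  refine lt_of_le_of_lt (norm_integral_le_of_norm_le_const (C := ε / 2) ?_) ?_
  · have hmeas : MeasurableSet (E ∩ Metric.ball p (r j)) :=
      hE.inter Metric.isOpen_ball.measurableSet
    have hac := ProbabilityTheory.cond_absolutelyContinuous
      (μ := (volume : Measure (Euc d))) (s := E ∩ Metric.ball p (r j))
    have h6 : ∀ᵐ x ∂(ProbabilityTheory.cond volume (E ∩ Metric.ball p (r j))),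
        x ∈ E ∩ Metric.ball p (r j) := by
      rw [ProbabilityTheory.cond]
      exact Measure.ae_smul_measure (ae_restrict_mem hmeas) _
    filter_upwards [h6] with x hx
    have := hball (show dist x p < δ from lt_trans hx.2 hrj)
    rw [Real.dist_eq, ← Real.norm_eq_abs] at this
    exact this.le
  · simp
    linarith

/-- The trace inequality: for `σ > 1/2` the `L²` norm on a set carrying an `m`-dimensional measure
is bounded by the `H^σ` norm on an `(m+1)`-dimensional set `E` that has uniformly positive density
at the points of that set. The dyadic averages `localAvg E φ (r₀ / 2 ^ j)` converge to `φ`, and the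
`L²(μ)` norms of their increments decay geometrically. -/
theorem exists_trace_inequality {m : ℕ} {E : Set (Euc (m + 1))} (hE : MeasurableSet E)
    {μ : Measure (Euc (m + 1))} [SFinite μ] {σ : ℝ} (hσ : 1 / 2 < σ) {c₀ r₀ c₁ : ℝ} (hc₀ : 0 < c₀)
    (hr₀ : 0 < r₀) (hc₁ : 0 ≤ c₁)
    (hvol : ∀ᵐ p ∂μ, ∀ r, 0 < r → r ≤ r₀ →
      ENNReal.ofReal (c₀ * r ^ (m + 1)) ≤ volume (E ∩ Metric.ball p r))
    (hμ : ∀ x r, 0 < r → μ (Metric.ball x r) ≤ ENNReal.ofReal (c₁ * r ^ m)) :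
    ∃ C : ℝ≥0, ∀ φ : Euc (m + 1) → ℝ, Continuous φ → HasCompactSupport φ →
      ∫⁻ x, ‖φ x‖ₑ ^ 2 ∂μ ≤ C * fracNormSq E σ φ := by
  set θ : ℝ := 2 ^ (-(2 * σ - 1)) with hθ
  have hθ0 : 0 < θ := by positivity
  have hθ1 : √θ < 1 := by
    rw [Real.sqrt_lt' one_pos, one_pow]
    exact Real.rpow_lt_one_of_one_lt_of_neg one_lt_two (by linarith)
  set r : ℕ → ℝ := fun j => r₀ / 2 ^ j with hr
  have hrpos : ∀ j, 0 < r j := fun j => by positivity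
  have hrle : ∀ j, r j ≤ r₀ := fun j => div_le_self hr₀.le (one_le_pow₀ one_le_two)
  have hrs : ∀ j, r (j + 1) = r j / 2 := fun j => by simp only [hr, pow_succ]; field_simp
  have hrlim : Tendsto r atTop (𝓝 0) := by
    have := (tendsto_pow_atTop_nhds_zero_of_lt_one (r := (1 / 2 : ℝ)) (by norm_num)
      (by norm_num)).const_mul r₀
    rw [mul_zero] at this
    refine this.congr fun j => ?_
    simp only [hr]
    rw [one_div, inv_pow, div_eq_mul_inv]
  set B : ℝ := (c₀ ^ 2)⁻¹ * 2 ^ (m + 1) * 2 ^ (((m + 1 : ℕ) : ℝ) + 2 * σ) * c₁ *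
    r₀ ^ (2 * σ - 1) with hB
  have hB0 : 0 ≤ B := by positivity
  set B₀ : ℝ := (c₀ * r₀ ^ (m + 1))⁻¹ * (c₁ * r₀ ^ m) with hB₀
  have hB₀0 : 0 ≤ B₀ := by positivity
  -- the constant of the `j`-th dyadic step
  have hstep : ∀ j, (c₀ * (r j / 2) ^ (m + 1))⁻¹ * (c₀ * r j ^ (m + 1))⁻¹ *
      (2 * r j) ^ (((m + 1 : ℕ) : ℝ) + 2 * σ) * (c₁ * r j ^ m) = B * θ ^ j := by
    intro j
    have hj := hrpos j
    have e1 : (2 * r j) ^ (((m + 1 : ℕ) : ℝ) + 2 * σ) =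
        2 ^ (((m + 1 : ℕ) : ℝ) + 2 * σ) * (r j ^ (m + 1) * (r j ^ (2 * σ - 1) * r j)) := by
      rw [Real.mul_rpow (by norm_num) hj.le, Real.rpow_add hj, Real.rpow_natCast,
        Real.rpow_sub_one hj.ne', div_mul_cancel₀ _ hj.ne']
    have e2 : r j ^ (2 * σ - 1) = r₀ ^ (2 * σ - 1) * θ ^ j := by
      simp only [hr, hθ]
      rw [Real.div_rpow hr₀.le (by positivity), ← Real.rpow_natCast 2 j, ← Real.rpow_natCast _ j,
        ← Real.rpow_mul (by norm_num), ← Real.rpow_mul (by norm_num), div_eq_mul_inv,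
        ← Real.rpow_neg (by norm_num)]
      congr 2
      ring
    rw [e1, e2, hB, div_pow]
    field_simp
    ring
  refine ⟨(√B₀ + √B * (1 - √θ)⁻¹).toNNReal ^ 2, fun φ hφ hc => ?_⟩
  set N := fracNormSq E σ φ with hN
  set s : ℝ≥0∞ := N ^ (1 / 2 : ℝ) with hs
  have hs2 : s ^ 2 = N := by
    rw [hs, ← ENNReal.rpow_natCast, ← ENNReal.rpow_mul]
    norm_num
  have hroot : ∀ (x : ℝ≥0∞) (b : ℝ), 0 ≤ b → x ^ 2 ≤ ENNReal.ofReal b * N →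
      x ≤ ENNReal.ofReal √b * s := by
    intro x b hb hx
    rw [← ENNReal.pow_le_pow_left_iff two_ne_zero, mul_pow, hs2,
      ← ENNReal.ofReal_pow (Real.sqrt_nonneg _), Real.sq_sqrt hb]
    exact hx
  set a : ℕ → Euc (m + 1) → ℝ := fun j => localAvg E φ (r j) with ha
  have ham : ∀ j, Measurable (a j) := fun j => measurable_localAvg hφ.measurable _
  have hkm : Measurable fun p : Euc (m + 1) × Euc (m + 1) =>
      ENNReal.ofReal ((φ p.1 - φ p.2) ^ 2 / ‖p.1 - p.2‖ ^ (((m + 1 : ℕ) : ℝ) + 2 * σ)) := by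
    have := hφ.measurable
    fun_prop
  have hgm : Measurable fun x => ∫⁻ y in E,
      ENNReal.ofReal ((φ x - φ y) ^ 2 / ‖x - y‖ ^ (((m + 1 : ℕ) : ℝ) + 2 * σ)) :=
    hkm.lintegral_prod_right'
  have hinc : ∀ j, eLpNorm (fun p => a (j + 1) p - a j p) 2 μ ≤
      ENNReal.ofReal (√B * √θ ^ j) * s := by
    intro j
    have hj := hrpos j
    have hsq : √B * √θ ^ j = √(B * θ ^ j) := by
      rw [Real.sqrt_mul hB0]
      congr 1
      rw [Real.sqrt_eq_rpow, Real.sqrt_eq_rpow, ← Real.rpow_natCast, ← Real.rpow_natCast,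
        ← Real.rpow_mul hθ0.le, ← Real.rpow_mul hθ0.le, mul_comm]
    rw [hsq]
    refine hroot _ _ (by positivity) ?_
    rw [eLpNorm_two_sq, ← hstep]
    calc _ ≤ ∫⁻ p, ENNReal.ofReal ((c₀ * (r j / 2) ^ (m + 1))⁻¹ * (c₀ * r j ^ (m + 1))⁻¹ *
          (2 * r j) ^ (((m + 1 : ℕ) : ℝ) + 2 * σ)) *
          (∫⁻ x in E ∩ Metric.ball p (r j), ∫⁻ y in E,
            ENNReal.ofReal ((φ x - φ y) ^ 2 / ‖x - y‖ ^ (((m + 1 : ℕ) : ℝ) + 2 * σ))) ∂μ := by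
          refine lintegral_mono_ae ?_
          filter_upwards [hvol] with p hp
          simp only [ha, hrs]
          exact enorm_localAvg_sub_sq_le hφ hc (by linarith) hj hc₀
            (hp _ (by positivity) (by have := hrle j; linarith)) (hp _ hj (hrle j))
      _ ≤ ENNReal.ofReal ((c₀ * (r j / 2) ^ (m + 1))⁻¹ * (c₀ * r j ^ (m + 1))⁻¹ *
          (2 * r j) ^ (((m + 1 : ℕ) : ℝ) + 2 * σ)) *
          (ENNReal.ofReal (c₁ * r j ^ m) * gagliardoSq E σ φ) := by
          rw [lintegral_const_mul' _ _ ENNReal.ofReal_ne_top]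
          gcongr
          exact lintegral_lintegral_ball_le (fun x => hμ x _ hj) hgm
      _ ≤ _ := by
          rw [← mul_assoc, ← ENNReal.ofReal_mul (by positivity)]
          gcongr
          exact le_add_self
  have h0 : eLpNorm (a 0) 2 μ ≤ ENNReal.ofReal √B₀ * s := by
    refine hroot _ _ hB₀0 ?_
    have hr0 : r 0 = r₀ := by simp [hr]
    rw [eLpNorm_two_sq]
    calc _ ≤ ∫⁻ p, ENNReal.ofReal (c₀ * r₀ ^ (m + 1))⁻¹ *
          (∫⁻ x in E ∩ Metric.ball p r₀, ‖φ x‖ₑ ^ 2) ∂μ := by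
          refine lintegral_mono_ae ?_
          filter_upwards [hvol] with p hp
          have h1 := hp r₀ hr₀ le_rfl
          have h3 : 0 < volume (E ∩ Metric.ball p r₀) :=
            lt_of_lt_of_le (ENNReal.ofReal_pos.2 (by positivity)) h1
          have h4 : volume (E ∩ Metric.ball p r₀) ≠ ⊤ :=
            ((measure_mono inter_subset_right).trans_lt measure_ball_lt_top).ne
          have := ProbabilityTheory.cond_isProbabilityMeasure_of_finite h3.ne' h4
          refine le_trans ?_ (lintegral_cond_le (by positivity) h1 _)
          have h5 := eLpNorm_le_eLpNorm_of_exponent_le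
            (μ := ProbabilityTheory.cond volume (E ∩ Metric.ball p r₀)) (f := φ) (p := 1) (q := 2)
            (by norm_num) hφ.aestronglyMeasurable
          rw [← eLpNorm_two_sq]
          simp only [ha, hr0]
          gcongr
          refine le_trans ?_ h5
          rw [eLpNorm_one_eq_lintegral_enorm]
          exact enorm_integral_le_lintegral_enorm _
      _ ≤ ENNReal.ofReal (c₀ * r₀ ^ (m + 1))⁻¹ * (ENNReal.ofReal (c₁ * r₀ ^ m) *
          ∫⁻ x in E, ‖φ x‖ₑ ^ 2) := by
          rw [lintegral_const_mul' _ _ ENNReal.ofReal_ne_top]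
          gcongr
          exact lintegral_lintegral_ball_le (fun x => hμ x _ hr₀)
            (hφ.measurable.enorm.pow_const 2)
      _ ≤ _ := by
          rw [← mul_assoc, ← ENNReal.ofReal_mul (by positivity)]
          gcongr
          rw [hN, fracNormSq]
          simp only [ofReal_sq_eq_enorm_sq]
          exact le_self_add
  have hbound : ∀ n, eLpNorm (a n) 2 μ ≤ ENNReal.ofReal (√B₀ + √B * (1 - √θ)⁻¹) * s := by
    intro n
    have h1 : eLpNorm (a n) 2 μ ≤
        ENNReal.ofReal (√B₀ + √B * ∑ j ∈ Finset.range n, √θ ^ j) * s := by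
      induction n with
      | zero => simpa using h0
      | succ n ih =>
        have h2 : a (n + 1) = a n + fun p => a (n + 1) p - a n p := by ext p; simp
        rw [h2]
        refine (eLpNorm_add_le (ham n).aestronglyMeasurable
          ((ham (n + 1)).sub (ham n)).aestronglyMeasurable (by norm_num)).trans ?_
        refine (add_le_add ih (hinc n)).trans (le_of_eq ?_)
        rw [← add_mul, ← ENNReal.ofReal_add (by positivity) (by positivity),
          Finset.sum_range_succ]
        ring_nf
    refine h1.trans ?_
    gcongr
    have h3 : ∑ j ∈ Finset.range n, √θ ^ j ≤ (1 - √θ)⁻¹ := by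
      have := Summable.sum_le_tsum (Finset.range n) (fun j _ => by positivity)
        (summable_geometric_of_lt_one (Real.sqrt_nonneg θ) hθ1)
      rwa [tsum_geometric_of_lt_one (Real.sqrt_nonneg θ) hθ1] at this
    exact h3
  have hlim : ∀ᵐ p ∂μ, Tendsto (fun j => a j p) atTop (𝓝 (φ p)) := by
    filter_upwards [hvol] with p hp
    refine tendsto_localAvg hφ hc hrlim (fun j => ?_) hE
    exact (lt_of_lt_of_le (ENNReal.ofReal_pos.2 (by have := hrpos j; positivity))
      (hp _ (hrpos j) (hrle j))).ne'
  have hfatou : eLpNorm φ 2 μ ≤ ENNReal.ofReal (√B₀ + √B * (1 - √θ)⁻¹) * s := by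
    refine (Lp.eLpNorm_lim_le_liminf_eLpNorm (fun n => (ham n).aestronglyMeasurable) φ
      hlim).trans ?_
    exact liminf_le_of_le (by isBoundedDefault) fun b hb => by
      obtain ⟨n, hn⟩ := hb.exists
      exact hn.trans (hbound n)
  rw [← eLpNorm_two_sq]
  calc _ ≤ (ENNReal.ofReal (√B₀ + √B * (1 - √θ)⁻¹) * s) ^ 2 := by gcongr
    _ = _ := by rw [mul_pow, hs2]; push_cast; rfl

/-! ### Density of smooth functions -/

/-- A finite smooth partition of unity on a compact set, subordinate to balls of prescribed
radii. -/
theorem exists_finite_partition {d : ℕ} {K : Set (Euc d)} (hK : IsCompact K) (r : Euc d → ℝ)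
    (hr : ∀ p ∈ K, 0 < r p) :
    ∃ (s : Finset (Euc d)) (χ : Euc d → Euc d → ℝ), (∀ p ∈ s, p ∈ K) ∧
      (∀ p ∈ s, ContDiff ℝ ∞ (χ p) ∧ HasCompactSupport (χ p) ∧
        tsupport (χ p) ⊆ Metric.ball p (r p)) ∧
      ∀ x ∈ K, ∑ p ∈ s, χ p x = 1 := by
  obtain ⟨s, hcov⟩ := hK.elim_nhds_subcover' (fun p _ => Metric.ball p (r p))
    (fun p hp => Metric.ball_mem_nhds p (hr p hp))
  classical
  obtain ⟨f, hf⟩ := SmoothPartitionOfUnity.exists_isSubordinate (modelWithCornersSelf ℝ (Euc d))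
    (ι := s) hK.isClosed (fun q => Metric.ball (q : K) (r (q : K))) (fun q => Metric.isOpen_ball)
    (by simpa only [iUnion_subtype] using hcov)
  let χ : Euc d → Euc d → ℝ := fun p =>
    if h : ∃ q : s, ((q : K) : Euc d) = p then fun x => f h.choose x else 0
  have hχ : ∀ q : s, χ ((q : K) : Euc d) = fun x => f q x := by
    intro q
    have h : ∃ q' : s, ((q' : K) : Euc d) = ((q : K) : Euc d) := ⟨q, rfl⟩
    simp only [χ, h, dif_pos]
    have : h.choose = q := Subtype.ext (Subtype.ext h.choose_spec)
    rw [this]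
  refine ⟨s.image (fun q : K => (q : Euc d)), χ, ?_, ?_, ?_⟩
  · intro p hp
    obtain ⟨q, -, rfl⟩ := Finset.mem_image.1 hp
    exact q.2
  · intro p hp
    obtain ⟨q, hq, rfl⟩ := Finset.mem_image.1 hp
    rw [hχ ⟨q, hq⟩]
    have hsub := hf ⟨q, hq⟩
    refine ⟨(contMDiff_iff_contDiff.1 (f ⟨q, hq⟩).contMDiff), ?_, hsub⟩
    exact Metric.isCompact_of_isClosed_isBounded (isClosed_tsupport _)
      (Metric.isBounded_ball.subset hsub)
  · intro x hx
    rw [Finset.sum_image fun a _ b _ h => Subtype.ext h, ← f.sum_eq_one hx, finsum_eq_sum_of_fintype,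
      ← Finset.sum_coe_sort s]
    exact Finset.sum_congr rfl fun q _ => congrFun (hχ q) x

/-- A bounded open set with interior cones at all points of its closure. -/
structure IsConeDomain {d : ℕ} (K : Set (Euc d)) : Prop where
  isOpen : IsOpen K
  isBounded : Bornology.IsBounded K
  cone : ∀ p ∈ closure K, ∃ w r, InteriorCone K p w r

theorem RegularMap.isConeDomain {d : ℕ} {f : Euc d → Euc d} {A : Euc d → Euc d →L[ℝ] Euc d}
    {C : Set (Euc d)} {κ L : ℝ} (h : RegularMap f A C κ L) : IsConeDomain (f '' C) := by
  refine ⟨h.isOpen_image, ?_, fun p hp => ?_⟩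
  · exact (h.isCompact_closure.image_of_continuousOn h.continuousOn).isBounded.subset
      (image_mono subset_closure)
  · rw [h.closure_image] at hp
    obtain ⟨q, hq, rfl⟩ := hp
    obtain ⟨z, hz⟩ := closure_nonempty_iff.1 ⟨q, hq⟩
    obtain ⟨r, hr⟩ := h.interiorCone hq (w := z - q) (by simpa using hz)
    exact ⟨_, r, hr⟩

/-- A square integrable function on `K` has a measurable representative that vanishes off `K`. -/
theorem exists_representative {d : ℕ} {K : Set (Euc d)} (hK : MeasurableSet K) {v : Euc d → ℝ}
    (hv : MemLp v 2 (volume.restrict K)) :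
    ∃ f : Euc d → ℝ, Measurable f ∧ MemLp f 2 volume ∧ (∀ x ∉ K, f x = 0) ∧
      v =ᵐ[volume.restrict K] f := by
  have h1 := hv.1.ae_eq_mk
  have h2 : v =ᵐ[volume.restrict K] indicator K (hv.1.mk v) := by
    filter_upwards [h1, ae_restrict_mem hK] with x hx hxK
    rw [indicator_of_mem hxK, hx]
  refine ⟨indicator K (hv.1.mk v), hv.1.stronglyMeasurable_mk.measurable.indicator hK, ?_,
    fun x hx => indicator_of_notMem hx _, h2⟩
  rw [memLp_indicator_iff_restrict hK]
  exact hv.ae_eq h1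

/-- For functions supported in a ball `B(p, ρ)`, the fractional norm on `K` is controlled by the one
near the ball: pairs of points at distance at least `r - ρ` contribute only an `L²` norm. -/
theorem exists_fracNormSq_le_of_support {d : ℕ} {K : Set (Euc d)} (hK : MeasurableSet K)
    (hKb : Bornology.IsBounded K) {σ : ℝ} (hσ : 0 ≤ σ) (p : Euc d) {ρ r : ℝ} (hρ : ρ < r) :
    ∃ c : ℝ≥0, ∀ e : Euc d → ℝ, AEMeasurable e (volume.restrict K) →
      (∀ x ∉ Metric.ball p ρ, e x = 0) →
      fracNormSq K σ e ≤ c * fracNormSq (K ∩ Metric.ball p r) σ e := by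
  set A : ℝ := ((r - ρ) ^ ((d : ℝ) + 2 * σ))⁻¹ with hA
  have hA0 : 0 ≤ A := by have : 0 < r - ρ := by linarith
                         positivity
  have hKf : volume K ≠ ⊤ := hKb.measure_lt_top.ne
  refine ⟨1 + 2 * A.toNNReal * (volume K).toNNReal, fun e he h0 => ?_⟩
  set E := K ∩ Metric.ball p r with hE
  have hEm : MeasurableSet E := hK.inter Metric.isOpen_ball.measurableSet
  have hcase : ∀ x y, e x ≠ 0 → y ∉ Metric.ball p r →
      (e x - e y) ^ 2 / ‖x - y‖ ^ ((d : ℝ) + 2 * σ) ≤ A * (e x ^ 2 + e y ^ 2) := by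
    intro x y hx hy
    have hxb : x ∈ Metric.ball p ρ := by
      by_contra h
      exact hx (h0 x h)
    have hey : e y = 0 := h0 y fun h => hy (Metric.ball_subset_ball hρ.le h)
    have h1 : r - ρ ≤ ‖x - y‖ := by
      rw [Metric.mem_ball] at hxb hy
      rw [← dist_eq_norm, dist_comm]
      have := dist_triangle y x p
      linarith
    have h2 : (r - ρ) ^ ((d : ℝ) + 2 * σ) ≤ ‖x - y‖ ^ ((d : ℝ) + 2 * σ) :=
      Real.rpow_le_rpow (by linarith) h1 (by positivity)
    have h3 : 0 < (r - ρ) ^ ((d : ℝ) + 2 * σ) := Real.rpow_pos_of_pos (by linarith) _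
    rw [hey, sub_zero, zero_pow two_ne_zero, add_zero, hA, div_eq_inv_mul]
    gcongr
  have key : ∀ x ∈ K, ∀ y ∈ K,
      ENNReal.ofReal ((e x - e y) ^ 2 / ‖x - y‖ ^ ((d : ℝ) + 2 * σ)) ≤
        indicator E (fun x => indicator E (fun y =>
          ENNReal.ofReal ((e x - e y) ^ 2 / ‖x - y‖ ^ ((d : ℝ) + 2 * σ))) y) x +
        ENNReal.ofReal A * (‖e x‖ₑ ^ 2 + ‖e y‖ₑ ^ 2) := by
    intro x hx y hy
    have hsum : ENNReal.ofReal A * (‖e x‖ₑ ^ 2 + ‖e y‖ₑ ^ 2) =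
        ENNReal.ofReal (A * (e x ^ 2 + e y ^ 2)) := by
      rw [ENNReal.ofReal_mul hA0, ENNReal.ofReal_add (sq_nonneg _) (sq_nonneg _),
        ofReal_sq_eq_enorm_sq, ofReal_sq_eq_enorm_sq]
    by_cases hxE : x ∈ E
    · by_cases hyE : y ∈ E
      · rw [indicator_of_mem hxE, indicator_of_mem hyE]
        exact le_self_add
      · rw [hsum]
        refine le_trans ?_ le_add_self
        have hyb : y ∉ Metric.ball p r := fun h => hyE ⟨hy, h⟩
        by_cases hex : e x = 0
        · have hey : e y = 0 := h0 y fun h => hyb (Metric.ball_subset_ball hρ.le h)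
          simp [hex, hey]
        · exact ENNReal.ofReal_le_ofReal (hcase x y hex hyb)
    · rw [hsum]
      refine le_trans ?_ le_add_self
      have hxb : x ∉ Metric.ball p r := fun h => hxE ⟨hx, h⟩
      by_cases hey : e y = 0
      · have hex : e x = 0 := h0 x fun h => hxb (Metric.ball_subset_ball hρ.le h)
        simp [hex, hey]
      · have := hcase y x hey hxb
        rw [norm_sub_rev, ← sub_sq_comm, add_comm (e y ^ 2)] at this
        exact ENNReal.ofReal_le_ofReal this
  have hL2 : ∫⁻ x in K, ‖e x‖ₑ ^ 2 = ∫⁻ x in E, ‖e x‖ₑ ^ 2 := by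
    have h1 := setLIntegral_indicator (μ := volume) (t := K) hEm fun x => ‖e x‖ₑ ^ 2
    rw [inter_eq_left.2 inter_subset_left] at h1
    rw [← h1]
    refine setLIntegral_congr_fun hK fun x hx => ?_
    by_cases hxE : x ∈ E
    · rw [indicator_of_mem hxE]
    · rw [indicator_of_notMem hxE, h0 x fun h => hxE ⟨hx, Metric.ball_subset_ball hρ.le h⟩]
      simp
  have hen := he.enorm.pow_const 2
  have hg : gagliardoSq K σ e ≤ gagliardoSq E σ e +
      2 * ENNReal.ofReal A * volume K * ∫⁻ x in E, ‖e x‖ₑ ^ 2 := by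
    calc gagliardoSq K σ e ≤ ∫⁻ x in K, (indicator E (fun x => ∫⁻ y in E,
          ENNReal.ofReal ((e x - e y) ^ 2 / ‖x - y‖ ^ ((d : ℝ) + 2 * σ))) x +
          ENNReal.ofReal A * (‖e x‖ₑ ^ 2 * volume K + ∫⁻ y in E, ‖e y‖ₑ ^ 2)) := by
          refine setLIntegral_mono_ae' hK (Eventually.of_forall fun x hx => ?_)
          refine (setLIntegral_mono' hK (key x hx)).trans ?_
          rw [lintegral_add_right' _ ((hen.const_add _).const_mul _),
            lintegral_const_mul' _ _ ENNReal.ofReal_ne_top, lintegral_add_left' aemeasurable_const,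
            setLIntegral_const, hL2]
          gcongr
          by_cases hxE : x ∈ E
          · simp only [indicator_of_mem hxE]
            rw [setLIntegral_indicator hEm, inter_eq_left.2 inter_subset_left]
          · simp [indicator_of_notMem hxE]
      _ = _ := by
          rw [lintegral_add_right' _ (((hen.mul_const _).add_const _).const_mul _),
            lintegral_const_mul' _ _ ENNReal.ofReal_ne_top, lintegral_add_right' _ aemeasurable_const,
            setLIntegral_const, setLIntegral_indicator hEm, inter_eq_left.2 inter_subset_left,
            lintegral_mul_const'' _ hen, hL2]
          simp only [gagliardoSq]
          ring
  rw [fracNormSq, fracNormSq]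
  simp only [ofReal_sq_eq_enorm_sq]
  rw [hL2]
  push_cast
  rw [ENNReal.coe_toNNReal hKf]
  change _ + _ ≤ (1 + 2 * ENNReal.ofReal A * volume K) * _
  calc _ ≤ (∫⁻ x in E, ‖e x‖ₑ ^ 2) + (gagliardoSq E σ e +
        2 * ENNReal.ofReal A * volume K * ∫⁻ x in E, ‖e x‖ₑ ^ 2) := by gcongr
    _ = 1 * ((∫⁻ x in E, ‖e x‖ₑ ^ 2) + gagliardoSq E σ e) +
        2 * ENNReal.ofReal A * volume K * ∫⁻ x in E, ‖e x‖ₑ ^ 2 := by ring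
    _ ≤ _ := by
        rw [add_mul]
        gcongr
        exact le_self_add

theorem InteriorCone.add_smul_mem {d : ℕ} {K : Set (Euc d)} {p w : Euc d} {r : ℝ}
    (h : InteriorCone K p w r) {x z : Euc d} (hx : x ∈ closure K) (hxp : dist x p < r)
    (hz : z ∈ Metric.closedBall w r) {t : ℝ} (ht : 0 < t) (htr : t ≤ r) : x + t • z ∈ K := by
  refine h.subset x hx hxp t ht htr ?_
  rw [mem_closedBall_iff_norm] at hz ⊢
  rw [add_sub_add_left_eq_sub, ← smul_sub, norm_smul, Real.norm_of_nonneg ht.le, mul_comm]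
  gcongr

theorem coneAvg_eq_zero {d : ℕ} {η u : Euc d → ℝ} {t : ℝ} {x : Euc d}
    (h : ∀ z ∈ tsupport η, u (x + t • z) = 0) : coneAvg η t u x = 0 := by
  rw [coneAvg]
  refine integral_eq_zero_of_ae (Eventually.of_forall fun z => ?_)
  by_cases hz : z ∈ tsupport η
  · simp [h z hz]
  · simp [image_eq_zero_of_notMem_tsupport hz]

/-- Near a point with an interior cone, averages over cones of a localized function converge in the
fractional norm of the whole domain. -/
theorem InteriorCone.tendsto_fracNormSq {d : ℕ} {K : Set (Euc d)} (hK : IsConeDomain K)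
    {p w : Euc d} {r : ℝ} (h : InteriorCone K p w r) {η : Euc d → ℝ} (hη : IsMollifier η)
    (hηs : tsupport η ⊆ Metric.closedBall w r) {u : Euc d → ℝ} (hum : Measurable u)
    (hu : MemLp u 2 volume) (hu0 : ∀ x ∉ Metric.ball p (r / 2), u x = 0) {σ : ℝ} (hσ : 0 ≤ σ)
    (huσ : fracNormSq K σ u < ⊤) :
    Tendsto (fun t => fracNormSq K σ (fun x => coneAvg η t u x - u x)) (𝓝[>] 0) (𝓝 0) := by
  have hr := h.pos
  have hKm := hK.isOpen.measurableSet
  obtain ⟨c, hc⟩ := exists_fracNormSq_le_of_support hKm hK.isBounded hσ p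
    (show 3 / 4 * r < r by linarith)
  have h1 := hη.tendsto_fracNormSq_coneAvg hKm
    (hKm.inter (Metric.isOpen_ball (x := p) (ε := r)).measurableSet) inter_subset_left (by
      filter_upwards [Ioc_mem_nhdsGT hr] with t ht x hx z hz
      exact h.add_smul_mem (subset_closure hx.1) hx.2 (hηs hz) ht.1 ht.2) hum hu huσ
  have h2 := ENNReal.Tendsto.const_mul (a := (c : ℝ≥0∞)) h1 (Or.inr ENNReal.coe_ne_top)
  rw [mul_zero] at h2
  refine tendsto_of_tendsto_of_tendsto_of_le_of_le' tendsto_const_nhds h2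
    (Eventually.of_forall fun _ => zero_le) ?_
  have hR : 0 < ‖w‖ + r := by positivity
  filter_upwards [Ioc_mem_nhdsGT (show 0 < r / 4 / (‖w‖ + r) by positivity)] with t ht
  refine hc _ ?_ fun x hx => ?_
  · exact ((hη.contDiff_coneAvg ht.1
      (hu.locallyIntegrable (by norm_num))).continuous.measurable.sub hum).aemeasurable
  · rw [Metric.mem_ball, not_lt] at hx
    rw [hu0 x (by rw [Metric.mem_ball]; linarith), sub_zero]
    refine coneAvg_eq_zero fun z hz => hu0 _ ?_
    rw [Metric.mem_ball, not_lt]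
    have h3 : ‖z‖ ≤ ‖w‖ + r := by
      have := hηs hz
      rw [mem_closedBall_iff_norm] at this
      have h4 := norm_add_le (z - w) w
      rw [sub_add_cancel] at h4
      linarith
    have h5 : dist x (x + t • z) ≤ r / 4 := by
      rw [dist_self_add_right, norm_smul, Real.norm_of_nonneg ht.1.le]
      calc t * ‖z‖ ≤ r / 4 / (‖w‖ + r) * (‖w‖ + r) := by gcongr; exact ht.2
        _ = _ := div_mul_cancel₀ _ hR.ne'
    have := dist_triangle x (x + t • z) p
    linarith

/-- Smooth functions are dense in the fractional spaces of a domain with interior cones. -/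
theorem IsConeDomain.exists_smooth_approx {d : ℕ} (hd : 0 < d) {K : Set (Euc d)}
    (hK : IsConeDomain K) {σ : ℝ} (hσ : 0 ≤ σ) (hσ1 : σ < 1) {v : Euc d → ℝ}
    (hv : MemLp v 2 (volume.restrict K)) (hvσ : fracNormSq K σ v < ⊤) :
    ∃ φ : ℕ → Euc d → ℝ, (∀ n, ContDiff ℝ ∞ (φ n) ∧ HasCompactSupport (φ n)) ∧
      Tendsto (fun n => fracNormSq K σ (fun x => φ n x - v x)) atTop (𝓝 0) := by
  have hKm := hK.isOpen.measurableSet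
  obtain ⟨f, hfm, hf, hf0, hvf⟩ := exists_representative hKm hv
  choose! w r hwr using hK.cone
  obtain ⟨s, χ, hsK, hχ, hsum⟩ := exists_finite_partition hK.isBounded.isCompact_closure
    (fun p => r p / 2) (fun p hp => half_pos (hwr p hp).pos)
  have hη : ∀ p ∈ s, ∃ η : Euc d → ℝ, IsMollifier η ∧ tsupport η ⊆ Metric.closedBall (w p) (r p) :=
    fun p hp => exists_isMollifier _ (hwr p (hsK p hp)).pos
  choose! η hη hηs using hη
  have hum : ∀ p ∈ s, Measurable fun x => χ p x * f x := fun p hp =>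
    (hχ p hp).1.continuous.measurable.mul hfm
  have hu : ∀ p ∈ s, MemLp (fun x => χ p x * f x) 2 volume := fun p hp => by
    obtain ⟨b, l, hb, -⟩ := (hχ p hp).2.1.exists_bound_lipschitz (hχ p hp).1
    refine MemLp.of_le_mul (c := b) hf (hum p hp).aestronglyMeasurable
      (Eventually.of_forall fun x => ?_)
    rw [norm_mul]
    gcongr
    exact hb x
  have huc : ∀ p ∈ s, HasCompactSupport fun x => χ p x * f x := fun p hp =>
    (hχ p hp).2.1.mul_right
  -- each localized function is approximated by averages along the cone of its own ball
  have hconv : ∀ p ∈ s, Tendsto (fun t => fracNormSq K σ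
      (fun x => coneAvg (η p) t (fun x => χ p x * f x) x - χ p x * f x)) (𝓝[>] 0) (𝓝 0) := by
    intro p hp
    obtain ⟨b, l, hb, hl⟩ := (hχ p hp).2.1.exists_bound_lipschitz (hχ p hp).1
    obtain ⟨c, hc⟩ := exists_fracNormSq_mul_le hd hK.isBounded hKm hσ1 hb hl
    refine (hwr p (hsK p hp)).tendsto_fracNormSq hK (hη p hp) (hηs p hp) (hum p hp) (hu p hp)
      (fun x hx => ?_) hσ ((hc f hfm.aemeasurable).trans_lt
        (ENNReal.mul_lt_top ENNReal.coe_lt_top ?_))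
    · rw [image_eq_zero_of_notMem_tsupport fun h => hx ((hχ p hp).2.2 h), zero_mul]
    · rwa [← fracNormSq_congr_ae σ hvf]
  set t : ℕ → ℝ := fun n => 1 / ((n : ℝ) + 1) with ht
  have ht0 : ∀ n, 0 < t n := fun n => by positivity
  have htlim : Tendsto t atTop (𝓝[>] 0) := tendsto_nhdsWithin_iff.2
    ⟨tendsto_one_div_add_atTop_nhds_zero_nat, Eventually.of_forall ht0⟩
  have hsm : ∀ p ∈ s, ∀ n, ContDiff ℝ ∞ (coneAvg (η p) (t n) fun x => χ p x * f x) :=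
    fun p hp n => (hη p hp).contDiff_coneAvg (ht0 n) ((hu p hp).locallyIntegrable (by norm_num))
  have hcs : ∀ p ∈ s, ∀ n, HasCompactSupport (coneAvg (η p) (t n) fun x => χ p x * f x) :=
    fun p hp n => (hη p hp).hasCompactSupport_coneAvg (ht0 n) (huc p hp)
  have hfin : ∀ s' : Finset (Euc d), s' ⊆ s → Tendsto (fun n => fracNormSq K σ (fun x =>
      ∑ p ∈ s', (coneAvg (η p) (t n) (fun x => χ p x * f x) x - χ p x * f x))) atTop (𝓝 0) := by
    intro s'
    induction s' using Finset.induction_on with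
    | empty => intro _; simp [fracNormSq, gagliardoSq]
    | insert p s' hp ih =>
      intro hs'
      have hps : p ∈ s := hs' (Finset.mem_insert_self _ _)
      have hs's : s' ⊆ s := (Finset.subset_insert _ _).trans hs'
      have h1 := ENNReal.Tendsto.const_mul (a := 2) ((hconv p hps).comp htlim)
        (Or.inr ENNReal.ofNat_ne_top)
      have h2 := ENNReal.Tendsto.const_mul (a := 2) (ih hs's) (Or.inr ENNReal.ofNat_ne_top)
      have h3 := h1.add h2
      simp only [mul_zero, add_zero] at h3
      refine tendsto_of_tendsto_of_tendsto_of_le_of_le tendsto_const_nhds h3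
        (fun _ => zero_le) fun n => ?_
      simp only [Finset.sum_insert hp]
      exact fracNormSq_add_le ((hsm p hps n).continuous.measurable.sub (hum p hps)).aemeasurable
        (Finset.aemeasurable_fun_sum _ fun q hq =>
          ((hsm q (hs's hq) n).continuous.measurable.sub (hum q (hs's hq))).aemeasurable) σ
  refine ⟨fun n x => ∑ p ∈ s, coneAvg (η p) (t n) (fun x => χ p x * f x) x, fun n => ⟨?_, ?_⟩, ?_⟩
  · exact ContDiff.sum fun p hp => hsm p hp n
  · refine Metric.isCompact_of_isClosed_isBounded (isClosed_tsupport _) ?_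
    refine Bornology.IsBounded.subset (t := ⋃ p ∈ s, tsupport
      (coneAvg (η p) (t n) fun x => χ p x * f x)) ?_ ?_
    · exact (Bornology.isBounded_biUnion s.finite_toSet).2 fun p hp =>
        (hcs p hp n).isCompact.isBounded
    · refine closure_minimal (fun x hx => ?_)
        (s.finite_toSet.isClosed_biUnion fun p _ => isClosed_tsupport _)
      obtain ⟨p, hp, hpx⟩ := Finset.exists_ne_zero_of_sum_ne_zero (Function.mem_support.1 hx)
      exact mem_biUnion hp (subset_closure hpx)
  · refine (hfin s subset_rfl).congr fun n => fracNormSq_congr_ae σ ?_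
    filter_upwards [hvf, ae_restrict_mem hKm] with x hx hxK
    rw [Finset.sum_sub_distrib, ← Finset.sum_mul, hsum x (subset_closure hxK), one_mul, hx]

/-! ### First order Sobolev functions have fractional derivatives -/

theorem lintegral_comp_smul_eq {d : ℕ} {s : ℝ} (hs : 0 < s) {G : Euc d → ℝ≥0∞}
    (hG : Measurable G) : ∫⁻ h, G (s • h) = ENNReal.ofReal ((s ^ d)⁻¹) * ∫⁻ h, G h := by
  have h1 := Measure.map_addHaar_smul (volume : Measure (Euc d)) hs.ne'
  have h2 : ∫⁻ h, G (s • h) = ∫⁻ h, G h ∂(Measure.map (s • ·) volume) :=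
    (lintegral_map hG (measurable_const_smul s)).symm
  rw [h2, h1, lintegral_smul_measure, finrank_euclideanSpace, Fintype.card_fin,
    abs_of_pos (by positivity), smul_eq_mul]

theorem measurable_norm_rpow_sub_left {d : ℕ} (x : Euc d) (a : ℝ) :
    Measurable fun z => ENNReal.ofReal (‖x - z‖ ^ a) := by
  fun_prop

/-- Substituting `z = x + s • (y - x)`, a dilation whose factor is at least one half. -/
theorem lintegral_segment_point_le {d : ℕ} {a : ℝ} (ha0 : 0 ≤ a) {D : Set (Euc d)}
    (hDm : MeasurableSet D) (hD : Convex ℝ D) {g : Euc d → ℝ≥0∞} (hg : Measurable g) {s : ℝ}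
    (hs1 : 1 / 2 ≤ s) (hs2 : s < 1) {x : Euc d} (hx : x ∈ D) :
    ∫⁻ y in D, g (x + s • (y - x)) * ENNReal.ofReal (‖x - y‖ ^ (-a)) ≤
      2 ^ d * ∫⁻ z in D, g z * ENNReal.ofReal (‖x - z‖ ^ (-a)) := by
  have hs0 : 0 < s := by linarith
  set G₀ : Euc d → ℝ≥0∞ :=
    indicator D (fun z => g z * ENNReal.ofReal (‖x - z‖ ^ (-a))) with hG₀
  have hG₀m : Measurable G₀ := (hg.mul (measurable_norm_rpow_sub_left x (-a))).indicator hDm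
  have hGm : Measurable fun h => G₀ (x + h) := hG₀m.comp (measurable_const_add x)
  calc _ ≤ ∫⁻ y in D, G₀ (x + s • (y - x)) := by
        refine setLIntegral_mono' hDm fun y hy => ?_
        have h1 : x + s • (y - x) ∈ D := hD.add_smul_sub_mem hx hy ⟨hs0.le, hs2.le⟩
        rw [hG₀, indicator_of_mem h1]
        refine mul_le_mul' le_rfl (ENNReal.ofReal_le_ofReal ?_)
        rw [sub_add_cancel_left, norm_neg, norm_smul, Real.norm_of_nonneg hs0.le]
        rcases eq_or_ne y x with rfl | hyx
        · simp
        · have h2 : 0 < ‖y - x‖ := norm_pos_iff.2 (sub_ne_zero.2 hyx)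
          rw [norm_sub_rev x y]
          exact Real.rpow_le_rpow_of_nonpos (by positivity)
            (mul_le_of_le_one_left h2.le hs2.le) (by linarith)
    _ ≤ ∫⁻ y, G₀ (x + s • (y - x)) := setLIntegral_le_lintegral _ _
    _ = ENNReal.ofReal ((s ^ d)⁻¹) * ∫⁻ h, G₀ (x + h) := by
        rw [lintegral_sub_right_eq_self (fun y => G₀ (x + s • y)) x,
          lintegral_comp_smul_eq hs0 hGm]
    _ ≤ 2 ^ d * ∫⁻ h, G₀ (x + h) := by
        gcongr
        rw [show (2 : ℝ≥0∞) ^ d = ENNReal.ofReal (2 ^ d) by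
          rw [ENNReal.ofReal_pow (by norm_num)]; norm_num]
        refine ENNReal.ofReal_le_ofReal ?_
        rw [← inv_pow]
        gcongr
        rw [inv_le_comm₀ hs0 (by norm_num)]
        linarith
    _ = _ := by
        rw [lintegral_add_left_eq_self G₀ x, hG₀, lintegral_indicator hDm]

/-- Averages of `g` over all segments in a convex set, weighted by an integrable power of the
length. Reversing the segments reduces this to the halves away from the first end point. -/
theorem exists_lintegral_segment_le {d : ℕ} (hd : 0 < d) {a : ℝ} (ha0 : 0 ≤ a) (ha : a < d)
    (R : ℝ) : ∃ c : ℝ≥0, ∀ D : Set (Euc d), MeasurableSet D → Convex ℝ D →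
      D ⊆ Metric.ball 0 R → ∀ g : Euc d → ℝ≥0∞, Measurable g →
      ∫⁻ x in D, ∫⁻ y in D, (∫⁻ s in Ioo (0 : ℝ) 1, g (x + s • (y - x))) *
        ENNReal.ofReal (‖x - y‖ ^ (-a)) ≤ c * ∫⁻ x in D, g x := by
  obtain ⟨c, hc⟩ := exists_lintegral_rpow_norm_le hd ha (2 * R)
  refine ⟨2 ^ d * c, fun D hDm hD hDR g hg => ?_⟩
  have hDb : ∀ x ∈ D, D ⊆ Metric.ball x (2 * R) := fun x hx y hy => by
    have h1 := hDR hx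
    have h2 := hDR hy
    rw [mem_ball_zero_iff] at h1 h2
    rw [mem_ball_iff_norm]
    have := norm_sub_le y x
    linarith
  have hkm : Measurable fun p : Euc d × Euc d => ENNReal.ofReal (‖p.1 - p.2‖ ^ (-a)) :=
    (measurable_norm_sub_rpow _).ennreal_ofReal
  set J : ℝ → ℝ≥0∞ := fun s => ∫⁻ x in D, ∫⁻ y in D,
    g (x + s • (y - x)) * ENNReal.ofReal (‖x - y‖ ^ (-a)) with hJ
  have hhalf : ∀ s : ℝ, 1 / 2 ≤ s → s < 1 → J s ≤ (2 ^ d * c : ℝ≥0) * ∫⁻ x in D, g x := by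
    intro s hs1 hs2
    calc J s ≤ ∫⁻ x in D, 2 ^ d * ∫⁻ z in D, g z * ENNReal.ofReal (‖x - z‖ ^ (-a)) :=
          setLIntegral_mono' hDm fun x hx => lintegral_segment_point_le ha0 hDm hD hg hs1 hs2 hx
      _ = 2 ^ d * ∫⁻ z in D, ∫⁻ x in D, g z * ENNReal.ofReal (‖x - z‖ ^ (-a)) := by
          rw [lintegral_const_mul' _ _ (by finiteness), lintegral_lintegral_swap]
          exact ((hg.comp measurable_snd).mul hkm).aemeasurable
      _ ≤ 2 ^ d * ∫⁻ z in D, g z * c := by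
          refine mul_le_mul' le_rfl (setLIntegral_mono' hDm fun z hz => ?_)
          simp only [norm_sub_rev _ z]
          rw [lintegral_const_mul _ (measurable_norm_rpow_sub_left z (-a))]
          gcongr
          exact (lintegral_mono_set (hDb z hz)).trans (hc z)
      _ = _ := by
          rw [lintegral_mul_const _ hg]
          push_cast
          ring
  have hm2 : ∀ s : ℝ, Measurable fun p : Euc d × Euc d => g (p.1 + s • (p.2 - p.1)) :=
    fun s => hg.comp (by fun_prop)
  have hsymm : ∀ s, J s = J (1 - s) := by
    intro s
    simp only [hJ]
    rw [lintegral_lintegral_swap]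
    · refine lintegral_congr fun x => lintegral_congr fun y => ?_
      rw [norm_sub_rev]
      congr 2
      module
    · exact ((hm2 s).mul hkm).aemeasurable
  have hall : ∀ s ∈ Ioo (0 : ℝ) 1, J s ≤ (2 ^ d * c : ℝ≥0) * ∫⁻ x in D, g x := by
    intro s hs
    rcases le_total (1 / 2) s with h | h
    · exact hhalf s h hs.2
    · rw [hsymm]
      exact hhalf _ (by linarith) (by linarith [hs.1])
  have hm3 : Measurable fun q : (Euc d × ℝ) × Euc d => g (q.1.1 + q.1.2 • (q.2 - q.1.1)) *
      ENNReal.ofReal (‖q.1.1 - q.2‖ ^ (-a)) := by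
    have h1 : Measurable fun q : (Euc d × ℝ) × Euc d => g (q.1.1 + q.1.2 • (q.2 - q.1.1)) :=
      hg.comp (by fun_prop)
    exact h1.mul (by fun_prop)
  have hm1 : ∀ x, Measurable fun q : Euc d × ℝ => g (x + q.2 • (q.1 - x)) :=
    fun x => hg.comp (by fun_prop)
  calc _ = ∫⁻ x in D, ∫⁻ s in Ioo (0 : ℝ) 1, ∫⁻ y in D,
        g (x + s • (y - x)) * ENNReal.ofReal (‖x - y‖ ^ (-a)) := by
        refine lintegral_congr fun x => ?_
        rw [← lintegral_lintegral_swap]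
        · refine lintegral_congr fun y => ?_
          rw [lintegral_mul_const]
          exact (hm1 x).comp (measurable_const.prodMk measurable_id)
        · have h2 : Measurable fun q : Euc d × ℝ => ENNReal.ofReal (‖x - q.1‖ ^ (-a)) := by
            fun_prop
          exact ((hm1 x).mul h2).aemeasurable
    _ = ∫⁻ s in Ioo (0 : ℝ) 1, J s := by
        rw [lintegral_lintegral_swap]
        exact (Measurable.lintegral_prod_right' hm3).aemeasurable
    _ ≤ ∫⁻ s in Ioo (0 : ℝ) 1, (2 ^ d * c : ℝ≥0) * ∫⁻ x in D, g x :=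
        setLIntegral_mono' measurableSet_Ioo hall
    _ = _ := by simp

theorem norm_sq_le_sum_sq {d : ℕ} (T : Euc d →L[ℝ] ℝ) : ‖T‖ ^ 2 ≤ ∑ i, T (stdVec i) ^ 2 := by
  have h : ‖T‖ ≤ √(∑ i, T (stdVec i) ^ 2) := by
    refine T.opNorm_le_bound (Real.sqrt_nonneg _) fun x => ?_
    have h1 : T x = ∑ i, x i * T (stdVec i) := by
      conv_lhs => rw [← (EuclideanSpace.basisFun (Fin d) ℝ).sum_repr x]
      simp [stdVec]
    rw [h1, EuclideanSpace.norm_eq, mul_comm, Real.norm_eq_abs]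
    simp only [Real.norm_eq_abs, sq_abs]
    exact (Real.abs_le_sqrt (Finset.sum_mul_sq_le_sq_mul_sq _ _ _)).trans
      (le_of_eq (Real.sqrt_mul (by positivity) _))
  calc ‖T‖ ^ 2 ≤ √(∑ i, T (stdVec i) ^ 2) ^ 2 := by gcongr
    _ = _ := Real.sq_sqrt (by positivity)

namespace RegularMap

variable {d : ℕ} {f : Euc d → Euc d} {A : Euc d → Euc d →L[ℝ] Euc d} {C : Set (Euc d)} {κ L : ℝ}

theorem hasFDerivAt (h : RegularMap f A C κ L) {x : Euc d} (hx : x ∈ C) : HasFDerivAt f (A x) x :=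
  (h.deriv x (subset_closure hx)).hasFDerivAt
    (mem_of_superset (h.isOpen.mem_nhds hx) subset_closure)

theorem exists_norm_le (h : RegularMap f A C κ L) : ∃ B : ℝ, 0 ≤ B ∧ ∀ x ∈ closure C, ‖A x‖ ≤ B := by
  obtain ⟨B, hB⟩ := h.isCompact_closure.exists_bound_of_continuousOn h.cont
  exact ⟨max B 0, le_max_right _ _, fun x hx => (hB x hx).trans (le_max_left _ _)⟩

theorem exists_det_bounds (h : RegularMap f A C κ L) :
    ∃ a b : ℝ≥0, ∀ x ∈ C, ENNReal.ofReal |(A x).det| ≤ a ∧ 1 ≤ b * ENNReal.ofReal |(A x).det| := by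
  have hc : ContinuousOn (fun x => (A x).det) (closure C) :=
    ContinuousLinearMap.continuous_det.comp_continuousOn h.cont
  have h0 : ∀ x ∈ closure C, (A x).det ≠ 0 := fun x hx => by
    obtain ⟨e, he⟩ := h.exists_equiv hx
    rw [← he]
    exact (LinearEquiv.isUnit_det' e.toLinearEquiv).ne_zero
  obtain ⟨a, ha⟩ := h.isCompact_closure.exists_bound_of_continuousOn hc
  obtain ⟨b, hb⟩ := h.isCompact_closure.exists_bound_of_continuousOn (hc.inv₀ h0)
  refine ⟨a.toNNReal, b.toNNReal, fun x hx => ⟨ENNReal.ofReal_le_ofReal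
    (ha x (subset_closure hx)), ?_⟩⟩
  have h1 := hb x (subset_closure hx)
  have h2 : 0 < |(A x).det| := abs_pos.2 (h0 x (subset_closure hx))
  rw [Pi.inv_apply, norm_inv, Real.norm_eq_abs] at h1
  change 1 ≤ ENNReal.ofReal b * _
  rw [← ENNReal.ofReal_mul ((inv_nonneg.2 h2.le).trans h1), ← ENNReal.ofReal_one]
  refine ENNReal.ofReal_le_ofReal ?_
  rwa [← inv_le_iff_one_le_mul₀ h2]

theorem lintegral_image (h : RegularMap f A C κ L) {D : Set (Euc d)} (hD : MeasurableSet D)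
    (hDC : D ⊆ C) (F : Euc d → ℝ≥0∞) :
    ∫⁻ y in f '' D, F y = ∫⁻ x in D, ENNReal.ofReal |(A x).det| * F (f x) :=
  lintegral_image_eq_lintegral_abs_det_fderiv_mul volume hD
    (fun _ hx => (h.hasFDerivAt (hDC hx)).hasFDerivWithinAt)
    (h.injOn.mono (hDC.trans subset_closure)) F

/-- The mean value inequality in integral form along the image of a segment. -/
theorem enorm_sub_sq_le (h : RegularMap f A C κ L) {B : ℝ} (hB0 : 0 ≤ B)
    (hB : ∀ x ∈ closure C, ‖A x‖ ≤ B) {φ : Euc d → ℝ} (hφ : ContDiff ℝ 1 φ) {x y : Euc d}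
    (hx : x ∈ C) (hy : y ∈ C) :
    ‖φ (f x) - φ (f y)‖ₑ ^ 2 ≤ ENNReal.ofReal (B ^ 2 * ‖x - y‖ ^ 2) *
      ∫⁻ s in Ioo (0 : ℝ) 1, ‖fderiv ℝ φ (f (x + s • (y - x)))‖ₑ ^ 2 := by
  set γ : ℝ → Euc d := fun s => x + s • (y - x) with hγ
  have hγC : ∀ s ∈ Icc (0 : ℝ) 1, γ s ∈ C := fun s hs => h.convex.add_smul_sub_mem hx hy hs
  have hγc : Continuous γ := by fun_prop
  set g : ℝ → ℝ := fun s => fderiv ℝ φ (f (γ s)) (A (γ s) (y - x)) with hg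
  have hfγ : ContinuousOn (fun s => f (γ s)) (Icc 0 1) :=
    h.continuousOn.comp hγc.continuousOn fun s hs => subset_closure (hγC s hs)
  have hDφ : ContinuousOn (fun s => fderiv ℝ φ (f (γ s))) (Icc 0 1) :=
    (hφ.continuous_fderiv one_ne_zero).comp_continuousOn hfγ
  have hgc : ContinuousOn g (Icc 0 1) := by
    refine hDφ.clm_apply (ContinuousOn.clm_apply ?_ continuousOn_const)
    exact h.cont.comp hγc.continuousOn fun s hs => subset_closure (hγC s hs)
  have hder : ∀ s ∈ uIcc (0 : ℝ) 1, HasDerivAt (fun s => φ (f (γ s))) (g s) s := by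
    intro s hs
    rw [uIcc_of_le zero_le_one] at hs
    have h1 : HasDerivAt γ (y - x) s := by
      have := ((hasDerivAt_id s).smul_const (y - x)).const_add x
      rwa [one_smul] at this
    have h2 := (h.hasFDerivAt (hγC s hs)).comp_hasDerivAt s h1
    exact ((hφ.differentiable one_ne_zero _).hasFDerivAt).comp_hasDerivAt s h2
  have hftc := intervalIntegral.integral_eq_sub_of_hasDerivAt hder
    (hgc.intervalIntegrable_of_Icc zero_le_one)
  have h0 : γ 0 = x := by simp [hγ]
  have h1 : γ 1 = y := by simp [hγ]
  rw [h0, h1, intervalIntegral.integral_of_le zero_le_one, integral_Ioc_eq_integral_Ioo] at hftc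
  have hprob : IsProbabilityMeasure (volume.restrict (Ioo (0 : ℝ) 1)) := ⟨by simp⟩
  have hgm : AEStronglyMeasurable g (volume.restrict (Ioo (0 : ℝ) 1)) :=
    (hgc.mono Ioo_subset_Icc_self).aestronglyMeasurable measurableSet_Ioo
  have h2 : ‖φ (f y) - φ (f x)‖ₑ ≤ eLpNorm g 2 (volume.restrict (Ioo (0 : ℝ) 1)) := by
    rw [← hftc]
    refine (enorm_integral_le_lintegral_enorm _).trans ?_
    rw [← eLpNorm_one_eq_lintegral_enorm]
    exact eLpNorm_le_eLpNorm_of_exponent_le (by norm_num) hgm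
  rw [← enorm_neg, neg_sub]
  calc _ ≤ eLpNorm g 2 (volume.restrict (Ioo (0 : ℝ) 1)) ^ 2 := by gcongr
    _ = ∫⁻ s in Ioo (0 : ℝ) 1, ‖g s‖ₑ ^ 2 := eLpNorm_two_sq _ _
    _ ≤ ∫⁻ s in Ioo (0 : ℝ) 1, ENNReal.ofReal (B ^ 2 * ‖x - y‖ ^ 2) *
          ‖fderiv ℝ φ (f (x + s • (y - x)))‖ₑ ^ 2 := by
        refine setLIntegral_mono' measurableSet_Ioo fun s hs => ?_
        have h3 : ‖g s‖ ≤ B * ‖x - y‖ * ‖fderiv ℝ φ (f (x + s • (y - x)))‖ := by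
          refine (ContinuousLinearMap.le_opNorm _ _).trans ?_
          rw [mul_comm]
          gcongr
          refine (ContinuousLinearMap.le_opNorm _ _).trans ?_
          rw [norm_sub_rev]
          gcongr
          exact hB _ (subset_closure (hγC s (Ioo_subset_Icc_self hs)))
        rw [← mul_pow, ENNReal.ofReal_pow (by positivity), ← mul_pow]
        gcongr
        rw [← ofReal_norm, ← ofReal_norm, ← ENNReal.ofReal_mul (by positivity)]
        exact ENNReal.ofReal_le_ofReal h3
    _ = _ := lintegral_const_mul' _ _ ENNReal.ofReal_ne_top

/-- On the regular image of a convex set the fractional seminorm of a smooth function is controlled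
by the `L²` norm of its gradient. The constant serves all convex open subsets at once. -/
theorem exists_gagliardoSq_le (hd : 0 < d) (h : RegularMap f A C κ L) {σ : ℝ}
    (hσ : 1 / 2 ≤ σ) (hσ1 : σ < 1) :
    ∃ c : ℝ≥0, ∀ D ⊆ C, IsOpen D → Convex ℝ D → ∀ φ : Euc d → ℝ, ContDiff ℝ 1 φ →
      gagliardoSq (f '' D) σ φ ≤ c * ∫⁻ x in f '' D, ‖fderiv ℝ φ x‖ₑ ^ 2 := by
  have hκ := h.pos
  obtain ⟨R, hR⟩ := h.bounded.subset_ball 0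
  obtain ⟨B, hB0, hB⟩ := h.exists_norm_le
  obtain ⟨a, b, hab⟩ := h.exists_det_bounds
  have hd1 : (1 : ℝ) ≤ d := by exact_mod_cast hd
  obtain ⟨c, hc⟩ := exists_lintegral_segment_le hd (a := (d : ℝ) + 2 * σ - 2) (by linarith)
    (by linarith) R
  set k : ℝ := (κ ^ ((d : ℝ) + 2 * σ))⁻¹ * B ^ 2 with hk
  have hk0 : 0 ≤ k := by positivity
  refine ⟨a * a * k.toNNReal * c * b, fun D hDC hDo hD φ hφ => ?_⟩
  have hDm := hDo.measurableSet
  set g : Euc d → ℝ≥0∞ := indicator D fun z => ‖fderiv ℝ φ (f z)‖ₑ ^ 2 with hg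
  have hgm : Measurable g := by
    have h1 : ContinuousOn (fun z => ‖fderiv ℝ φ (f z)‖ₑ ^ 2) D := by
      refine (ENNReal.continuous_pow 2).comp_continuousOn ?_
      refine continuous_enorm.comp_continuousOn ?_
      exact (hφ.continuous_fderiv one_ne_zero).comp_continuousOn
        (h.continuousOn.mono (hDC.trans subset_closure))
    classical
    rw [hg, ← piecewise_eq_indicator]
    exact h1.measurable_piecewise continuousOn_const hDm
  have hpt : ∀ x ∈ D, ∀ y ∈ D,
      ENNReal.ofReal ((φ (f x) - φ (f y)) ^ 2 /
      ‖f x - f y‖ ^ ((d : ℝ) + 2 * σ)) ≤ ENNReal.ofReal k *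
      ((∫⁻ s in Ioo (0 : ℝ) 1, g (x + s • (y - x))) *
        ENNReal.ofReal (‖x - y‖ ^ (-((d : ℝ) + 2 * σ - 2)))) := by
    intro x hx y hy
    rcases eq_or_ne x y with rfl | hxy
    · simp
    have hxy0 : 0 < ‖x - y‖ := norm_pos_iff.2 (sub_ne_zero.2 hxy)
    have h1 := h.enorm_sub_sq_le hB0 hB hφ (hDC hx) (hDC hy)
    have h2 : ∫⁻ s in Ioo (0 : ℝ) 1, ‖fderiv ℝ φ (f (x + s • (y - x)))‖ₑ ^ 2 =
        ∫⁻ s in Ioo (0 : ℝ) 1, g (x + s • (y - x)) := by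
      refine setLIntegral_congr_fun measurableSet_Ioo fun s hs => ?_
      simp only [hg]
      rw [indicator_of_mem (hD.add_smul_sub_mem hx hy (Ioo_subset_Icc_self hs))]
    rw [h2] at h1
    have h3 : (‖f x - f y‖ ^ ((d : ℝ) + 2 * σ))⁻¹ ≤
        (κ ^ ((d : ℝ) + 2 * σ))⁻¹ * ‖x - y‖ ^ (-((d : ℝ) + 2 * σ)) := by
      rw [Real.rpow_neg hxy0.le, ← mul_inv, ← Real.mul_rpow hκ.le hxy0.le]
      gcongr
      exact h.lower x (subset_closure (hDC hx)) y (subset_closure (hDC hy))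
    have h4 : ‖x - y‖ ^ 2 * ‖x - y‖ ^ (-((d : ℝ) + 2 * σ)) =
        ‖x - y‖ ^ (-((d : ℝ) + 2 * σ - 2)) := by
      rw [← Real.rpow_natCast, ← Real.rpow_add hxy0]
      congr 1
      push_cast
      ring
    rw [div_eq_mul_inv, ENNReal.ofReal_mul (sq_nonneg _), ofReal_sq_eq_enorm_sq]
    calc _ ≤ (ENNReal.ofReal (B ^ 2 * ‖x - y‖ ^ 2) *
          ∫⁻ s in Ioo (0 : ℝ) 1, g (x + s • (y - x))) *
          ENNReal.ofReal ((κ ^ ((d : ℝ) + 2 * σ))⁻¹ * ‖x - y‖ ^ (-((d : ℝ) + 2 * σ))) := by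
          gcongr
      _ = _ := by
          rw [mul_right_comm, ← ENNReal.ofReal_mul (by positivity),
            mul_comm (lintegral _ _) (ENNReal.ofReal (_ ^ _)), ← mul_assoc (ENNReal.ofReal k),
            ← ENNReal.ofReal_mul hk0, ← h4, hk]
          congr 2
          ring
  have hI : ∫⁻ x in D, g x ≤ b * ∫⁻ x in f '' D, ‖fderiv ℝ φ x‖ₑ ^ 2 := by
    rw [h.lintegral_image hDm hDC, ← lintegral_const_mul' _ _ ENNReal.coe_ne_top]
    refine setLIntegral_mono' hDm fun x hx => ?_
    rw [hg, indicator_of_mem hx, ← mul_assoc]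
    exact le_mul_of_one_le_left zero_le (hab x (hDC hx)).2
  calc gagliardoSq (f '' D) σ φ = ∫⁻ x in D, ENNReal.ofReal |(A x).det| * ∫⁻ y in D,
        ENNReal.ofReal |(A y).det| * ENNReal.ofReal ((φ (f x) - φ (f y)) ^ 2 /
          ‖f x - f y‖ ^ ((d : ℝ) + 2 * σ)) := by
        rw [gagliardoSq, h.lintegral_image hDm hDC]
        refine lintegral_congr fun x => ?_
        rw [h.lintegral_image hDm hDC]
    _ ≤ ∫⁻ x in D, a * ∫⁻ y in D, a * (ENNReal.ofReal k *
          ((∫⁻ s in Ioo (0 : ℝ) 1, g (x + s • (y - x))) *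
            ENNReal.ofReal (‖x - y‖ ^ (-((d : ℝ) + 2 * σ - 2))))) := by
        refine setLIntegral_mono' hDm fun x hx => ?_
        refine mul_le_mul' (hab x (hDC hx)).1 (setLIntegral_mono' hDm fun y hy => ?_)
        exact mul_le_mul' (hab y (hDC hy)).1 (hpt x hx y hy)
    _ = a * a * ENNReal.ofReal k * ∫⁻ x in D, ∫⁻ y in D,
          (∫⁻ s in Ioo (0 : ℝ) 1, g (x + s • (y - x))) *
            ENNReal.ofReal (‖x - y‖ ^ (-((d : ℝ) + 2 * σ - 2))) := by
        rw [lintegral_const_mul' _ _ ENNReal.coe_ne_top, mul_assoc, mul_assoc]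
        congr 1
        rw [← mul_assoc, ← lintegral_const_mul' _ _ (by finiteness)]
        refine lintegral_congr fun x => ?_
        rw [lintegral_const_mul' _ _ ENNReal.coe_ne_top,
          lintegral_const_mul' _ _ ENNReal.ofReal_ne_top, mul_assoc]
    _ ≤ a * a * ENNReal.ofReal k * (c * (b * ∫⁻ x in f '' D, ‖fderiv ℝ φ x‖ₑ ^ 2)) := by
        gcongr
        refine (hc D hDm hD (hDC.trans hR) g hgm).trans ?_
        gcongr
    _ = _ := by
        push_cast
        rw [ENNReal.ofReal]
        ring

end RegularMap

namespace IsMollifier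

variable {d : ℕ} {η : Euc d → ℝ}

theorem tendsto_eLpNorm_coneAvg (hη : IsMollifier η) {f : Euc d → ℝ} (hfm : Measurable f)
    (hf : MemLp f 2 volume) :
    Tendsto (fun t => eLpNorm (fun x => coneAvg η t f x - f x) 2 volume) (𝓝[>] 0) (𝓝 0) := by
  have h1 := (tendsto_lintegral_average hη (ContinuousLinearMap.id ℝ (Euc d)) hfm hf).mono_left
    (nhdsWithin_le_nhds (s := Ioi (0 : ℝ)))
  have h2 := (ENNReal.continuous_rpow_const (y := 1 / 2)).tendsto 0 |>.comp h1
  rw [ENNReal.zero_rpow_of_pos (by norm_num)] at h2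
  refine h2.congr' ?_
  filter_upwards [self_mem_nhdsWithin] with t ht
  have h3 : ∀ x, ∫ z, η z * (f (x + t • z) - f x) = coneAvg η t f x - f x := by
    intro x
    simp only [mul_sub]
    rw [integral_sub (hη.integrable_mul_comp hf x (ne_of_gt ht)) (hη.integrable.mul_const _),
      hη.integral_mul_const, coneAvg]
  have h4 := eLpNorm_two_sq (fun x => coneAvg η t f x - f x) volume
  simp only [Function.comp_apply, ContinuousLinearMap.id_apply, h3, ← h4]
  rw [← ENNReal.rpow_natCast, ← ENNReal.rpow_mul]
  norm_num

/-- Averaging over cones does not increase the `L²` norm. -/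
theorem lintegral_coneAvg_sq_le (hη : IsMollifier η) {f : Euc d → ℝ} (hf : Measurable f) (t : ℝ) :
    ∫⁻ x, ‖coneAvg η t f x‖ₑ ^ 2 ≤ ∫⁻ x, ‖f x‖ₑ ^ 2 := by
  have hm : Measurable fun p : Euc d × Euc d =>
      ENNReal.ofReal (η p.2) * ‖f (p.1 + t • p.2)‖ₑ ^ 2 := by
    have h1 := hη.measurable
    have h2 : Measurable fun p : Euc d × Euc d => f (p.1 + t • p.2) := hf.comp (by fun_prop)
    fun_prop
  calc _ ≤ ∫⁻ x, ∫⁻ z, ENNReal.ofReal (η z) * ‖f (x + t • z)‖ₑ ^ 2 :=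
        lintegral_mono fun x => hη.enorm_integral_mul_sq_le (hf.comp (by fun_prop))
    _ = ∫⁻ z, ∫⁻ x, ENNReal.ofReal (η z) * ‖f (x + t • z)‖ₑ ^ 2 :=
        lintegral_lintegral_swap hm.aemeasurable
    _ = ∫⁻ z, ENNReal.ofReal (η z) * ∫⁻ x, ‖f x‖ₑ ^ 2 := by
        refine lintegral_congr fun z => ?_
        rw [lintegral_const_mul' _ _ ENNReal.ofReal_ne_top,
          lintegral_add_right_eq_self (fun x => ‖f x‖ₑ ^ 2) (t • z)]
    _ = _ := by
        rw [lintegral_mul_const _ hη.measurable.ennreal_ofReal, hη.lintegral, one_mul]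

end IsMollifier

/-- The dilates `{z | q + τ • (z - q) ∈ C}` with `τ > 1` exhaust an open convex set. -/
theorem Convex.exists_exhaustion {d : ℕ} {C : Set (Euc d)} (hC : Convex ℝ C) (hCo : IsOpen C) :
    ∃ D : ℕ → Set (Euc d), (∀ n, IsOpen (D n) ∧ Convex ℝ (D n) ∧ closure (D n) ⊆ C) ∧
      ∀ z ∈ C, ∀ᶠ n in atTop, z ∈ D n := by
  rcases C.eq_empty_or_nonempty with rfl | ⟨q, hq⟩
  · exact ⟨fun _ => ∅, by simp [hC]⟩
  set τ : ℕ → ℝ := fun n => 1 + 1 / ((n : ℝ) + 1) with hτ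
  have hτ1 : ∀ n, 1 < τ n := fun n => by
    have : (0 : ℝ) < 1 / ((n : ℝ) + 1) := by positivity
    simp only [hτ]; linarith
  have hτlim : Tendsto τ atTop (𝓝 1) := by
    have := (tendsto_one_div_add_atTop_nhds_zero_nat (𝕜 := ℝ)).const_add 1
    rwa [add_zero] at this
  have hcont : ∀ n, Continuous fun z : Euc d => q + τ n • (z - q) := fun n => by fun_prop
  refine ⟨fun n => {z | q + τ n • (z - q) ∈ C}, fun n => ⟨hCo.preimage (hcont n), ?_, ?_⟩, ?_⟩
  · intro x hx y hy a b ha hb hab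
    have := hC hx hy ha hb hab
    rw [mem_ofPred_eq]
    convert this using 1
    have : q = a • q + b • q := by rw [← add_smul, hab, one_smul]
    nth_rewrite 1 [this]
    nth_rewrite 3 [this]
    module
  · intro z hz
    have h1 : q + τ n • (z - q) ∈ closure C :=
      map_mem_closure (f := fun z => q + τ n • (z - q)) (hcont n) hz fun x hx => hx
    have hτ0 : 0 < τ n := by linarith [hτ1 n]
    have h2 := hC.combo_interior_closure_mem_interior (x := q) (a := 1 - (τ n)⁻¹) (b := (τ n)⁻¹)
      (by rwa [hCo.interior_eq]) h1 (by
        have := inv_lt_one_of_one_lt₀ (hτ1 n)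
        linarith) (by positivity) (by ring)
    rw [hCo.interior_eq] at h2
    convert h2 using 1
    rw [smul_add, smul_smul, inv_mul_cancel₀ hτ0.ne']
    module
  · intro z hz
    have h1 : Tendsto (fun n => q + τ n • (z - q)) atTop (𝓝 (q + (1 : ℝ) • (z - q))) :=
      (hτlim.smul_const _).const_add _
    rw [one_smul, add_sub_cancel] at h1
    exact h1.eventually (hCo.mem_nhds hz)

/-- A square integrable function with square integrable weak gradient, on a regular image of a
convex set, has finite fractional seminorm. The bound for smooth functions is applied to
mollifications on an exhausting sequence of subdomains, and passes to the limit by Fatou's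
lemma. -/
theorem RegularMap.gagliardoSq_lt_top {d : ℕ} {f : Euc d → Euc d} {A : Euc d → Euc d →L[ℝ] Euc d}
    {C : Set (Euc d)} {κ L : ℝ} (hd : 0 < d) (h : RegularMap f A C κ L) {σ : ℝ} (hσ : 1 / 2 ≤ σ)
    (hσ1 : σ < 1) {v : Euc d → ℝ} {w : Fin d → Euc d → ℝ}
    (hv : MemLp v 2 (volume.restrict (f '' C))) (hvw : ∀ i, HasWeakPartial (f '' C) i v (w i))
    (hw : ∀ i, MemLp (w i) 2 (volume.restrict (f '' C))) : gagliardoSq (f '' C) σ v < ⊤ := by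
  set K := f '' C with hK
  have hKm := h.isOpen_image.measurableSet
  obtain ⟨u, hum, hu, hu0, hvu⟩ := exists_representative hKm hv
  choose g hgm hg hg0 hwg using fun i => exists_representative hKm (hw i)
  have hug : ∀ i, HasWeakPartial K i u (g i) := fun i => (hvw i).congr_ae hvu (hwg i)
  rw [gagliardoSq_congr_ae σ hvu]
  obtain ⟨D, hD, hDcov⟩ := h.convex.exists_exhaustion h.isOpen
  obtain ⟨c, hc⟩ := h.exists_gagliardoSq_le hd hσ hσ1
  obtain ⟨η, hη, hηs⟩ := exists_isMollifier (0 : Euc d) one_pos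
  have hDC : ∀ n, D n ⊆ C := fun n => subset_closure.trans (hD n).2.2
  -- heights for which the averages over the `n`-th subdomain only use values on `K`
  have ht : ∀ n : ℕ, ∃ t : ℝ, 0 < t ∧ t ≤ 1 / ((n : ℝ) + 1) ∧
      ∀ x ∈ f '' D n, ∀ z ∈ tsupport η, x + t • z ∈ K := by
    intro n
    have hcomp : IsCompact (f '' closure (D n)) := by
      refine IsCompact.image_of_continuousOn ?_
        (h.continuousOn.mono ((hD n).2.2.trans subset_closure))
      exact Metric.isCompact_of_isClosed_isBounded isClosed_closure
        (h.bounded.subset (hD n).2.2)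
    obtain ⟨δ, hδ, hδK⟩ := hcomp.exists_cthickening_subset_open h.isOpen_image
      (image_mono (hD n).2.2)
    refine ⟨min δ (1 / ((n : ℝ) + 1)), by positivity, min_le_right _ _, fun x hx z hz => ?_⟩
    refine hδK (Metric.mem_cthickening_of_dist_le _ x _ _ (image_mono subset_closure hx) ?_)
    have h1 := hηs hz
    rw [mem_closedBall_zero_iff] at h1
    rw [dist_self_add_left, norm_smul, Real.norm_of_nonneg (by positivity)]
    calc _ ≤ δ * 1 := by gcongr; exact min_le_left _ _
      _ = δ := mul_one _
  choose t ht0 htn htK using ht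
  have htlim : Tendsto t atTop (𝓝[>] 0) := by
    refine tendsto_nhdsWithin_iff.2 ⟨?_, Eventually.of_forall ht0⟩
    exact squeeze_zero (fun n => (ht0 n).le) htn tendsto_one_div_add_atTop_nhds_zero_nat
  set ψ : ℕ → Euc d → ℝ := fun n => coneAvg η (t n) u with hψ
  have hul : LocallyIntegrable u volume := hu.locallyIntegrable (by norm_num)
  have hψs : ∀ n, ContDiff ℝ ∞ (ψ n) := fun n => hη.contDiff_coneAvg (ht0 n) hul
  set M : ℝ≥0∞ := ∑ i, ∫⁻ x, ‖g i x‖ₑ ^ 2 with hM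
  have hMtop : M < ⊤ := by
    refine ENNReal.sum_lt_top.2 fun i _ => ?_
    rw [← eLpNorm_two_sq]
    exact ENNReal.pow_lt_top (hg i).2
  -- the bound is uniform in `n`, as averaging does not increase the `L²` norms of the derivatives
  have hbound : ∀ n, gagliardoSq (f '' D n) σ (ψ n) ≤ c * M := by
    intro n
    refine (hc (D n) (hDC n) (hD n).1 (hD n).2.1 (ψ n) ((hψs n).of_le (by norm_num))).trans ?_
    gcongr
    have hsub : f '' D n ⊆ K := image_mono (hDC n)
    have hDm : MeasurableSet (f '' D n) := by
      refine measurable_image_of_fderivWithin (hD n).1.measurableSet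
        (fun x hx => (h.hasFDerivAt (hDC n hx)).hasFDerivWithinAt)
        (h.injOn.mono ((hDC n).trans subset_closure))
    have hm : ∀ i, Measurable fun x => ‖coneAvg η (t n) (g i) x‖ₑ ^ 2 := fun i =>
      (hη.contDiff_coneAvg (ht0 n)
        ((hg i).locallyIntegrable (by norm_num))).continuous.measurable.enorm.pow_const 2
    calc _ ≤ ∫⁻ x in f '' D n, ∑ i, ‖coneAvg η (t n) (g i) x‖ₑ ^ 2 := by
          refine setLIntegral_mono' hDm fun x hx => ?_
          have h1 := norm_sq_le_sum_sq (fderiv ℝ (ψ n) x)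
          have h2 : ∀ i, fderiv ℝ (ψ n) x (stdVec i) = coneAvg η (t n) (g i) x := fun i =>
            hη.fderiv_coneAvg (ht0 n) hul (hug i) hu0 (hg0 i) (htK n x hx)
          simp only [h2] at h1
          simp only [← ofReal_sq_eq_enorm_sq]
          rw [← ENNReal.ofReal_sum_of_nonneg fun i _ => sq_nonneg _, ← ofReal_norm,
            ← ENNReal.ofReal_pow (norm_nonneg _)]
          exact ENNReal.ofReal_le_ofReal h1
      _ = ∑ i, ∫⁻ x in f '' D n, ‖coneAvg η (t n) (g i) x‖ₑ ^ 2 :=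
          lintegral_finsetSum _ fun i _ => hm i
      _ ≤ M := Finset.sum_le_sum fun i _ =>
          (setLIntegral_le_lintegral _ _).trans (hη.lintegral_coneAvg_sq_le (hgm i) _)
  have hL2 : Tendsto (fun n => eLpNorm (ψ n - u) 2 volume) atTop (𝓝 0) :=
    (hη.tendsto_eLpNorm_coneAvg hum hu).comp htlim
  have hmeas := tendstoInMeasure_of_tendsto_eLpNorm (p := 2) two_ne_zero
    (fun n => (hψs n).continuous.aestronglyMeasurable) hu.1 hL2
  obtain ⟨ns, hns, hae⟩ := hmeas.exists_seq_tendsto_ae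
  have hKn : ∀ n, MeasurableSet (f '' D n) := fun n =>
    measurable_image_of_fderivWithin (hD n).1.measurableSet
        (fun x hx => (h.hasFDerivAt (hDC n hx)).hasFDerivWithinAt)
        (h.injOn.mono ((hDC n).trans subset_closure))
  set F : ℕ → Euc d × Euc d → ℝ≥0∞ := fun k =>
    indicator ((f '' D (ns k)) ×ˢ (f '' D (ns k))) fun p => ‖diffQuot σ (ψ (ns k)) p‖ₑ ^ 2 with hF
  have hdm : ∀ φ : Euc d → ℝ, Measurable φ → Measurable (diffQuot σ φ) := fun φ hφ =>
    ((hφ.comp measurable_fst).sub (hφ.comp measurable_snd)).mul (measurable_norm_sub_rpow _)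
  have hFm : ∀ k, Measurable (F k) := fun k =>
    ((hdm _ (hψs _).continuous.measurable).enorm.pow_const 2).indicator ((hKn _).prod (hKn _))
  have hae' : ∀ᵐ x ∂(volume.restrict K), x ∈ K ∧
      Tendsto (fun k => ψ (ns k) x) atTop (𝓝 (u x)) :=
    (ae_restrict_mem hKm).and (ae_restrict_of_ae hae)
  have hevent : ∀ x ∈ K, ∀ᶠ k in atTop, x ∈ f '' D (ns k) := by
    rintro x ⟨z, hz, rfl⟩
    filter_upwards [hns.tendsto_atTop.eventually (hDcov z hz)] with k hk
    exact mem_image_of_mem f hk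
  -- along a subsequence the mollifications converge almost everywhere
  have hlim : ∀ᵐ p ∂((volume.restrict K).prod (volume.restrict K)),
      ‖diffQuot σ u p‖ₑ ^ 2 ≤ liminf (fun k => F k p) atTop := by
    filter_upwards [Measure.quasiMeasurePreserving_fst.ae hae',
      Measure.quasiMeasurePreserving_snd.ae hae'] with p hp1 hp2
    have h1 : Tendsto (fun k => ‖diffQuot σ (ψ (ns k)) p‖ₑ ^ 2) atTop
        (𝓝 (‖diffQuot σ u p‖ₑ ^ 2)) := by
      refine ((ENNReal.continuous_pow 2).comp continuous_enorm).continuousAt.tendsto.comp ?_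
      exact (hp1.2.sub hp2.2).mul_const _
    have h2 : Tendsto (fun k => F k p) atTop (𝓝 (‖diffQuot σ u p‖ₑ ^ 2)) := by
      refine h1.congr' ?_
      filter_upwards [hevent _ hp1.1, hevent _ hp2.1] with k hk1 hk2
      simp only [hF]
      rw [indicator_of_mem (show p ∈ _ ×ˢ _ from ⟨hk1, hk2⟩)]
    exact h2.liminf_eq.ge
  rw [gagliardoSq_eq_lintegral_prod hum.aemeasurable]
  have hMc : c * M < ⊤ := ENNReal.mul_lt_top ENNReal.coe_lt_top hMtop
  refine lt_of_le_of_lt ?_ hMc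
  calc _ ≤ ∫⁻ p, liminf (fun k => F k p) atTop
        ∂((volume.restrict K).prod (volume.restrict K)) := lintegral_mono_ae hlim
    _ ≤ liminf (fun k => ∫⁻ p, F k p ∂((volume.restrict K).prod (volume.restrict K))) atTop :=
        lintegral_liminf_le hFm
    _ ≤ c * M := by
        refine liminf_le_of_le (by isBoundedDefault) fun b hb => ?_
        obtain ⟨k, hk⟩ := hb.exists
        refine hk.trans (le_trans ?_ (hbound (ns k)))
        simp only [hF]
        rw [lintegral_indicator ((hKn _).prod (hKn _)), Measure.prod_restrict,
          Measure.restrict_restrict ((hKn _).prod (hKn _)), inter_eq_left.2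
          (prod_mono (image_mono (hDC _)) (image_mono (hDC _))),
          gagliardoSq_eq_lintegral_prod (hψs _).continuous.measurable.aemeasurable,
          Measure.prod_restrict]

/-! ### Traces -/

/-- The properties of a domain `K` and a subset `F` of its closure on which the theory of traces
rests: interior cones of `K`, and balls of radius `r` meet `F` in a set of area `O(r ^ m)`. -/
structure IsTraceFace {m : ℕ} (K F : Set (Euc (m + 1))) : Prop where
  domain : IsConeDomain K
  subset : F ⊆ closure K
  measurableSet : MeasurableSet F
  area : ∃ c : ℝ≥0, ∀ x r, 0 < r → surf F (Metric.ball x r) ≤ c * ENNReal.ofReal r ^ m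

theorem RegularFace.isTraceFace {m : ℕ} {K F : Set (Euc (m + 1))}
    {f : Euc (m + 1) → Euc (m + 1)} {A C S O O' ν c κ L}
    (h : RegularFace K F f A C S O O' ν c κ L) : IsTraceFace K F := by
  obtain ⟨X, U, κ', L', hX⟩ := h.exists_globalChart
  refine ⟨h.domain_eq ▸ h.map.isConeDomain, ?_, hX.measurableSet, hX.exists_surf_ball_le⟩
  rw [h.face_eq, h.domain_eq, h.map.closure_image]
  exact inter_subset_left.trans (image_mono h.flat.subset_closure)

/-- The part of `K` near a point with an interior cone fills a positive fraction of all small balls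
centred at nearby points of the closure. -/
theorem InteriorCone.exists_le_volume {m : ℕ} {K : Set (Euc (m + 1))} {p w : Euc (m + 1)} {ρ : ℝ}
    (h : InteriorCone K p w ρ) : ∃ c₀ r₀ : ℝ, 0 < c₀ ∧ 0 < r₀ ∧ ∀ x ∈ closure K, dist x p < ρ / 2 →
      ∀ r, 0 < r → r ≤ r₀ →
        ENNReal.ofReal (c₀ * r ^ (m + 1)) ≤ volume ((K ∩ Metric.ball p ρ) ∩ Metric.ball x r) := by
  have hρ := h.pos
  set l : ℝ := ‖w‖ + 2 * ρ with hl
  have hl0 : 0 < l := by positivity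
  set β : ℝ := (volume (Metric.ball (0 : Euc (m + 1)) 1)).toReal with hβ
  have hβ0 : 0 < β := ENNReal.toReal_pos (Metric.measure_ball_pos _ _ one_pos).ne'
    measure_ball_lt_top.ne
  refine ⟨(ρ / l) ^ (m + 1) * β, min (ρ / 2) (ρ * l), by positivity, by positivity,
    fun x hx hxp r hr hr0 => ?_⟩
  have hrl : r / l ≤ ρ := (div_le_iff₀ hl0).2 (hr0.trans (min_le_right _ _))
  have h1 := h.subset x hx (hxp.trans (by linarith)) (r / l) (by positivity) hrl
  have h2 : Metric.closedBall (x + (r / l) • w) (ρ * (r / l)) ⊆ Metric.ball x r := by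
    refine Metric.closedBall_subset_ball' ?_
    rw [dist_self_add_left, norm_smul, Real.norm_of_nonneg (by positivity)]
    calc ρ * (r / l) + r / l * ‖w‖ < r / l * l := by
          rw [hl]
          have : 0 < r / (‖w‖ + 2 * ρ) := by positivity
          nlinarith
      _ = r := div_mul_cancel₀ _ hl0.ne'
  have h3 : Metric.ball x r ⊆ Metric.ball p ρ := by
    refine Metric.ball_subset_ball' ?_
    have := hr0.trans (min_le_left _ _)
    linarith
  calc _ = volume (Metric.closedBall (x + (r / l) • w) (ρ * (r / l))) := by
        rw [Measure.addHaar_closedBall _ _ (by positivity), finrank_euclideanSpace,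
          Fintype.card_fin, ← ENNReal.ofReal_toReal measure_ball_lt_top.ne,
          ← ENNReal.ofReal_mul (by positivity)]
        congr 1
        rw [← hβ, mul_div_assoc', mul_comm ρ r, mul_div_assoc, mul_pow]
        ring
    _ ≤ _ := measure_mono (subset_inter (subset_inter h1 (h2.trans h3)) h2)

theorem restrict_biUnion_le_sum {α ι : Type*} [MeasurableSpace α] (μ : Measure α) (s : Finset ι)
    (B : ι → Set α) : μ.restrict (⋃ i ∈ s, B i) ≤ ∑ i ∈ s, μ.restrict (B i) := by
  classical
  induction s using Finset.induction_on with
  | empty => simp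
  | insert i s hi ih =>
    rw [Finset.set_biUnion_insert, Finset.sum_insert hi]
    exact (Measure.restrict_union_le _ _).trans (by gcongr)

namespace IsTraceFace

variable {m : ℕ} {K F : Set (Euc (m + 1))}

theorem isFiniteMeasure (hF : IsTraceFace K F) : IsFiniteMeasure (surf F) := by
  obtain ⟨c, hc⟩ := hF.area
  obtain ⟨R, hR⟩ := (hF.domain.isBounded.closure.subset hF.subset).subset_ball 0
  refine ⟨?_⟩
  have h1 : surf F univ = surf F (Metric.ball 0 (max R 1)) := by
    rw [surf, Measure.restrict_apply MeasurableSet.univ,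
      Measure.restrict_apply Metric.isOpen_ball.measurableSet, univ_inter, inter_eq_right.2
        (hR.trans (Metric.ball_subset_ball (le_max_left _ _)))]
  rw [h1]
  refine (hc 0 _ (by positivity)).trans_lt ?_
  finiteness

theorem memLp (hF : IsTraceFace K F) {φ : Euc (m + 1) → ℝ} (hφ : Continuous φ)
    (hc : HasCompactSupport φ) : MemLp φ 2 (surf F) := by
  have := hF.isFiniteMeasure
  exact hφ.memLp_of_hasCompactSupport hc

/-- The trace inequality for smooth functions near a point with an interior cone. -/
theorem exists_local_trace_inequality (hF : IsTraceFace K F) {σ : ℝ} (hσ : 1 / 2 < σ)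
    {p w : Euc (m + 1)} {ρ : ℝ} (h : InteriorCone K p w ρ) :
    ∃ C : ℝ≥0, ∀ φ : Euc (m + 1) → ℝ, Continuous φ → HasCompactSupport φ →
      ∫⁻ x in Metric.ball p (ρ / 2), ‖φ x‖ₑ ^ 2 ∂(surf F) ≤
        C * fracNormSq (K ∩ Metric.ball p ρ) σ φ := by
  have := hF.isFiniteMeasure
  obtain ⟨c₀, r₀, hc₀, hr₀, hvol⟩ := h.exists_le_volume
  obtain ⟨c, hc⟩ := hF.area
  refine exists_trace_inequality
    (hF.domain.isOpen.measurableSet.inter Metric.isOpen_ball.measurableSet) hσ hc₀ hr₀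
    (c₁ := c) c.2 ?_ fun x r hr => ?_
  · rw [ae_restrict_iff' Metric.isOpen_ball.measurableSet, surf]
    filter_upwards [ae_restrict_mem hF.measurableSet] with x hx hxp
    exact hvol x (hF.subset hx) hxp
  · refine (Measure.restrict_apply_le _ _).trans ((hc x r hr).trans (le_of_eq ?_))
    rw [ENNReal.ofReal_mul c.coe_nonneg, ENNReal.ofReal_pow hr.le, ENNReal.ofReal_coe_nnreal]

/-- The local trace inequalities, added up over a finite cover of the face by interior cones. -/
theorem exists_trace_inequality (hF : IsTraceFace K F) {σ : ℝ} (hσ : 1 / 2 < σ) :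
    ∃ C : ℝ≥0, ∀ φ : Euc (m + 1) → ℝ, Continuous φ → HasCompactSupport φ →
      eLpNorm φ 2 (surf F) ^ 2 ≤ C * fracNormSq K σ φ := by
  choose! w ρ hcone using hF.domain.cone
  obtain ⟨s, hs, hcov⟩ := hF.domain.isBounded.isCompact_closure.elim_nhds_subcover
    (fun p => Metric.ball p (ρ p / 2))
    (fun p hp => Metric.ball_mem_nhds p (half_pos (hcone p hp).pos))
  have hloc : ∀ p ∈ s, ∃ C : ℝ≥0, ∀ φ : Euc (m + 1) → ℝ, Continuous φ → HasCompactSupport φ →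
      ∫⁻ x in Metric.ball p (ρ p / 2), ‖φ x‖ₑ ^ 2 ∂(surf F) ≤
        C * fracNormSq (K ∩ Metric.ball p (ρ p)) σ φ :=
    fun p hp => hF.exists_local_trace_inequality hσ (hcone p (hs p hp))
  choose! C hC using hloc
  refine ⟨∑ p ∈ s, C p, fun φ hφ hc => ?_⟩
  have hsub : surf F ≤ ∑ p ∈ s, (surf F).restrict (Metric.ball p (ρ p / 2)) := by
    have h1 : surf F = (surf F).restrict (⋃ p ∈ s, Metric.ball p (ρ p / 2)) := by
      rw [surf, Measure.restrict_restrict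
        (s.measurableSet_biUnion fun p _ => Metric.isOpen_ball.measurableSet),
        inter_eq_right.2 (hF.subset.trans hcov)]
    conv_lhs => rw [h1]
    exact restrict_biUnion_le_sum _ _ _
  rw [eLpNorm_two_sq]
  calc _ ≤ ∫⁻ x, ‖φ x‖ₑ ^ 2 ∂(∑ p ∈ s, (surf F).restrict (Metric.ball p (ρ p / 2))) :=
        lintegral_mono' hsub le_rfl
    _ = ∑ p ∈ s, ∫⁻ x in Metric.ball p (ρ p / 2), ‖φ x‖ₑ ^ 2 ∂(surf F) :=
        lintegral_finsetSum_measure _ _ _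
    _ ≤ ∑ p ∈ s, C p * fracNormSq K σ φ := Finset.sum_le_sum fun p hp =>
        (hC p hp φ hφ hc).trans (by gcongr; exact fracNormSq_mono_set inter_subset_left _ _)
    _ = _ := by rw [← Finset.sum_mul]; push_cast; rfl

end IsTraceFace

theorem ENNReal.tendsto_of_tendsto_sq {ι : Type*} {l : Filter ι} {f : ι → ℝ≥0∞}
    (h : Tendsto (fun n => f n ^ 2) l (𝓝 0)) : Tendsto f l (𝓝 0) := by
  have h2 := (ENNReal.continuous_rpow_const (y := 1 / 2)).tendsto 0 |>.comp h
  rw [ENNReal.zero_rpow_of_pos (by norm_num)] at h2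
  refine h2.congr fun n => ?_
  simp only [Function.comp_apply]
  rw [← ENNReal.rpow_natCast, ← ENNReal.rpow_mul]
  norm_num

/-- If `φ n → v` and `ψ n → v` in a fractional norm, then `φ n - ψ n → 0`. -/
theorem tendsto_fracNormSq_sub {d : ℕ} {K : Set (Euc d)} {σ : ℝ} {v : Euc d → ℝ}
    (hv : AEMeasurable v (volume.restrict K)) {ι : Type*} {l : Filter ι} {φ ψ : ι → Euc d → ℝ}
    (hφm : ∀ n, AEMeasurable (φ n) (volume.restrict K))
    (hψm : ∀ n, AEMeasurable (ψ n) (volume.restrict K))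
    (hφ : Tendsto (fun n => fracNormSq K σ (fun x => φ n x - v x)) l (𝓝 0))
    (hψ : Tendsto (fun n => fracNormSq K σ (fun x => ψ n x - v x)) l (𝓝 0)) :
    Tendsto (fun n => fracNormSq K σ (fun x => φ n x - ψ n x)) l (𝓝 0) := by
  have h1 := (ENNReal.Tendsto.const_mul (a := 2) hφ (Or.inr ENNReal.ofNat_ne_top)).add
    (ENNReal.Tendsto.const_mul (a := 2) hψ (Or.inr ENNReal.ofNat_ne_top))
  simp only [mul_zero, add_zero] at h1
  refine tendsto_of_tendsto_of_tendsto_of_le_of_le tendsto_const_nhds h1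
    (fun _ => zero_le) fun n => ?_
  have := fracNormSq_sub_le (hφm n) (hψm n) hv σ
  rwa [fracNormSq_sub_comm K σ v (ψ n)] at this

namespace IsTraceFace

variable {m : ℕ} {K F : Set (Euc (m + 1))}

/-- The restrictions to `F` of smooth functions converging to `v` in `H^σ(K)` form a Cauchy sequence
in `L²(F)` by the trace inequality; their limit is the trace. -/
theorem exists_trace (hF : IsTraceFace K F) {σ : ℝ} (hσ : 1 / 2 < σ) (hσ1 : σ < 1)
    {v : Euc (m + 1) → ℝ} (hv : MemLp v 2 (volume.restrict K)) (hvσ : gagliardoSq K σ v < ⊤) :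
    ∃ g, HasTrace K F v g := by
  have hvN : fracNormSq K σ v < ⊤ := by
    rw [fracNormSq]
    simp only [ofReal_sq_eq_enorm_sq]
    rw [← eLpNorm_two_sq]
    exact ENNReal.add_lt_top.2 ⟨ENNReal.pow_lt_top hv.2, hvσ⟩
  obtain ⟨φ, hφ, hlim⟩ := hF.domain.exists_smooth_approx m.succ_pos (by linarith) hσ1 hv hvN
  obtain ⟨C, hC⟩ := hF.exists_trace_inequality hσ
  have hφL : ∀ n, MemLp (φ n) 2 (surf F) := fun n => hF.memLp (hφ n).1.continuous (hφ n).2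
  have hfst : Tendsto (fun q : ℕ × ℕ => q.1) atTop atTop := by
    rw [← prod_atTop_atTop_eq]; exact tendsto_fst
  have hsnd : Tendsto (fun q : ℕ × ℕ => q.2) atTop atTop := by
    rw [← prod_atTop_atTop_eq]; exact tendsto_snd
  have h1 : Tendsto (fun q : ℕ × ℕ => fracNormSq K σ (fun x => φ q.1 x - φ q.2 x)) atTop (𝓝 0) :=
    tendsto_fracNormSq_sub hv.1.aemeasurable
      (fun q => (hφ q.1).1.continuous.measurable.aemeasurable)
      (fun q => (hφ q.2).1.continuous.measurable.aemeasurable) (hlim.comp hfst) (hlim.comp hsnd)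
  have h2 : Tendsto (fun q : ℕ × ℕ => eLpNorm (φ q.1 - φ q.2) 2 (surf F)) atTop (𝓝 0) := by
    refine ENNReal.tendsto_of_tendsto_sq ?_
    have h3 := ENNReal.Tendsto.const_mul (a := (C : ℝ≥0∞)) h1 (Or.inr ENNReal.coe_ne_top)
    rw [mul_zero] at h3
    refine tendsto_of_tendsto_of_tendsto_of_le_of_le tendsto_const_nhds h3
      (fun _ => zero_le) fun q => ?_
    exact hC _ ((hφ q.1).1.continuous.sub (hφ q.2).1.continuous) ((hφ q.1).2.sub (hφ q.2).2)
  have hcau : CauchySeq fun n => (hφL n).toLp := by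
    rw [EMetric.cauchySeq_iff]
    intro ε hε
    have h4 := h2.eventually (gt_mem_nhds hε)
    rw [eventually_atTop] at h4
    obtain ⟨⟨a, b⟩, hab⟩ := h4
    refine ⟨max a b, fun i hi j hj => ?_⟩
    rw [Lp.edist_toLp_toLp]
    exact hab (i, j) ⟨(le_max_left _ _).trans hi, (le_max_right _ _).trans hj⟩
  obtain ⟨G, hG⟩ := cauchySeq_tendsto_of_complete hcau
  refine ⟨G, hv, Lp.memLp G, σ, hσ, hσ1, φ, hφ, hlim, ?_⟩
  rw [tendsto_iff_edist_tendsto_0] at hG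
  refine hG.congr fun n => ?_
  rw [Lp.edist_def]
  refine eLpNorm_congr_ae ?_
  filter_upwards [(hφL n).coeFn_toLp] with x hx
  simp [hx]

end IsTraceFace

namespace HasTrace

variable {m : ℕ} {K F : Set (Euc (m + 1))} {v v' g g' : Euc (m + 1) → ℝ}

theorem congr_ae (h : HasTrace K F v g) (hv : v =ᵐ[volume.restrict K] v') : HasTrace K F v' g := by
  obtain ⟨h1, h2, σ, hσ, hσ1, φ, hφ, h3, h4⟩ := h
  refine ⟨h1.ae_eq hv, h2, σ, hσ, hσ1, φ, hφ, h3.congr fun n => fracNormSq_congr_ae σ ?_, h4⟩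
  filter_upwards [hv] with x hx
  rw [hx]

/-- The order in the definition of a trace may be lowered. -/
theorem exists_order (hK : Bornology.IsBounded K) (hKm : MeasurableSet K) (h : HasTrace K F v g) :
    ∃ σ₀, 1 / 2 < σ₀ ∧ σ₀ < 1 ∧ ∀ σ, σ ≤ σ₀ → ∃ φ : ℕ → Euc (m + 1) → ℝ,
      (∀ n, ContDiff ℝ ∞ (φ n) ∧ HasCompactSupport (φ n)) ∧
      Tendsto (fun n => fracNormSq K σ (fun x => φ n x - v x)) atTop (𝓝 0) ∧
      Tendsto (fun n => eLpNorm (fun x => φ n x - g x) 2 (surf F)) atTop (𝓝 0) := by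
  obtain ⟨h1, h2, σ₀, hσ, hσ1, φ, hφ, h3, h4⟩ := h
  refine ⟨σ₀, hσ, hσ1, fun σ hσσ => ⟨φ, hφ, ?_, h4⟩⟩
  obtain ⟨c, hc⟩ := exists_fracNormSq_le_of_le hK hKm hσσ
  have h5 := ENNReal.Tendsto.const_mul (a := (c : ℝ≥0∞)) h3 (Or.inr ENNReal.coe_ne_top)
  rw [mul_zero] at h5
  exact tendsto_of_tendsto_of_tendsto_of_le_of_le tendsto_const_nhds h5
    (fun _ => zero_le) fun n => hc _

/-- Two traces may come from approximations of different orders `σ`, `σ'`; both converge in the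
smaller one, where the trace inequality applies. -/
theorem unique (hF : IsTraceFace K F) (h : HasTrace K F v g) (h' : HasTrace K F v g') :
    g =ᵐ[surf F] g' := by
  have hKm := hF.domain.isOpen.measurableSet
  obtain ⟨σ, hσ, hσ1, hall⟩ := h.exists_order hF.domain.isBounded hKm
  obtain ⟨σ', hσ', hσ1', hall'⟩ := h'.exists_order hF.domain.isBounded hKm
  obtain ⟨φ, hφ, h3, h4⟩ := hall (min σ σ') (min_le_left _ _)
  obtain ⟨ψ, hψ, h3', h4'⟩ := hall' (min σ σ') (min_le_right _ _)
  obtain ⟨C, hC⟩ := hF.exists_trace_inequality (lt_min hσ hσ')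
  have h5 := tendsto_fracNormSq_sub h.1.1.aemeasurable
    (fun n => (hφ n).1.continuous.measurable.aemeasurable)
    (fun n => (hψ n).1.continuous.measurable.aemeasurable) h3 h3'
  have h6 : Tendsto (fun n => eLpNorm (fun x => φ n x - ψ n x) 2 (surf F)) atTop (𝓝 0) := by
    refine ENNReal.tendsto_of_tendsto_sq ?_
    have h7 := ENNReal.Tendsto.const_mul (a := (C : ℝ≥0∞)) h5 (Or.inr ENNReal.coe_ne_top)
    rw [mul_zero] at h7
    refine tendsto_of_tendsto_of_tendsto_of_le_of_le tendsto_const_nhds h7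
      (fun _ => zero_le) fun n => ?_
    exact hC _ ((hφ n).1.continuous.sub (hψ n).1.continuous) ((hφ n).2.sub (hψ n).2)
  have h8 := (h4.add h6).add h4'
  simp only [add_zero] at h8
  have hm : ∀ n, AEStronglyMeasurable (φ n) (surf F) := fun n => (hφ n).1.continuous.aestronglyMeasurable
  have hm' : ∀ n, AEStronglyMeasurable (ψ n) (surf F) :=
    fun n => (hψ n).1.continuous.aestronglyMeasurable
  -- `g - g'` is the sum of `g - φ n`, `φ n - ψ n` and `ψ n - g'`, which all tend to zero
  have h9 : eLpNorm (g - g') 2 (surf F) ≤ 0 := by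
    refine ge_of_tendsto' h8 fun n => ?_
    have e1 : g - g' = ((fun x => -(φ n x - g x)) + fun x => φ n x - ψ n x) +
        fun x => ψ n x - g' x := by
      ext x; simp
    have e2 : eLpNorm (fun x => -(φ n x - g x)) 2 (surf F) =
        eLpNorm (fun x => φ n x - g x) 2 (surf F) := eLpNorm_neg (fun x => φ n x - g x) 2 (surf F)
    rw [e1, ← e2]
    have n1 : AEStronglyMeasurable (fun x => -(φ n x - g x)) (surf F) := ((hm n).sub h.2.1.1).neg
    have n2 : AEStronglyMeasurable (fun x => φ n x - ψ n x) (surf F) := (hm n).sub (hm' n)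
    exact (eLpNorm_add_le (n1.add n2) ((hm' n).sub h'.2.1.1) (by norm_num)).trans
      (add_le_add_left (eLpNorm_add_le n1 n2 (by norm_num)) _)
  have h10 := (eLpNorm_eq_zero_iff (h.2.1.1.sub h'.2.1.1) two_ne_zero).1 (le_antisymm h9 zero_le)
  filter_upwards [h10] with x hx
  exact sub_eq_zero.1 hx

theorem zero : HasTrace K F (fun _ => 0) (fun _ => 0) := by
  refine ⟨MemLp.zero', MemLp.zero', 3 / 4, by norm_num, by norm_num, fun _ _ => 0,
    fun _ => ⟨contDiff_const, HasCompactSupport.zero⟩, ?_, ?_⟩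
  · simp [fracNormSq, gagliardoSq]
  · simp

theorem add (hK : Bornology.IsBounded K) (hKm : MeasurableSet K) (h : HasTrace K F v g)
    (h' : HasTrace K F v' g') : HasTrace K F (fun x => v x + v' x) (fun x => g x + g' x) := by
  obtain ⟨σ, hσ, hσ1, hall⟩ := h.exists_order hK hKm
  obtain ⟨σ', hσ', hσ1', hall'⟩ := h'.exists_order hK hKm
  obtain ⟨φ, hφ, h3, h4⟩ := hall (min σ σ') (min_le_left _ _)
  obtain ⟨ψ, hψ, h3', h4'⟩ := hall' (min σ σ') (min_le_right _ _)
  refine ⟨h.1.add h'.1, h.2.1.add h'.2.1, min σ σ', lt_min hσ hσ', (min_le_left _ _).trans_lt hσ1,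
    fun n x => φ n x + ψ n x, fun n => ⟨(hφ n).1.add (hψ n).1, (hφ n).2.add (hψ n).2⟩, ?_, ?_⟩
  · have h1 := (ENNReal.Tendsto.const_mul (a := 2) h3 (Or.inr ENNReal.ofNat_ne_top)).add
      (ENNReal.Tendsto.const_mul (a := 2) h3' (Or.inr ENNReal.ofNat_ne_top))
    simp only [mul_zero, add_zero] at h1
    refine tendsto_of_tendsto_of_tendsto_of_le_of_le tendsto_const_nhds h1
      (fun _ => zero_le) fun n => ?_
    simp only [add_sub_add_comm]
    exact fracNormSq_add_le ((hφ n).1.continuous.measurable.aemeasurable.sub h.1.1.aemeasurable)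
      ((hψ n).1.continuous.measurable.aemeasurable.sub h'.1.1.aemeasurable) _
  · have h1 := h4.add h4'
    rw [add_zero] at h1
    refine tendsto_of_tendsto_of_tendsto_of_le_of_le tendsto_const_nhds h1
      (fun _ => zero_le) fun n => ?_
    simp only [add_sub_add_comm]
    exact eLpNorm_add_le ((hφ n).1.continuous.aestronglyMeasurable.sub h.2.1.1)
      ((hψ n).1.continuous.aestronglyMeasurable.sub h'.2.1.1) (by norm_num)

theorem sum (hK : Bornology.IsBounded K) (hKm : MeasurableSet K) {ι : Type*} (s : Finset ι)
    {v g : ι → Euc (m + 1) → ℝ} (h : ∀ i, HasTrace K F (v i) (g i)) :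
    HasTrace K F (fun x => ∑ i ∈ s, v i x) (fun x => ∑ i ∈ s, g i x) := by
  classical
  induction s using Finset.induction_on with
  | empty => simpa using zero
  | insert i s hi ih =>
    simp only [Finset.sum_insert hi]
    exact (h i).add hK hKm ih

/-- The averages over cones of a function with a trace converge to the trace. -/
theorem tendsto_coneAvg (hF : IsTraceFace K F) (h : HasTrace K F v g) (hvm : Measurable v)
    (hv : MemLp v 2 volume) (hv0 : ∀ x ∉ K, v x = 0) {p w : Euc (m + 1)} {ρ : ℝ}
    (hcone : InteriorCone K p w ρ) {η : Euc (m + 1) → ℝ} (hη : IsMollifier η)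
    (hηs : tsupport η ⊆ Metric.closedBall w ρ) :
    Tendsto (fun t => eLpNorm (fun x => coneAvg η t v x - g x) 2
      ((surf F).restrict (Metric.ball p (ρ / 2)))) (𝓝[>] 0) (𝓝 0) := by
  have hKm := hF.domain.isOpen.measurableSet
  obtain ⟨-, hg, σ, hσ, hσ1, φ, hφ, h3, h4⟩ := h
  set E := K ∩ Metric.ball p ρ with hE
  set ν := (surf F).restrict (Metric.ball p (ρ / 2)) with hν
  obtain ⟨C, hC⟩ := hF.exists_local_trace_inequality hσ hcone
  have hvσ : fracNormSq K σ v < ⊤ := by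
    obtain ⟨n, hn⟩ := (h3.eventually (gt_mem_nhds ENNReal.zero_lt_top)).exists
    obtain ⟨b, l, hb, hl⟩ := (hφ n).2.exists_bound_lipschitz (hφ n).1
    have h5 := fracNormSq_lt_top_of_lipschitz m.succ_pos hF.domain.isBounded hKm hσ1 hb hl
    have h6 := fracNormSq_sub_le (U := K) (v := v) (w := fun _ => 0) (u := φ n) hvm.aemeasurable
      aemeasurable_const (hφ n).1.continuous.measurable.aemeasurable σ
    simp only [sub_zero] at h6
    refine h6.trans_lt ?_
    rw [fracNormSq_sub_comm]
    exact ENNReal.add_lt_top.2 ⟨ENNReal.mul_lt_top (by simp) hn, ENNReal.mul_lt_top (by simp) h5⟩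
  have hconv := hη.tendsto_fracNormSq_coneAvg hKm
    (hKm.inter (Metric.isOpen_ball (x := p) (ε := ρ)).measurableSet) inter_subset_left (by
      filter_upwards [Ioc_mem_nhdsGT hcone.pos] with t ht x hx z hz
      exact hcone.add_smul_mem (subset_closure hx.1) hx.2 (hηs hz) ht.1 ht.2) hvm hv hvσ
  have hvc : HasCompactSupport v := by
    refine HasCompactSupport.of_support_subset_isCompact hF.domain.isBounded.isCompact_closure
      fun x hx => subset_closure ?_
    by_contra hxK
    exact hx (hv0 x hxK)
  refine ENNReal.tendsto_of_tendsto_sq ?_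
  have h5 := ENNReal.Tendsto.const_mul (a := (4 * C : ℝ≥0∞)) hconv (Or.inr (by finiteness))
  rw [mul_zero] at h5
  refine tendsto_of_tendsto_of_tendsto_of_le_of_le' tendsto_const_nhds h5
    (Eventually.of_forall fun _ => zero_le) ?_
  filter_upwards [self_mem_nhdsWithin] with t ht
  have ha := hη.contDiff_coneAvg ht (hv.locallyIntegrable (by norm_num))
  have hac := hη.hasCompactSupport_coneAvg ht hvc
  -- compare the average with the smooth functions that define the trace
  have h6 : ∀ n, eLpNorm (fun x => coneAvg η t v x - g x) 2 ν ^ 2 ≤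
      2 * (C * (2 * fracNormSq E σ (fun x => coneAvg η t v x - v x) +
        2 * fracNormSq K σ (fun x => φ n x - v x))) +
      2 * eLpNorm (fun x => φ n x - g x) 2 (surf F) ^ 2 := by
    intro n
    have e1 : (fun x => coneAvg η t v x - g x) =
        fun x => (coneAvg η t v x - φ n x) + (φ n x - g x) := by ext x; ring
    rw [e1, eLpNorm_two_sq, eLpNorm_two_sq]
    refine (lintegral_enorm_add_sq_le
      (ha.continuous.measurable.sub (hφ n).1.continuous.measurable).aemeasurable).trans ?_
    gcongr
    · refine (hC (fun x => coneAvg η t v x - φ n x) (ha.continuous.sub (hφ n).1.continuous)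
        (hac.sub (hφ n).2)).trans ?_
      gcongr
      refine (fracNormSq_sub_le (u := v) ha.continuous.measurable.aemeasurable
        (hφ n).1.continuous.measurable.aemeasurable hvm.aemeasurable σ).trans ?_
      gcongr
      rw [fracNormSq_sub_comm]
      exact fracNormSq_mono_set inter_subset_left _ _
    · exact Measure.restrict_le_self
  have h7 : Tendsto (fun n => 2 * (C * (2 * fracNormSq E σ (fun x => coneAvg η t v x - v x) +
        2 * fracNormSq K σ (fun x => φ n x - v x))) +
      2 * eLpNorm (fun x => φ n x - g x) 2 (surf F) ^ 2) atTop
      (𝓝 (2 * (C * (2 * fracNormSq E σ (fun x => coneAvg η t v x - v x) + 2 * 0)) + 2 * 0 ^ 2)) := by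
    refine Tendsto.add ?_ ?_
    · refine ENNReal.Tendsto.const_mul (ENNReal.Tendsto.const_mul ?_ (Or.inr ENNReal.coe_ne_top))
        (Or.inr ENNReal.ofNat_ne_top)
      exact (ENNReal.Tendsto.const_mul h3 (Or.inr ENNReal.ofNat_ne_top)).const_add _
    · refine ENNReal.Tendsto.const_mul ?_ (Or.inr ENNReal.ofNat_ne_top)
      exact ((ENNReal.continuous_pow 2).tendsto _).comp h4
  refine (ge_of_tendsto' h7 h6).trans (le_of_eq ?_)
  ring

end HasTrace

/-! ### Calculus of weak partial derivatives -/

theorem setIntegral_mul_eq_integral {d : ℕ} {U : Set (Euc d)} {φ : Euc d → ℝ} (hs : tsupport φ ⊆ U)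
    (g : Euc d → ℝ) : ∫ x in U, g x * φ x = ∫ x, g x * φ x := by
  refine setIntegral_eq_integral_of_forall_compl_eq_zero fun x hx => ?_
  rw [image_eq_zero_of_notMem_tsupport fun h => hx (hs h), mul_zero]

namespace HasWeakPartial

variable {d : ℕ} {U : Set (Euc d)} {i : Fin d} {v w v' w' : Euc d → ℝ}

/-- Having a weak partial derivative is a local property. -/
theorem of_local (h : ∀ p ∈ U, ∃ r > 0, Metric.ball p r ⊆ U ∧
    HasWeakPartial (Metric.ball p r) i v w) : HasWeakPartial U i v w := by
  choose! r hr hrU hloc using h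
  have hnhds : ∀ p ∈ U, Metric.ball p (r p) ∈ 𝓝 p := fun p hp => Metric.ball_mem_nhds p (hr p hp)
  have hint : ∀ g : Euc d → ℝ, (∀ p ∈ U, LocallyIntegrableOn g (Metric.ball p (r p)) volume) →
      LocallyIntegrableOn g U volume := by
    intro g hg p hp
    obtain ⟨s, hs, hgs⟩ := hg p hp p (Metric.mem_ball_self (hr p hp))
    rw [nhdsWithin_eq_nhds.2 (hnhds p hp)] at hs
    exact ⟨s, mem_nhdsWithin_of_mem_nhds hs, hgs⟩
  have hv := hint v fun p hp => (hloc p hp).1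
  have hw := hint w fun p hp => (hloc p hp).2.1
  refine ⟨hv, hw, fun φ hφ hc hs => ?_⟩
  obtain ⟨s, χ, hsK, hχ, hsum⟩ := exists_finite_partition hc r fun p hp => hr p (hs hp)
  have hdec : φ = fun x => ∑ p ∈ s, χ p x * φ x := by
    ext x
    rw [← Finset.sum_mul]
    by_cases hx : x ∈ tsupport φ
    · rw [hsum x hx, one_mul]
    · rw [image_eq_zero_of_notMem_tsupport hx, mul_zero]
  have hψ : ∀ p ∈ s, ContDiff ℝ ∞ fun x => χ p x * φ x := fun p hp => (hχ p hp).1.mul hφ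
  have hψc : ∀ p ∈ s, HasCompactSupport fun x => χ p x * φ x := fun p hp => hc.mul_left
  have hψs : ∀ p ∈ s, tsupport (fun x => χ p x * φ x) ⊆ Metric.ball p (r p) := fun p hp =>
    (tsupport_mul_subset_left).trans (hχ p hp).2.2
  have hψU : ∀ p ∈ s, tsupport (fun x => χ p x * φ x) ⊆ U := fun p hp =>
    tsupport_mul_subset_right.trans hs
  have hder : ∀ x, fderiv ℝ φ x (stdVec i) =
      ∑ p ∈ s, fderiv ℝ (fun x => χ p x * φ x) x (stdVec i) := by
    intro x
    conv_lhs => rw [hdec]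
    rw [fderiv_fun_sum fun p hp => (hψ p hp).differentiable (by norm_num) x,
      sum_apply]
  have h1 : ∫ x in U, v x * fderiv ℝ φ x (stdVec i) =
      ∑ p ∈ s, ∫ x in U, v x * fderiv ℝ (fun x => χ p x * φ x) x (stdVec i) := by
    rw [← integral_finsetSum]
    · simp only [hder, Finset.mul_sum]
    · intro p hp
      refine integrable_mul hv ?_ ?_ ((tsupport_fderiv_apply_subset ℝ _).trans (hψU p hp))
      · exact ((hψ p hp).continuous_fderiv (by norm_num)).clm_apply continuous_const
      · exact (hψc p hp).fderiv_apply ℝ _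
  have h2 : ∫ x in U, w x * φ x = ∑ p ∈ s, ∫ x in U, w x * (χ p x * φ x) := by
    rw [← integral_finsetSum]
    · congr 1
      ext x
      conv_lhs => rw [hdec]
      rw [Finset.mul_sum]
    · intro p hp
      exact integrable_mul hw (hψ p hp).continuous (hψc p hp) (hψU p hp)
  rw [h1, h2, ← Finset.sum_neg_distrib]
  refine Finset.sum_congr rfl fun p hp => ?_
  have h3 := (hloc p (hs (hsK p hp))).2.2 _ (hψ p hp) (hψc p hp) (hψs p hp)
  rw [setIntegral_mul_eq_integral ((tsupport_fderiv_apply_subset ℝ _).trans (hψs p hp)),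
    setIntegral_mul_eq_integral (hψs p hp)] at h3
  rw [setIntegral_mul_eq_integral ((tsupport_fderiv_apply_subset ℝ _).trans (hψU p hp)),
    setIntegral_mul_eq_integral (hψU p hp), h3]

theorem add (h : HasWeakPartial U i v w) (h' : HasWeakPartial U i v' w') :
    HasWeakPartial U i (fun x => v x + v' x) (fun x => w x + w' x) := by
  refine ⟨h.1.add h'.1, h.2.1.add h'.2.1, fun φ hφ hc hs => ?_⟩
  have hs' := (tsupport_fderiv_apply_subset ℝ (stdVec i)).trans hs
  have hc' : HasCompactSupport fun x => fderiv ℝ φ x (stdVec i) := hc.fderiv_apply ℝ _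
  have hφ' : Continuous fun x => fderiv ℝ φ x (stdVec i) :=
    (hφ.continuous_fderiv (by norm_num)).clm_apply continuous_const
  simp only [add_mul]
  rw [integral_add (integrable_mul h.1 hφ' hc' hs') (integrable_mul h'.1 hφ' hc' hs'),
    integral_add (integrable_mul h.2.1 hφ.continuous hc hs)
      (integrable_mul h'.2.1 hφ.continuous hc hs), h.2.2 φ hφ hc hs, h'.2.2 φ hφ hc hs]
  ring

theorem neg (h : HasWeakPartial U i v w) : HasWeakPartial U i (fun x => -v x) (fun x => -w x) := by
  refine ⟨h.1.neg, h.2.1.neg, fun φ hφ hc hs => ?_⟩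
  simp only [neg_mul]
  rw [integral_neg, integral_neg, h.2.2 φ hφ hc hs]

/-- Continuously differentiable test functions are admissible. -/
theorem integral_eq_of_contDiff_one (hU : IsOpen U) (h : HasWeakPartial U i v w) {φ : Euc d → ℝ}
    (hφ : ContDiff ℝ 1 φ) (hc : HasCompactSupport φ) (hs : tsupport φ ⊆ U) :
    ∫ x in U, v x * fderiv ℝ φ x (stdVec i) = - ∫ x in U, w x * φ x := by
  obtain ⟨δ, hδ, hδU⟩ := hc.isCompact.exists_cthickening_subset_open hU hs
  obtain ⟨η, hη, hηs⟩ := exists_isMollifier (0 : Euc d) one_pos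
  set S := Metric.cthickening δ (tsupport φ) with hS
  have hSc : IsCompact S := hc.isCompact.cthickening
  set t : ℕ → ℝ := fun n => δ / ((n : ℝ) + 1) with ht
  have ht0 : ∀ n, 0 < t n := fun n => by positivity
  have htδ : ∀ n, t n ≤ δ := fun n => div_le_self hδ.le (by linarith [n.cast_nonneg (α := ℝ)])
  have htlim : Tendsto t atTop (𝓝 0) := by
    have := (tendsto_one_div_add_atTop_nhds_zero_nat (𝕜 := ℝ)).const_mul δ
    rw [mul_zero] at this
    refine this.congr fun n => ?_
    simp only [ht]
    rw [mul_one_div]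
  set D : Euc d → ℝ := fun x => fderiv ℝ φ x (stdVec i) with hD
  have hDc : Continuous D := (hφ.continuous_fderiv one_ne_zero).clm_apply continuous_const
  have hDs : tsupport D ⊆ tsupport φ := tsupport_fderiv_apply_subset ℝ _
  have hDcs : HasCompactSupport D := hc.fderiv_apply ℝ _
  -- averages of a function supported in `tsupport φ` are supported in the thickening
  have hsupp : ∀ f : Euc d → ℝ, tsupport f ⊆ tsupport φ → ∀ n, tsupport (coneAvg η (t n) f) ⊆ S := by
    intro f hf n
    refine closure_minimal (fun x hx => ?_) Metric.isClosed_cthickening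
    by_contra hxS
    refine hx (coneAvg_eq_zero fun z hz => ?_)
    by_contra hne
    refine hxS (Metric.mem_cthickening_of_dist_le x _ _ _ (hf (subset_closure hne)) ?_)
    have h1 := hηs hz
    rw [mem_closedBall_zero_iff] at h1
    rw [dist_self_add_right, norm_smul, Real.norm_of_nonneg (ht0 n).le]
    exact (mul_le_of_le_one_right (ht0 n).le h1).trans (htδ n)
  have hlim : ∀ f : Euc d → ℝ, Continuous f → HasCompactSupport f → ∀ ε > 0,
      ∀ᶠ n in atTop, ∀ x, ‖coneAvg η (t n) f x - f x‖ ≤ ε := by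
    intro f hf hfc ε hε
    have huc := hfc.uniformContinuous_of_continuous hf
    obtain ⟨ρ, hρ, hfρ⟩ := Metric.uniformContinuous_iff.1 huc ε hε
    filter_upwards [htlim.eventually (gt_mem_nhds hρ)] with n hn x
    have hint : Integrable fun z => η z * f (x + t n • z) := by
      refine Continuous.integrable_of_hasCompactSupport
        (hη.contDiff.continuous.mul (hf.comp (by fun_prop))) hη.hasCompactSupport.mul_right
    have e1 : coneAvg η (t n) f x - f x = ∫ z, η z * (f (x + t n • z) - f x) := by
      simp only [mul_sub]
      rw [integral_sub hint (hη.integrable.mul_const _), hη.integral_mul_const, coneAvg]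
    rw [e1]
    calc _ ≤ ∫ z, η z * ε := by
          refine norm_integral_le_of_norm_le (hη.integrable.mul_const _)
            (Eventually.of_forall fun z => ?_)
          rw [norm_mul, Real.norm_of_nonneg (hη.nonneg z)]
          by_cases hz : z ∈ tsupport η
          · gcongr
            · exact hη.nonneg z
            have h1 := hηs hz
            rw [mem_closedBall_zero_iff] at h1
            rw [← dist_eq_norm]
            refine (hfρ ?_).le
            rw [dist_self_add_left, norm_smul, Real.norm_of_nonneg (ht0 n).le]
            exact (mul_le_of_le_one_right (ht0 n).le h1).trans_lt hn
          · simp [image_eq_zero_of_notMem_tsupport hz]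
      _ = ε := hη.integral_mul_const ε
  have hconv : ∀ g : Euc d → ℝ, LocallyIntegrableOn g U volume → ∀ f : Euc d → ℝ, Continuous f →
      HasCompactSupport f → tsupport f ⊆ tsupport φ →
      Tendsto (fun n => ∫ x in U, g x * coneAvg η (t n) f x) atTop (𝓝 (∫ x in U, g x * f x)) := by
    intro g hg f hf hfc hfs
    have hgS : IntegrableOn g S volume := hg.integrableOn_compact_subset hδU hSc
    have hfS : tsupport f ⊆ S := hfs.trans (Metric.self_subset_cthickening _)
    have hsm : ∀ n, Continuous (coneAvg η (t n) f) := fun n =>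
      (hη.contDiff_coneAvg (ht0 n) hf.locallyIntegrable).continuous
    have hrep : ∀ k : Euc d → ℝ, tsupport k ⊆ S →
        ∫ x in U, g x * k x = ∫ x in S, g x * k x := fun k hk => by
      rw [setIntegral_mul_eq_integral (hk.trans hδU), setIntegral_mul_eq_integral hk]
    rw [hrep f hfS, Metric.tendsto_atTop]
    intro ε hε
    set I := ∫ x in S, ‖g x‖ with hI
    have hI0 : 0 ≤ I := integral_nonneg fun _ => norm_nonneg _
    obtain ⟨n₀, hn₀⟩ := eventually_atTop.1 (hlim f hf hfc (ε / (I + 1)) (by positivity))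
    refine ⟨n₀, fun n hn => ?_⟩
    rw [hrep _ (hsupp f hfs n), dist_eq_norm, ← integral_sub]
    · calc _ ≤ ∫ x in S, ‖g x‖ * (ε / (I + 1)) := by
            refine norm_integral_le_of_norm_le (hgS.norm.mul_const _)
              (Eventually.of_forall fun x => ?_)
            rw [← mul_sub, norm_mul]
            gcongr
            exact hn₀ n hn x
        _ = I * (ε / (I + 1)) := integral_mul_const _ _
        _ < ε := by
            rw [mul_div_assoc', div_lt_iff₀ (by positivity)]
            nlinarith
    · exact hgS.mul_continuousOn (hsm n).continuousOn hSc
    · exact hgS.mul_continuousOn hf.continuousOn hSc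
  have hder : ∀ n x, fderiv ℝ (coneAvg η (t n) φ) x (stdVec i) = coneAvg η (t n) D x := by
    intro n x
    rw [IsMollifier.coneAvg_eq_convolution _ (ht0 n), IsMollifier.coneAvg_eq_convolution _ (ht0 n)]
    have h1 := hc.hasFDerivAt_convolution_left (μ := volume) (ContinuousLinearMap.mul ℝ ℝ) hφ
      (hη.contDiff_kernel (t n)).continuous.locallyIntegrable x
    rw [h1.fderiv, convolution_def, convolution_def, ContinuousLinearMap.integral_apply]
    · rfl
    · exact HasCompactSupport.convolutionExists_left _ (hc.fderiv ℝ)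
        (hφ.continuous_fderiv one_ne_zero)
        (hη.contDiff_kernel (t n)).continuous.locallyIntegrable x
  have h1 := hconv v h.1 D hDc hDcs hDs
  have h2 := (hconv w h.2.1 φ hφ.continuous hc subset_rfl).neg
  refine tendsto_nhds_unique h1 (h2.congr fun n => ?_)
  simp only [← hder]
  refine (h.2.2 _ (hη.contDiff_coneAvg (ht0 n) hφ.continuous.locallyIntegrable)
    (hη.hasCompactSupport_coneAvg (ht0 n) hc) ((hsupp φ subset_rfl n).trans hδU)).symm

theorem const_one (U : Set (Euc d)) (i : Fin d) : HasWeakPartial U i (fun _ => 1) (fun _ => 0) := by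
  refine ⟨(locallyIntegrable_const _).locallyIntegrableOn _,
    (locallyIntegrable_const _).locallyIntegrableOn _, fun φ hφ hc hs => ?_⟩
  rw [setIntegral_mul_eq_integral ((tsupport_fderiv_apply_subset ℝ _).trans hs)]
  have hφ' : Continuous fun x => fderiv ℝ φ x (stdVec i) :=
    (hφ.continuous_fderiv (by norm_num)).clm_apply continuous_const
  have h1 := integral_mul_fderiv_eq_neg_fderiv_mul_of_integrable (μ := (volume : Measure (Euc d)))
    (f := fun _ => (1 : ℝ)) (g := φ) (v := stdVec i) (by simp)
    (by simpa using hφ'.integrable_of_hasCompactSupport (hc.fderiv_apply ℝ _))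
    (by simpa using hφ.continuous.integrable_of_hasCompactSupport hc)
    (fun _ _ => differentiableAt_const _) fun x _ => hφ.differentiable (by norm_num) x
  rw [h1]
  simp

/-- The Leibniz rule with a continuously differentiable factor. -/
theorem mul_left (hU : IsOpen U) (h : HasWeakPartial U i v w) {a : Euc d → ℝ}
    (ha : ContDiffOn ℝ 1 a U) :
    HasWeakPartial U i (fun x => a x * v x)
      (fun x => a x * w x + fderiv ℝ a x (stdVec i) * v x) := by
  have hDa : ContinuousOn (fun x => fderiv ℝ a x (stdVec i)) U :=
    (ha.continuousOn_fderiv_of_isOpen hU le_rfl).clm_apply continuousOn_const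
  have hmul : ∀ {f g : Euc d → ℝ}, ContinuousOn f U → LocallyIntegrableOn g U volume →
      LocallyIntegrableOn (fun x => f x * g x) U volume := fun hf hg =>
    hg.continuousOn_mul hf hU.isLocallyClosed
  refine ⟨hmul ha.continuousOn h.1, (hmul ha.continuousOn h.2.1).add (hmul hDa h.1),
    fun φ hφ hc hs => ?_⟩
  set ψ : Euc d → ℝ := fun x => a x * φ x with hψ
  have hψs : tsupport ψ ⊆ tsupport φ := tsupport_mul_subset_right
  have hψc : HasCompactSupport ψ := hc.mul_left
  have hψd : ContDiff ℝ 1 ψ := by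
    rw [contDiff_iff_contDiffAt]
    intro x
    by_cases hx : x ∈ tsupport φ
    · exact (ha.contDiffAt (hU.mem_nhds (hs hx))).mul (hφ.of_le (by norm_num)).contDiffAt
    · have h0 : ψ =ᶠ[𝓝 x] fun _ => 0 := by
        filter_upwards [(isClosed_tsupport φ).isOpen_compl.mem_nhds hx] with y hy
        simp only [hψ]
        rw [image_eq_zero_of_notMem_tsupport hy, mul_zero]
      exact contDiffAt_const.congr_of_eventuallyEq h0
  have h1 := h.integral_eq_of_contDiff_one hU hψd hψc (hψs.trans hs)
  have hφ' : Continuous fun x => fderiv ℝ φ x (stdVec i) :=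
    (hφ.continuous_fderiv (by norm_num)).clm_apply continuous_const
  have hφs' := (tsupport_fderiv_apply_subset ℝ (stdVec i)).trans hs
  have hφc' : HasCompactSupport fun x => fderiv ℝ φ x (stdVec i) := hc.fderiv_apply ℝ _
  have h2 : ∫ x in U, v x * fderiv ℝ ψ x (stdVec i) =
      ∫ x in U, ((a x * v x) * fderiv ℝ φ x (stdVec i) +
        (fderiv ℝ a x (stdVec i) * v x) * φ x) := by
    refine setIntegral_congr_fun hU.measurableSet fun x hx => ?_
    have hax : DifferentiableAt ℝ a x := (ha.contDiffAt (hU.mem_nhds hx)).differentiableAt one_ne_zero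
    simp only [hψ]
    rw [fderiv_fun_mul hax (hφ.differentiable (by norm_num) x)]
    simp only [add_apply, smul_apply, smul_eq_mul]
    ring
  rw [h2, integral_add (integrable_mul (hmul ha.continuousOn h.1) hφ' hφc' hφs')
    (integrable_mul (hmul hDa h.1) hφ.continuous hc hs)] at h1
  simp only [add_mul]
  rw [integral_add (integrable_mul (hmul ha.continuousOn h.2.1) hφ.continuous hc hs)
    (integrable_mul (hmul hDa h.1) hφ.continuous hc hs), eq_sub_of_add_eq h1]
  have h3 : ∫ x in U, w x * ψ x = ∫ x in U, a x * w x * φ x := by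
    congr 1
    ext x
    simp only [hψ]
    ring
  rw [h3]
  ring

theorem of_contDiffOn (hU : IsOpen U) {a : Euc d → ℝ} (ha : ContDiffOn ℝ 1 a U) :
    HasWeakPartial U i a (fun x => fderiv ℝ a x (stdVec i)) := by
  simpa using (const_one U i).mul_left hU ha

/-- Weak partial derivatives pass to `L²` limits. -/
theorem of_tendsto (hU : volume U < ⊤) {v' w' : ℕ → Euc d → ℝ}
    (h : ∀ᶠ n in atTop, HasWeakPartial U i (v' n) (w' n)) (hv : MemLp v 2 (volume.restrict U))
    (hw : MemLp w 2 (volume.restrict U)) (hv' : ∀ᶠ n in atTop, MemLp (v' n) 2 (volume.restrict U))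
    (hw' : ∀ᶠ n in atTop, MemLp (w' n) 2 (volume.restrict U))
    (hvlim : Tendsto (fun n => eLpNorm (fun x => v' n x - v x) 2 (volume.restrict U)) atTop (𝓝 0))
    (hwlim : Tendsto (fun n => eLpNorm (fun x => w' n x - w x) 2 (volume.restrict U)) atTop (𝓝 0)) :
    HasWeakPartial U i v w := by
  have : IsFiniteMeasure (volume.restrict U) := ⟨by rwa [Measure.restrict_apply_univ]⟩
  have hloc : ∀ {f : Euc d → ℝ}, MemLp f 2 (volume.restrict U) → LocallyIntegrableOn f U volume :=
    fun hf => (show IntegrableOn _ U volume from hf.integrable (by norm_num)).locallyIntegrableOn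
  refine ⟨hloc hv, hloc hw, fun φ hφ hc hs => ?_⟩
  have hlim : ∀ (f : Euc d → ℝ) (f' : ℕ → Euc d → ℝ) (k : Euc d → ℝ), Continuous k →
      HasCompactSupport k → MemLp f 2 (volume.restrict U) →
      (∀ᶠ n in atTop, MemLp (f' n) 2 (volume.restrict U)) →
      Tendsto (fun n => eLpNorm (fun x => f' n x - f x) 2 (volume.restrict U)) atTop (𝓝 0) →
      Tendsto (fun n => ∫ x in U, f' n x * k x) atTop (𝓝 (∫ x in U, f x * k x)) := by
    intro f f' k hk hkc hf hf' hff
    have hkL : MemLp k 2 (volume.restrict U) := hk.memLp_of_hasCompactSupport hkc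
    refine tendsto_integral_of_L1' _ (hf.integrable_mul hkL).aestronglyMeasurable
      (hf'.mono fun n hn => hn.integrable_mul hkL) ?_
    have h1 := ENNReal.Tendsto.mul_const (b := eLpNorm k 2 (volume.restrict U)) hff
      (Or.inr hkL.2.ne)
    rw [zero_mul] at h1
    refine tendsto_of_tendsto_of_tendsto_of_le_of_le' tendsto_const_nhds h1
      (Eventually.of_forall fun _ => zero_le) ?_
    filter_upwards [hf'] with n hn
    have h2 : ((fun x => f' n x * k x) - f * k) =
        (fun x => f' n x - f x) • k := by
      ext x
      simp only [Pi.sub_apply, Pi.mul_apply, Pi.smul_apply', smul_eq_mul]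
      ring
    rw [h2]
    exact eLpNorm_smul_le_mul_eLpNorm hkL.1 (hn.1.sub hf.1)
  have hφ' : Continuous fun x => fderiv ℝ φ x (stdVec i) :=
    (hφ.continuous_fderiv (by norm_num)).clm_apply continuous_const
  have h1 := hlim v v' _ hφ' (hc.fderiv_apply ℝ _) hv hv' hvlim
  have h2 := (hlim w w' _ hφ.continuous hc hw hw' hwlim).neg
  refine tendsto_nhds_unique h1 (h2.congr' ?_)
  filter_upwards [h] with n hn
  exact (hn.2.2 φ hφ hc hs).symm

end HasWeakPartial

/-! ### Weak gradients on hypersurfaces -/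

/-- In every regular local parametrization `X` of `F` the function `u` has the weak derivatives
`∂_a (u ∘ X) = B ∘ X · ∂_a X`. Unlike a tangential gradient, `B` may have a normal component. -/
def HasChartGradient {m : ℕ} (F : Set (Euc (m + 1))) (u : Euc (m + 1) → ℝ)
    (B : Euc (m + 1) → Euc (m + 1)) : Prop :=
  ∀ (U : Set (Euc m)) (X : Euc m → Euc (m + 1)), IsOpen U → ContDiffOn ℝ 1 X U →
    (∀ p ∈ U, Function.Injective (fderiv ℝ X p)) → MapsTo X U F →
    ∀ a, HasWeakPartial U a (fun p => u (X p))
      (fun p => inner ℝ (B (X p)) (fderiv ℝ X p (stdVec a)))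

/-- The derivatives of a parametrization of `F` are tangent to `F`. -/
theorem fderiv_mem_tangentConeAt {m : ℕ} {F : Set (Euc (m + 1))} {U : Set (Euc m)}
    {X : Euc m → Euc (m + 1)} (hU : IsOpen U) (hX : ContDiffOn ℝ 1 X U) (hXF : MapsTo X U F)
    {p : Euc m} (hp : p ∈ U) (e : Euc m) : fderiv ℝ X p e ∈ tangentConeAt ℝ F (X p) := by
  have h1 : HasFDerivWithinAt X (fderiv ℝ X p) U p :=
    ((hX.contDiffAt (hU.mem_nhds hp)).differentiableAt one_ne_zero).hasFDerivAt.hasFDerivWithinAt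
  have h2 : e ∈ tangentConeAt ℝ U p := by
    rw [tangentConeAt_of_mem_nhds (hU.mem_nhds hp)]
    exact mem_univ _
  exact tangentConeAt_mono hXF.image_subset (h1.mapsTo_tangent_cone h2)

/-- A property that holds almost everywhere on `F` holds almost everywhere in every parameter
domain. -/
theorem ae_comp_of_ae_surf {m : ℕ} {F : Set (Euc (m + 1))} {U : Set (Euc m)}
    {X : Euc m → Euc (m + 1)} (hU : IsOpen U) (hX : ContDiffOn ℝ 1 X U)
    (hinj : ∀ p ∈ U, Function.Injective (fderiv ℝ X p)) (hXF : MapsTo X U F)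
    {P : Euc (m + 1) → Prop} (hP : ∀ᵐ x ∂(surf F), P x) :
    ∀ᵐ p ∂(volume.restrict U), P (X p) := by
  rw [ae_restrict_iff' hU.measurableSet, ae_iff]
  refine measure_null_of_locally_null _ fun p₀ hp₀ => ?_
  simp only [mem_ofPred_eq, Classical.not_imp] at hp₀
  obtain ⟨r, hr, hrU, ⟨c, hc⟩, -⟩ := exists_ball_map_le_surf hU hX hinj hXF hp₀.1
  refine ⟨{p | ¬(p ∈ U → P (X p))} ∩ Metric.ball p₀ r, inter_mem_nhdsWithin _
    (Metric.ball_mem_nhds _ hr), ?_⟩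
  have hXm : AEMeasurable X (volume.restrict (Metric.ball p₀ r)) :=
    (hX.continuousOn.mono hrU).aemeasurable Metric.isOpen_ball.measurableSet
  have h1 : ∀ᵐ x ∂((volume.restrict (Metric.ball p₀ r)).map X), P x :=
    (Measure.absolutelyContinuous_of_le hc).ae_le (Measure.ae_smul_measure hP _)
  have h2 := ae_of_ae_map hXm h1
  rw [ae_restrict_iff' Metric.isOpen_ball.measurableSet, ae_iff] at h2
  refine measure_mono_null (fun p hp => ?_) h2
  simp only [mem_inter_iff, mem_ofPred_eq, Classical.not_imp] at hp ⊢
  exact ⟨hp.2, hp.1.2⟩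

theorem mem_of_ae_surf {m : ℕ} {F : Set (Euc (m + 1))} (hF : MeasurableSet F) :
    ∀ᵐ x ∂(surf F), x ∈ F := ae_restrict_mem hF

namespace HasChartGradient

variable {m : ℕ} {F : Set (Euc (m + 1))} {u u' : Euc (m + 1) → ℝ}
  {B B' : Euc (m + 1) → Euc (m + 1)}

theorem congr_ae (h : HasChartGradient F u B) (hu : u =ᵐ[surf F] u') (hB : B =ᵐ[surf F] B') :
    HasChartGradient F u' B' := by
  intro U X hU hX hinj hXF a
  refine (h U X hU hX hinj hXF a).congr_ae (ae_comp_of_ae_surf hU hX hinj hXF hu) ?_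
  filter_upwards [ae_comp_of_ae_surf hU hX hinj hXF hB] with p hp
  rw [hp]

theorem add (h : HasChartGradient F u B) (h' : HasChartGradient F u' B') :
    HasChartGradient F (fun x => u x + u' x) (fun x => B x + B' x) := by
  intro U X hU hX hinj hXF a
  simp only [inner_add_left]
  exact (h U X hU hX hinj hXF a).add (h' U X hU hX hinj hXF a)

theorem neg (h : HasChartGradient F u B) : HasChartGradient F (fun x => -u x) (fun x => -B x) := by
  intro U X hU hX hinj hXF a
  simp only [inner_neg_left]
  exact (h U X hU hX hinj hXF a).neg

theorem sub (h : HasChartGradient F u B) (h' : HasChartGradient F u' B') :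
    HasChartGradient F (fun x => u x - u' x) (fun x => B x - B' x) := by
  simpa only [sub_eq_add_neg] using h.add h'.neg

theorem zero : HasChartGradient F (fun _ => 0) (fun _ => 0) := by
  intro U X hU hX hinj hXF a
  simpa using HasWeakPartial.of_contDiffOn (i := a) hU (contDiffOn_const (c := (0 : ℝ)))

theorem sum {ι : Type*} (s : Finset ι) {u : ι → Euc (m + 1) → ℝ}
    {B : ι → Euc (m + 1) → Euc (m + 1)} (h : ∀ i ∈ s, HasChartGradient F (u i) (B i)) :
    HasChartGradient F (fun x => ∑ i ∈ s, u i x) (fun x => ∑ i ∈ s, B i x) := by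
  classical
  induction s using Finset.induction_on with
  | empty => simpa using zero
  | insert i s hi ih =>
    simp only [Finset.sum_insert hi]
    exact (h i (Finset.mem_insert_self _ _)).add
      (ih fun j hj => h j (Finset.mem_insert_of_mem hj))

/-- The Leibniz rule with a factor that is continuously differentiable near `F`. -/
theorem mul_left (h : HasChartGradient F u B) {O : Set (Euc (m + 1))} (hO : IsOpen O)
    (hFO : F ⊆ O) {ψ : Euc (m + 1) → ℝ} (hψ : ContDiffOn ℝ 1 ψ O) :
    HasChartGradient F (fun x => ψ x * u x) (fun x => ψ x • B x + u x • gradient ψ x) := by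
  intro U X hU hX hinj hXF a
  have hψX : ContDiffOn ℝ 1 (fun p => ψ (X p)) U := hψ.comp hX (hXF.mono_right hFO)
  refine ((h U X hU hX hinj hXF a).mul_left hU hψX).congr_ae (ae_of_all _ fun _ => rfl) ?_
  filter_upwards [ae_restrict_mem hU.measurableSet] with p hp
  have h1 : DifferentiableAt ℝ ψ (X p) :=
    (hψ.contDiffAt (hO.mem_nhds (hFO (hXF hp)))).differentiableAt one_ne_zero
  have h2 : DifferentiableAt ℝ X p :=
    (hX.contDiffAt (hU.mem_nhds hp)).differentiableAt one_ne_zero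
  have h3 : fderiv ℝ (fun p => ψ (X p)) p (stdVec a) =
      inner ℝ (gradient ψ (X p)) (fderiv ℝ X p (stdVec a)) := by
    rw [fderiv_fun_comp p h1 h2, inner_gradient_left]
    rfl
  rw [h3, inner_add_left, inner_smul_left, inner_smul_left]
  simp only [conj_trivial]
  ring

/-- Removing the normal component of a gradient in charts gives the tangential gradient. -/
theorem hasTangentialGradient (h : HasChartGradient F u B) (hF : MeasurableSet F)
    {n : Euc (m + 1) → Euc (m + 1)} (hn1 : ∀ x ∈ F, ‖n x‖ = 1)
    (hn : ∀ x ∈ F, ∀ t ∈ tangentConeAt ℝ F x, inner ℝ (n x) t = 0) :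
    HasTangentialGradient F n u (fun x => B x - inner ℝ (n x) (B x) • n x) := by
  refine ⟨?_, fun U X hU hX hinj hXF a => ?_⟩
  · filter_upwards [mem_of_ae_surf hF] with x hx
    rw [inner_sub_left, inner_smul_left, real_inner_self_eq_norm_sq, hn1 x hx, real_inner_comm]
    simp
  · refine (h U X hU hX hinj hXF a).congr_ae (ae_of_all _ fun _ => rfl) ?_
    filter_upwards [ae_restrict_mem hU.measurableSet] with p hp
    rw [inner_sub_left, inner_smul_left,
      hn _ (hXF hp) _ (fderiv_mem_tangentConeAt hU hX hXF hp _), mul_zero, sub_zero]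

end HasChartGradient

namespace HasTangentialGradient

variable {m : ℕ} {F : Set (Euc (m + 1))} {n : Euc (m + 1) → Euc (m + 1)}
  {u u' : Euc (m + 1) → ℝ} {W W' : Euc (m + 1) → Euc (m + 1)}

theorem congr_ae (h : HasTangentialGradient F n u W) (hu : u =ᵐ[surf F] u') :
    HasTangentialGradient F n u' W :=
  ⟨h.1, HasChartGradient.congr_ae h.2 hu (ae_eq_refl _)⟩

/-- Tangential gradients are unique, since the derivatives of a parametrization together with the
normal span the space. -/
theorem unique {X : Euc m → Euc (m + 1)} {U : Set (Euc m)} {κ : ℝ} {L : ℝ≥0}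
    (hX : GlobalChart F X U κ L) (hn1 : ∀ x ∈ F, ‖n x‖ = 1)
    (hn : ∀ x ∈ F, ∀ t ∈ tangentConeAt ℝ F x, inner ℝ (n x) t = 0)
    (h : HasTangentialGradient F n u W) (h' : HasTangentialGradient F n u W') :
    W =ᵐ[surf F] W' := by
  have hXF : MapsTo X U F := fun p hp => hX.image ▸ mem_image_of_mem X hp
  -- both have the same derivatives in the global chart
  have h1 : ∀ᵐ p ∂(volume.restrict U), ∀ a, inner ℝ (W (X p)) (fderiv ℝ X p (stdVec a)) =
      inner ℝ (W' (X p)) (fderiv ℝ X p (stdVec a)) :=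
    ae_all_iff.2 fun a => HasWeakPartial.unique hX.isOpen
      (h.2 U X hX.isOpen hX.contDiffOn hX.injective hXF a)
      (h'.2 U X hX.isOpen hX.contDiffOn hX.injective hXF a)
  have h2 : ∀ᵐ x ∂(surf F), ∀ p ∈ U, X p = x → ∀ a,
      inner ℝ (W x) (fderiv ℝ X p (stdVec a)) = inner ℝ (W' x) (fderiv ℝ X p (stdVec a)) := by
    refine hX.ae_surf_of_ae ?_
    filter_upwards [h1, ae_restrict_mem hX.isOpen.measurableSet] with p hp hpU q hq hqp
    rw [hX.injOn hq hpU hqp]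
    exact hp
  filter_upwards [h2, h.1, h'.1, mem_of_ae_surf hX.measurableSet] with x hx hxn hxn' hxF
  obtain ⟨p, hp, rfl⟩ : x ∈ X '' U := hX.image.symm ▸ hxF
  set D := fderiv ℝ X p with hD
  set R : Submodule ℝ (Euc (m + 1)) := LinearMap.range (D : Euc m →ₗ[ℝ] Euc (m + 1)) with hR
  -- the difference is orthogonal to the range of `DX`, whose orthogonal complement is the normal line,
  -- and orthogonal to the normal
  have hz : W (X p) - W' (X p) ∈ Rᗮ := by
    rw [Submodule.mem_orthogonal']
    rintro - ⟨e, rfl⟩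
    have he : e = ∑ a, e a • stdVec a := by
      conv_lhs => rw [← (EuclideanSpace.basisFun (Fin m) ℝ).sum_repr e]
      simp [stdVec]
    rw [ContinuousLinearMap.coe_coe, he, map_sum, inner_sum]
    refine Finset.sum_eq_zero fun a _ => ?_
    rw [map_smul, inner_smul_right, inner_sub_left, hx p hp rfl a, sub_self, mul_zero]
  have hnR : n (X p) ∈ Rᗮ := by
    rw [Submodule.mem_orthogonal']
    rintro - ⟨e, rfl⟩
    exact hn _ hxF _ (fderiv_mem_tangentConeAt hX.isOpen hX.contDiffOn hXF hp e)
  have hfin : Module.finrank ℝ Rᗮ = 1 := by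
    have h3 : Module.finrank ℝ R = m := by
      rw [hR, LinearMap.finrank_range_of_inj (hX.injective p hp)]
      simp
    have h4 := Submodule.finrank_add_finrank_orthogonal R
    rw [h3, finrank_euclideanSpace, Fintype.card_fin] at h4
    omega
  have hn0 : (⟨n (X p), hnR⟩ : Rᗮ) ≠ 0 := by
    intro h0
    have h5 := congrArg Subtype.val h0
    have h6 := hn1 _ hxF
    simp only [ZeroMemClass.coe_zero] at h5
    rw [h5, norm_zero] at h6
    exact zero_ne_one h6
  obtain ⟨c, hc⟩ := (finrank_eq_one_iff_of_nonzero' _ hn0).1 hfin ⟨_, hz⟩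
  have hc' : c • n (X p) = W (X p) - W' (X p) := congrArg Subtype.val hc
  have h7 : inner ℝ (W (X p) - W' (X p)) (n (X p)) = 0 := by
    rw [inner_sub_left, hxn, hxn', sub_zero]
  rw [← hc', inner_smul_left, real_inner_self_eq_norm_sq, hn1 _ hxF] at h7
  have h8 : c = 0 := by simpa using h7
  rw [h8, zero_smul] at hc'
  exact sub_eq_zero.1 hc'.symm

end HasTangentialGradient

/-- Every point of a parameter domain has a ball on which composition with the parametrization is
bounded from `L²` of the surface, near the image point, to `L²` of the ball. -/
theorem exists_ball_eLpNorm_comp_le {m : ℕ} {F : Set (Euc (m + 1))} {U : Set (Euc m)}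
    {X : Euc m → Euc (m + 1)} (hU : IsOpen U) (hX : ContDiffOn ℝ 1 X U)
    (hinj : ∀ p ∈ U, Function.Injective (fderiv ℝ X p)) (hXF : MapsTo X U F) {p₀ : Euc m}
    (hp₀ : p₀ ∈ U) {ρ : ℝ} (hρ : 0 < ρ) : ∃ r > 0, Metric.ball p₀ r ⊆ U ∧
      MapsTo X (Metric.ball p₀ r) (Metric.ball (X p₀) ρ) ∧
      (∃ b, ∀ p ∈ Metric.ball p₀ r, ‖fderiv ℝ X p‖ ≤ b) ∧
      ∃ c : ℝ≥0, ∀ k : Euc (m + 1) → ℝ, AEStronglyMeasurable k (surf F) →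
        AEStronglyMeasurable (fun p => k (X p)) (volume.restrict (Metric.ball p₀ r)) ∧
        eLpNorm (fun p => k (X p)) 2 (volume.restrict (Metric.ball p₀ r)) ≤
          c * eLpNorm k 2 ((surf F).restrict (Metric.ball (X p₀) ρ)) := by
  obtain ⟨r₁, hr₁, hr₁U, ⟨c, hc⟩, b, hb⟩ := exists_ball_map_le_surf hU hX hinj hXF hp₀
  obtain ⟨r₂, hr₂, hr₂X⟩ := Metric.continuousAt_iff.1
    (hX.continuousOn.continuousAt (hU.mem_nhds hp₀)) ρ hρ
  have hsub : Metric.ball p₀ (min r₁ r₂) ⊆ Metric.ball p₀ r₁ :=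
    Metric.ball_subset_ball (min_le_left _ _)
  have hmaps : MapsTo X (Metric.ball p₀ (min r₁ r₂)) (Metric.ball (X p₀) ρ) := fun p hp =>
    hr₂X (lt_of_lt_of_le hp (min_le_right _ _))
  refine ⟨min r₁ r₂, lt_min hr₁ hr₂, hsub.trans hr₁U, hmaps, ⟨b, fun p hp => hb p (hsub hp)⟩,
    c ^ (1 / 2 : ℝ), fun k hk => ?_⟩
  set μ := volume.restrict (Metric.ball p₀ (min r₁ r₂)) with hμ
  have hXm₁ : AEMeasurable X (volume.restrict (Metric.ball p₀ r₁)) :=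
    (hX.continuousOn.mono hr₁U).aemeasurable Metric.isOpen_ball.measurableSet
  have hXm : AEMeasurable X μ := hXm₁.mono_measure (Measure.restrict_mono_set _ hsub)
  have hle : μ.map X ≤ c • surf F := by
    refine le_trans ?_ hc
    refine Measure.le_iff.2 fun s hs => ?_
    rw [Measure.map_apply_of_aemeasurable hXm hs, Measure.map_apply_of_aemeasurable hXm₁ hs]
    exact Measure.restrict_mono_set _ hsub _
  have hle' : μ.map X ≤ c • (surf F).restrict (Metric.ball (X p₀) ρ) := by
    have h1 : μ.map X = (μ.map X).restrict (Metric.ball (X p₀) ρ) := by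
      refine (Measure.restrict_eq_self_of_ae_mem ?_).symm
      refine (ae_map_iff (p := fun x => x ∈ Metric.ball (X p₀) ρ) hXm
        Metric.isOpen_ball.measurableSet).2 ?_
      filter_upwards [ae_restrict_mem Metric.isOpen_ball.measurableSet] with p hp
      exact hmaps hp
    rw [h1, ← Measure.restrict_smul]
    exact Measure.restrict_mono subset_rfl hle
  have hk' : AEStronglyMeasurable k (μ.map X) :=
    (hk.smul_measure c).mono_measure hle
  refine ⟨hk'.comp_aemeasurable hXm, ?_⟩
  have h2 : eLpNorm (fun p => k (X p)) 2 μ = eLpNorm k 2 (μ.map X) :=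
    (eLpNorm_map_measure hk' hXm).symm
  rw [h2]
  refine (eLpNorm_mono_measure k hle').trans ?_
  change eLpNorm k 2 ((c : ℝ≥0∞) • (surf F).restrict (Metric.ball (X p₀) ρ)) ≤ _
  rw [eLpNorm_smul_measure_of_ne_top (by norm_num), smul_eq_mul,
    ENNReal.coe_rpow_of_nonneg _ (by norm_num)]
  norm_num

/-! ### The trace of a weak gradient -/

theorem fderiv_apply_eq_sum {d : ℕ} (T : Euc d →L[ℝ] ℝ) (y : Euc d) :
    T y = ∑ i, T (stdVec i) * y i := by
  conv_lhs => rw [← (EuclideanSpace.basisFun (Fin d) ℝ).sum_repr y]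
  simp [stdVec, mul_comm]

theorem norm_stdVec {d : ℕ} (i : Fin d) : ‖(stdVec i : Euc d)‖ = 1 := by simp [stdVec]

theorem inner_eq_sum {d : ℕ} (x y : Euc d) : inner ℝ x y = ∑ i, x i * y i := by
  simp [PiLp.inner_apply, mul_comm]

/-- The trace of the weak gradient is the gradient, in charts of the face, of the trace. Both are
limits of averages over interior cones, for which this is the chain rule. -/
theorem HasTrace.hasChartGradient {m : ℕ} {K F : Set (Euc (m + 1))} (hF : IsTraceFace K F)
    {v g : Euc (m + 1) → ℝ} {Dv : Fin (m + 1) → Euc (m + 1) → ℝ}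
    {G : Euc (m + 1) → Euc (m + 1)} (hv : HasTrace K F v g) (hD : HasVectorTrace K F Dv G)
    (hw : ∀ i, HasWeakPartial K i v (Dv i)) : HasChartGradient F g G := by
  intro U X hU hX hinj hXF a
  have hKm := hF.domain.isOpen.measurableSet
  obtain ⟨f, hfm, hf, hf0, hvf⟩ := exists_representative hKm hv.1
  choose D hDm hDL hD0 hDf using fun i => exists_representative hKm (hD i).1
  have hfD : ∀ i, HasWeakPartial K i f (D i) := fun i => (hw i).congr_ae hvf (hDf i)
  have htf : HasTrace K F f g := hv.congr_ae hvf
  have htD : ∀ i, HasTrace K F (D i) (fun x => G x i) := fun i => (hD i).congr_ae (hDf i)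
  -- weak derivatives are a local matter: work on a parameter ball `V` whose image lies in the part of
  -- the face near which one interior cone is available
  refine HasWeakPartial.of_local fun p₀ hp₀ => ?_
  obtain ⟨w, ρ, hcone⟩ := hF.domain.cone _ (hF.subset (hXF hp₀))
  have hρ := hcone.pos
  obtain ⟨η, hη, hηs⟩ := exists_isMollifier w hρ
  obtain ⟨r, hr, hrU, hrX, ⟨b, hb⟩, c, hc⟩ :=
    exists_ball_eLpNorm_comp_le hU hX hinj hXF hp₀ (half_pos hρ)
  refine ⟨r, hr, hrU, ?_⟩
  set V := Metric.ball p₀ r with hV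
  have hVm : MeasurableSet V := Metric.isOpen_ball.measurableSet
  have hXV : ContDiffOn ℝ 1 X V := hX.mono hrU
  -- `q i` is the `i`-th component of the tangent vector `∂_a X`, bounded on `V`
  set q : Fin (m + 1) → Euc m → ℝ := fun i p => (fderiv ℝ X p (stdVec a)) i with hq
  have hqc : ∀ i, AEStronglyMeasurable (q i) (volume.restrict V) := fun i => by
    have h1 : ContinuousOn (fun p => fderiv ℝ X p (stdVec a)) V :=
      (hXV.continuousOn_fderiv_of_isOpen Metric.isOpen_ball le_rfl).clm_apply continuousOn_const
    exact ((EuclideanSpace.proj (𝕜 := ℝ) i).continuous.comp_continuousOn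
      h1).aestronglyMeasurable hVm
  have hqb : ∀ i, ∀ᵐ p ∂(volume.restrict V), ‖q i p‖ ≤ b := fun i => by
    filter_upwards [ae_restrict_mem hVm] with p hp
    refine (PiLp.norm_apply_le _ i).trans ((ContinuousLinearMap.le_opNorm _ _).trans ?_)
    rw [norm_stdVec, mul_one]
    exact hb p hp
  have hcomp : ∀ k : Euc (m + 1) → ℝ, MemLp k 2 (surf F) →
      MemLp (fun p => k (X p)) 2 (volume.restrict V) := fun k hk =>
    ⟨(hc k hk.1).1, (hc k hk.1).2.trans_lt (ENNReal.mul_lt_top ENNReal.coe_lt_top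
      ((eLpNorm_mono_measure _ Measure.restrict_le_self).trans_lt hk.2))⟩
  have hcompq : ∀ i, ∀ k : Euc (m + 1) → ℝ, MemLp k 2 (surf F) →
      MemLp (fun p => k (X p) * q i p) 2 (volume.restrict V) := fun i k hk => by
    refine MemLp.of_le_mul (c := b) (hcomp k hk) ((hcomp k hk).1.mul (hqc i)) ?_
    filter_upwards [hqb i] with p hp
    rw [norm_mul, mul_comm]
    gcongr
  set t : ℕ → ℝ := fun n => 1 / ((n : ℝ) + 1) with ht
  have ht0 : ∀ n, 0 < t n := fun n => by positivity
  have htlim : Tendsto t atTop (𝓝[>] 0) := tendsto_nhdsWithin_iff.2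
    ⟨tendsto_one_div_add_atTop_nhds_zero_nat, Eventually.of_forall ht0⟩
  have hsm : ∀ k : Euc (m + 1) → ℝ, MemLp k 2 volume → ∀ n, ContDiff ℝ ∞ (coneAvg η (t n) k) :=
    fun k hk n => hη.contDiff_coneAvg (ht0 n) (hk.locallyIntegrable (by norm_num))
  have hcs : ∀ k : Euc (m + 1) → ℝ, (∀ x ∉ K, k x = 0) → ∀ n,
      HasCompactSupport (coneAvg η (t n) k) := fun k hk n => by
    refine hη.hasCompactSupport_coneAvg (ht0 n) ?_
    refine HasCompactSupport.of_support_subset_isCompact hF.domain.isBounded.isCompact_closure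
      fun x hx => subset_closure ?_
    by_contra hxK
    exact hx (hk x hxK)
  have hmem : ∀ k : Euc (m + 1) → ℝ, MemLp k 2 volume → (∀ x ∉ K, k x = 0) → ∀ n,
      MemLp (coneAvg η (t n) k) 2 (surf F) := fun k hk hk0 n =>
    hF.memLp (hsm k hk n).continuous (hcs k hk0 n)
  have hGL : ∀ i, MemLp (fun x => G x i) 2 (surf F) := fun i => (htD i).2.1
  -- cone averages of a function, composed with `X`, converge to its trace composed with `X`
  have hlim : ∀ k l : Euc (m + 1) → ℝ, HasTrace K F k l → Measurable k → MemLp k 2 volume →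
      (∀ x ∉ K, k x = 0) → Tendsto (fun n => eLpNorm (fun p => coneAvg η (t n) k (X p) - l (X p)) 2
        (volume.restrict V)) atTop (𝓝 0) := by
    intro k l hkl hkm hk hk0
    have h1 := ENNReal.Tendsto.const_mul (a := (c : ℝ≥0∞))
      ((hkl.tendsto_coneAvg hF hkm hk hk0 hcone hη hηs).comp htlim) (Or.inr ENNReal.coe_ne_top)
    rw [mul_zero] at h1
    refine tendsto_of_tendsto_of_tendsto_of_le_of_le tendsto_const_nhds h1
      (fun _ => zero_le) fun n => ?_
    exact (hc (fun x => coneAvg η (t n) k x - l x) ((hmem k hk hk0 n).sub hkl.2.1).1).2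
  have hsumG : (fun p => inner ℝ (G (X p)) (fderiv ℝ X p (stdVec a))) =
      fun p => ∑ i, G (X p) i * q i p := by
    ext p
    rw [inner_eq_sum]
  rw [hsumG]
  refine HasWeakPartial.of_tendsto (v' := fun n p => coneAvg η (t n) f (X p))
    (w' := fun n p => ∑ i, coneAvg η (t n) (D i) (X p) * q i p) measure_ball_lt_top ?_
    (hcomp g htf.2.1) (memLp_finsetSum _ fun i _ => hcompq i _ (hGL i))
    (Eventually.of_forall fun n => hcomp _ (hmem f hf hf0 n))
    (Eventually.of_forall fun n =>
      memLp_finsetSum _ fun i _ => hcompq i _ (hmem _ (hDL i) (hD0 i) n))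
    (hlim f g htf hfm hf hf0) ?_
  -- the chain rule for the smooth averages; on the face, averaging commutes with differentiation
  · filter_upwards [htlim.eventually (Ioc_mem_nhdsGT hρ)] with n hn
    have h1 : ContDiffOn ℝ 1 (fun p => coneAvg η (t n) f (X p)) V :=
      ((hsm f hf n).of_le (by norm_num)).comp_contDiffOn hXV
    refine (HasWeakPartial.of_contDiffOn Metric.isOpen_ball h1).congr_ae
      (ae_of_all _ fun _ => rfl) ?_
    filter_upwards [ae_restrict_mem hVm] with p hp
    have h2 : DifferentiableAt ℝ X p :=
      (hX.contDiffAt (hU.mem_nhds (hrU hp))).differentiableAt one_ne_zero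
    rw [fderiv_fun_comp p ((hsm f hf n).differentiable (by norm_num) _) h2,
      ContinuousLinearMap.comp_apply, fderiv_apply_eq_sum]
    refine Finset.sum_congr rfl fun i _ => ?_
    rw [hη.fderiv_coneAvg (ht0 n) (hf.locallyIntegrable (by norm_num)) (hfD i) hf0 (hD0 i)]
    intro z hz
    have h3 : dist (X p) (X p₀) < ρ := by
      have : dist (X p) (X p₀) < ρ / 2 := hrX hp
      linarith
    exact hcone.add_smul_mem (hF.subset (hXF (hrU hp))) h3 (hηs hz) hn.1 hn.2
  -- convergence of the derivatives in `L²(V)`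
  · have h0 : ∀ i, Tendsto (fun n => ENNReal.ofReal b * eLpNorm
        (fun p => coneAvg η (t n) (D i) (X p) - G (X p) i) 2 (volume.restrict V)) atTop
        (𝓝 (ENNReal.ofReal b * 0)) := fun i => by
      have h2 := hlim (D i) (fun x => G x i) (htD i) (hDm i) (hDL i) (hD0 i)
      exact ENNReal.Tendsto.const_mul h2 (Or.inr ENNReal.ofReal_ne_top)
    have h1 := tendsto_finsetSum Finset.univ fun i _ => h0 i
    simp only [mul_zero, Finset.sum_const_zero] at h1
    refine tendsto_of_tendsto_of_tendsto_of_le_of_le tendsto_const_nhds h1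
      (fun _ => zero_le) fun n => ?_
    have h2 : (fun p => ∑ i, coneAvg η (t n) (D i) (X p) * q i p - ∑ i, G (X p) i * q i p) =
        ∑ i, fun p => (coneAvg η (t n) (D i) (X p) - G (X p) i) * q i p := by
      ext p
      rw [Finset.sum_apply, ← Finset.sum_sub_distrib]
      simp only [sub_mul]
    have h3 : ∀ i, AEStronglyMeasurable (fun p => coneAvg η (t n) (D i) (X p) - G (X p) i)
        (volume.restrict V) := fun i =>
      ((hcomp _ (hmem _ (hDL i) (hD0 i) n)).sub (hcomp _ (hGL i))).1
    dsimp only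
    rw [h2]
    refine (eLpNorm_sum_le (fun i _ => (h3 i).mul (hqc i)) (by norm_num)).trans
      (Finset.sum_le_sum fun i _ => ?_)
    refine eLpNorm_le_mul_eLpNorm_of_ae_le_mul ?_ 2
    filter_upwards [hqb i] with p hp
    rw [Pi.mul_apply, norm_mul, mul_comm]
    gcongr

/-! ### Sobolev functions of the required orders have traces -/

theorem MemSlobodeckij.memLp {d : ℕ} {U : Set (Euc d)} {σ : ℝ} {k : ℕ} {v : Euc d → ℝ}
    (h : MemSlobodeckij U σ k v) : MemLp v 2 (volume.restrict U) := by
  cases k with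
  | zero => exact h.1
  | succ k => exact h.1

theorem MemSlobodeckij.congr_ae {d : ℕ} {U : Set (Euc d)} {σ : ℝ} {k : ℕ} {v w : Euc d → ℝ}
    (h : MemSlobodeckij U σ k v) (hvw : v =ᵐ[volume.restrict U] w) : MemSlobodeckij U σ k w := by
  cases k with
  | zero => exact ⟨h.1.ae_eq hvw, fun hσ => gagliardoSq_congr_ae σ hvw ▸ h.2 hσ⟩
  | succ k =>
    refine ⟨h.1.ae_eq hvw, fun i => ?_⟩
    obtain ⟨z, hz, hzk⟩ := h.2 i
    exact ⟨z, hz.congr_ae hvw (ae_eq_refl _), hzk⟩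

/-- Weak derivatives lower the Sobolev order by one. -/
theorem MemSlobodeckij.hasWeakPartial {d : ℕ} {U : Set (Euc d)} (hU : IsOpen U) {σ : ℝ} {k : ℕ}
    {v w : Euc d → ℝ} {i : Fin d} (h : MemSlobodeckij U σ (k + 1) v)
    (hw : HasWeakPartial U i v w) : MemSlobodeckij U σ k w := by
  obtain ⟨z, hz, hzk⟩ := h.2 i
  exact hzk.congr_ae (hz.unique hU hw)

/-- Functions of order greater than one half have traces on the faces. -/
theorem MemSlobodeckij.exists_trace {m : ℕ} {K F : Set (Euc (m + 1))}
    {f : Euc (m + 1) → Euc (m + 1)} {A C S O O' ν c κ L}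
    (hR : RegularFace K F f A C S O O' ν c κ L) {σ : ℝ} (hσ1 : σ < 1) {k : ℕ}
    (hk : 1 ≤ k ∨ 1 / 2 < σ) {v : Euc (m + 1) → ℝ} (hv : MemSlobodeckij K σ k v) :
    ∃ g, HasTrace K F v g := by
  cases k with
  | zero =>
    have hσ : 1 / 2 < σ := by simpa using hk
    exact hR.isTraceFace.exists_trace hσ hσ1 hv.1 (hv.2 (by linarith))
  | succ k =>
    choose w hw hwk using hv.2
    refine hR.isTraceFace.exists_trace (σ := 3 / 4) (by norm_num) (by norm_num) hv.1 ?_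
    have hK := hR.domain_eq
    subst hK
    exact hR.map.gagliardoSq_lt_top m.succ_pos (by norm_num) (by norm_num) hv.1 hw
      fun i => (hwk i).memLp

theorem exists_vectorTrace {m : ℕ} {K F : Set (Euc (m + 1))} {w : Fin (m + 1) → Euc (m + 1) → ℝ}
    (h : ∀ i, ∃ g, HasTrace K F (w i) g) : ∃ G, HasVectorTrace K F w G := by
  choose g hg using h
  exact ⟨fun x => WithLp.toLp 2 fun i => g i x, fun i => hg i⟩

/-! ### The Laplacian on a face -/

/-- The algebra behind the second identity, at one point: `n` is the unit normal, `P i j = ∂_i n_j`,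
and `B j` is the gradient of the `j`-th component of `G - (n · G) n`, as given by the Leibniz
rule. -/
theorem sum_eq_divergence_add {ι : Type*} [Fintype ι] (n G : ι → ℝ) (P Q : ι → ι → ℝ)
    (hn : ∑ i, n i ^ 2 = 1) (hP : ∀ i, ∑ k, n k * P i k = 0) {B : ι → ι → ℝ}
    (hB : ∀ j i, B j i = Q j i - ∑ k, (n k * n j * Q k i + G k * (n k * P i j + n j * P i k))) :
    ∑ j, Q j j = ∑ j, (B j j - (∑ i, n i * B j i) * n j) + (∑ i, P i i) * ∑ k, n k * G k +
      ∑ i, (∑ l, n l * Q i l) * n i := by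
  set g := ∑ k, n k * G k with hg
  set r : ι → ℝ := fun i => ∑ k, n k * Q k i with hr
  set c : ι → ℝ := fun i => ∑ k, G k * P i k with hc
  have hB' : ∀ j i, B j i = Q j i - n j * r i - g * P i j - n j * c i := by
    intro j i
    rw [hB, hr, hg, hc]
    simp only [mul_add, Finset.sum_add_distrib, Finset.mul_sum, Finset.sum_mul]
    have e1 : ∀ k, n k * n j * Q k i = n j * (n k * Q k i) := fun k => by ring
    have e2 : ∀ k, G k * (n k * P i j) = n k * G k * P i j := fun k => by ring
    have e3 : ∀ k, G k * (n j * P i k) = n j * (G k * P i k) := fun k => by ring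
    simp only [e1, e2, e3]
    ring
  have h1 : ∑ j, B j j = ∑ j, Q j j - ∑ j, n j * r j - g * ∑ j, P j j - ∑ j, n j * c j := by
    simp only [hB', Finset.sum_sub_distrib, Finset.mul_sum]
  have h2 : ∀ j, ∑ i, n i * B j i = ∑ i, n i * Q j i - n j * ∑ i, n i * r i -
      g * ∑ i, n i * P i j - n j * ∑ i, n i * c i := by
    intro j
    simp only [hB', mul_sub, Finset.sum_sub_distrib, Finset.mul_sum]
    congr 1
    · congr 1
      · congr 1
        exact Finset.sum_congr rfl fun i _ => by ring
      · exact Finset.sum_congr rfl fun i _ => by ring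
    · exact Finset.sum_congr rfl fun i _ => by ring
  have h3 : ∑ j, (∑ i, n i * P i j) * n j = 0 := by
    simp only [Finset.sum_mul]
    rw [Finset.sum_comm]
    refine Finset.sum_eq_zero fun i _ => ?_
    have : ∀ j, n i * P i j * n j = n i * (n j * P i j) := fun j => by ring
    simp only [this]
    rw [← Finset.mul_sum, hP, mul_zero]
  have h4 : ∑ j, (∑ i, n i * B j i) * n j = ∑ j, (∑ i, n i * Q j i) * n j -
      ∑ i, n i * r i - ∑ i, n i * c i := by
    have e1 : ∀ j, (∑ i, n i * B j i) * n j = (∑ i, n i * Q j i) * n j -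
        n j ^ 2 * ∑ i, n i * r i - g * ((∑ i, n i * P i j) * n j) - n j ^ 2 * ∑ i, n i * c i := by
      intro j
      rw [h2]
      ring
    simp only [e1, Finset.sum_sub_distrib]
    rw [← Finset.sum_mul, ← Finset.sum_mul, ← Finset.mul_sum, h3, hn]
    ring
  rw [Finset.sum_sub_distrib, h1, h4]
  ring

/-- The gradient in charts of the components of the tangential part `G - (n · G) n`, where the unit
normal `n` has the continuously differentiable extension `N`. -/
theorem HasChartGradient.tangentialPart {m : ℕ} {F : Set (Euc (m + 1))} (hF : MeasurableSet F)
    {n N G : Euc (m + 1) → Euc (m + 1)} {Q : Fin (m + 1) → Euc (m + 1) → Euc (m + 1)}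
    {O : Set (Euc (m + 1))} (hO : IsOpen O) (hFO : F ⊆ O) (hN : ContDiffOn ℝ 1 N O)
    (hNn : ∀ x ∈ F, N x = n x) (hG : ∀ j, HasChartGradient F (fun x => G x j) (Q j))
    (j : Fin (m + 1)) :
    HasChartGradient F (fun x => (G x - (inner ℝ (n x) (G x) : ℝ) • n x) j)
      (fun x => Q j x - ∑ k, ((N x k * N x j) • Q k x +
        G x k • gradient (fun y => N y k * N y j) x)) := by
  have hNc : ∀ i, ContDiffOn ℝ 1 (fun x => N x i) O := fun i =>
    (EuclideanSpace.proj (𝕜 := ℝ) i).contDiff.comp_contDiffOn hN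
  refine ((hG j).sub (HasChartGradient.sum Finset.univ fun k _ =>
    (hG k).mul_left hO hFO ((hNc k).mul (hNc j)))).congr_ae ?_ (ae_eq_refl _)
  filter_upwards [mem_of_ae_surf hF] with x hx
  rw [PiLp.sub_apply, PiLp.smul_apply, inner_eq_sum, smul_eq_mul, Finset.sum_mul, hNn x hx]
  congr 1
  exact Finset.sum_congr rfl fun k _ => by ring

theorem gradient_apply {d : ℕ} (f : Euc d → ℝ) (x : Euc d) (i : Fin d) :
    gradient f x i = fderiv ℝ f x (stdVec i) := by
  rw [← inner_gradient_left, inner_eq_sum]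
  simp [stdVec]

/-- The derivatives of a field of unit vectors are orthogonal to it. -/
theorem sum_mul_fderiv_eq_zero {d : ℕ} {O : Set (Euc d)} (hO : IsOpen O) {N : Euc d → Euc d}
    (hN : ContDiffOn ℝ 1 N O) (hN1 : ∀ x ∈ O, ‖N x‖ = 1) {x : Euc d} (hx : x ∈ O) (e : Euc d) :
    ∑ k, N x k * fderiv ℝ N x e k = 0 := by
  have h1 : HasFDerivAt N (fderiv ℝ N x) x :=
    ((hN.contDiffAt (hO.mem_nhds hx)).differentiableAt one_ne_zero).hasFDerivAt
  have h2 := h1.norm_sq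
  have h3 : (fun y => ‖N y‖ ^ 2) =ᶠ[𝓝 x] fun _ => 1 := by
    filter_upwards [hO.mem_nhds hx] with y hy
    rw [hN1 y hy, one_pow]
  have h4 := h2.unique ((hasFDerivAt_const (1 : ℝ) x).congr_of_eventuallyEq h3)
  have h5 := congrArg (fun T : Euc d →L[ℝ] ℝ => T e) h4
  simp only [smul_apply, ContinuousLinearMap.comp_apply, innerSL_apply_apply,
    zero_apply] at h5
  rw [← inner_eq_sum]
  simpa using h5

/-- The pointwise second identity: the divergence of the tangential part of the gradient. -/
theorem sum_trace_eq {m : ℕ} {F : Set (Euc (m + 1))} {n N G : Euc (m + 1) → Euc (m + 1)}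
    {Q : Fin (m + 1) → Euc (m + 1) → Euc (m + 1)} {O : Set (Euc (m + 1))} (hO : IsOpen O)
    (hFO : F ⊆ O) (hN : ContDiffOn ℝ 1 N O) (hN1 : ∀ x ∈ O, ‖N x‖ = 1)
    (hNn : ∀ x ∈ F, N x = n x) {x : Euc (m + 1)} (hx : x ∈ F)
    {B : Fin (m + 1) → Euc (m + 1)}
    (hB : ∀ j, B j = Q j x - ∑ k, ((N x k * N x j) • Q k x +
        G x k • gradient (fun y => N y k * N y j) x)) :
    ∑ j, Q j x j = ∑ j, (B j - (inner ℝ (n x) (B j) : ℝ) • n x) j +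
      (∑ i, (fderiv ℝ N x (stdVec i)) i) * normalDeriv n G x + secondNormalDeriv n Q x := by
  have hd : DifferentiableAt ℝ N x :=
    (hN.contDiffAt (hO.mem_nhds (hFO hx))).differentiableAt one_ne_zero
  have hc : ∀ i, HasFDerivAt (fun y => N y i)
      ((EuclideanSpace.proj (𝕜 := ℝ) i).comp (fderiv ℝ N x)) x := fun i =>
    (EuclideanSpace.proj (𝕜 := ℝ) i).hasFDerivAt.comp x hd.hasFDerivAt
  have hg : ∀ k j i, gradient (fun y => N y k * N y j) x i =
      N x k * fderiv ℝ N x (stdVec i) j + N x j * fderiv ℝ N x (stdVec i) k := by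
    intro k j i
    have h1 : HasFDerivAt (fun y => N y k * N y j) _ x := (hc k).mul (hc j)
    rw [gradient_apply, h1.fderiv]
    rfl
  have hkey := sum_eq_divergence_add (fun i => n x i) (fun i => G x i)
    (fun i j => fderiv ℝ N x (stdVec i) j) (fun i j => Q i x j) ?_ ?_ (B := fun j i => B j i) ?_
  · simp only [normalDeriv, secondNormalDeriv, inner_eq_sum, PiLp.sub_apply, PiLp.smul_apply,
      smul_eq_mul]
    exact hkey
  · have := hN1 x (hFO hx)
    rw [hNn x hx, ← sq_eq_sq₀ (norm_nonneg _) zero_le_one, EuclideanSpace.real_norm_sq_eq,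
      one_pow] at this
    exact this
  · intro i
    have := sum_mul_fderiv_eq_zero hO hN hN1 (hFO hx) (stdVec i)
    rwa [hNn x hx] at this
  · intro j i
    rw [hB j, PiLp.sub_apply, WithLp.ofLp_sum, Finset.sum_apply]
    simp only [PiLp.add_apply, PiLp.smul_apply, smul_eq_mul, hg, hNn x hx]

end

/-! ### The trace identities on mesh faces -/

theorem mainTheorem6 (m : ℕ) (α : ℝ≥0) (hα₀ : 0 < α) (hα₁ : α < 1)
    (Ω : Set (Euc (m + 1))) {N : ℕ} (Γ : Fin N → Set (Euc (m + 1)))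
    (hΩ : IsPiecewiseConvexDomain 2 α Ω Γ)
    {M : ℕ} (T : Fin M → CurvedElement (m + 1)) (hT : IsMesh Ω T)
    (k : Fin M) (F : Set (Euc (m + 1))) (hF : IsMeshFace Γ T k F) :
    (∃ n, IsOutwardUnitNormal (T k).carrier F n) ∧
    ∀ n, IsOutwardUnitNormal (T k).carrier F n →
      -- the first identity
      (∀ s : ℝ, 3 / 2 < s → ∀ v, MemHs (T k).carrier s v →
        ∀ Dv : Fin (m + 1) → Euc (m + 1) → ℝ,
        (∀ i, HasWeakPartial (T k).carrier i v (Dv i)) →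
        (∃ g, HasTrace (T k).carrier F v g) ∧
        (∃ G, HasVectorTrace (T k).carrier F Dv G) ∧
        ∀ g G, HasTrace (T k).carrier F v g → HasVectorTrace (T k).carrier F Dv G →
          (∃ W, HasTangentialGradient F n g W) ∧
          ∀ W, HasTangentialGradient F n g W →
            ∀ᵐ x ∂(surf F), G x = W x + normalDeriv n G x • n x) ∧
      -- the mean curvature of the face is defined, and the second identity holds
      (∃ H, IsMeanCurvature F n H) ∧
      ∀ H, IsMeanCurvature F n H →
        ∀ s : ℝ, 5 / 2 < s → ∀ v, MemHs (T k).carrier s v →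
        ∀ (Dv : Fin (m + 1) → Euc (m + 1) → ℝ)
          (D2v : Fin (m + 1) → Fin (m + 1) → Euc (m + 1) → ℝ),
        (∀ i, HasWeakPartial (T k).carrier i v (Dv i)) →
        (∀ i j, HasWeakPartial (T k).carrier j (Dv i) (D2v i j)) →
        (∃ g, HasTrace (T k).carrier F v g) ∧
        (∃ G, HasVectorTrace (T k).carrier F Dv G) ∧
        (∃ Q : Fin (m + 1) → Euc (m + 1) → Euc (m + 1),
          ∀ i, HasVectorTrace (T k).carrier F (D2v i) (Q i)) ∧
        (∃ L, HasTrace (T k).carrier F (fun x => ∑ i, D2v i i x) L) ∧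
        ∀ g G (Q : Fin (m + 1) → Euc (m + 1) → Euc (m + 1)) L,
          HasTrace (T k).carrier F v g → HasVectorTrace (T k).carrier F Dv G →
          (∀ i, HasVectorTrace (T k).carrier F (D2v i) (Q i)) →
          HasTrace (T k).carrier F (fun x => ∑ i, D2v i i x) L →
          (∃ W, HasTangentialGradient F n g W) ∧
          ∀ W, HasTangentialGradient F n g W →
            (∃ h, HasTangentialDivergence F n W h) ∧
            ∀ h, HasTangentialDivergence F n W h →
              ∀ᵐ x ∂(surf F), L x = h x + H x * normalDeriv n G x + secondNormalDeriv n Q x := by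
  obtain ⟨f, A, C, S, O, O', ν, c, κ, L, hR⟩ := hF.isFacetPiece.exists_regularFace
  obtain ⟨X, U, κ', L', hX⟩ := hR.exists_globalChart
  have hTF := hR.isTraceFace
  have hKo := hTF.domain.isOpen
  have hKm := hKo.measurableSet
  have hFm := hTF.measurableSet
  refine ⟨?_, fun n hn => ?_⟩
  · rw [hR.domain_eq, hR.face_eq]
    exact hR.map.exists_isOutwardUnitNormal hR.flat O'
  have hn1 : ∀ x ∈ F, ‖n x‖ = 1 := fun x hx => (hn x hx).1
  have hnt : ∀ x ∈ F, ∀ t ∈ tangentConeAt ℝ F x, inner ℝ (n x) t = 0 := fun x hx => (hn x hx).2.1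
  -- the tangential part of the trace of a gradient is the tangential gradient of the trace
  have htan : ∀ {v Dv g G}, HasTrace (T k).carrier F v g → HasVectorTrace (T k).carrier F Dv G →
      (∀ i, HasWeakPartial (T k).carrier i v (Dv i)) →
      HasTangentialGradient F n g (fun x => G x - (inner ℝ (n x) (G x) : ℝ) • n x) :=
    fun hg hG hw => (hg.hasChartGradient hTF hG hw).hasTangentialGradient hFm hn1 hnt
  refine ⟨fun s hs v hv Dv hDv => ?_, hF.exists_isMeanCurvature hΩ hT hn,
    fun H hH s hs v hv Dv D2v hDv hD2v => ?_⟩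
  -- after one derivative the order is `j + fract s`, which exceeds `1 / 2` as `s > 3 / 2`
  · obtain ⟨j, hj⟩ : ∃ j, ⌊s⌋₊ = j + 1 :=
      Nat.exists_eq_succ_of_ne_zero (Nat.floor_pos.2 (by linarith)).ne'
    rw [MemHs, hj] at hv
    have hj' : 1 ≤ j ∨ 1 / 2 < Int.fract s := by
      rcases Nat.eq_zero_or_pos j with rfl | h
      · right
        have h1 := natCast_floor_eq_intCast_floor (a := s) (by linarith)
        rw [hj] at h1
        rw [Int.fract, ← h1]
        push_cast
        linarith
      · exact Or.inl h
    refine ⟨hv.exists_trace hR (Int.fract_lt_one s) (Or.inl (by omega)),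
      exists_vectorTrace fun i => (hv.hasWeakPartial hKo (hDv i)).exists_trace hR
        (Int.fract_lt_one s) hj', fun g G hg hG => ⟨⟨_, htan hg hG hDv⟩, fun W hW => ?_⟩⟩
    filter_upwards [hW.unique hX hn1 hnt (htan hg hG hDv)] with x hx
    rw [hx, normalDeriv, sub_add_cancel]
  -- after two derivatives the order is `j + fract s`, which exceeds `1 / 2` as `s > 5 / 2`
  · obtain ⟨j, hj⟩ : ∃ j, ⌊s⌋₊ = j + 2 := by
      have h1 : 2 ≤ ⌊s⌋₊ := Nat.le_floor (by push_cast; linarith)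
      exact ⟨⌊s⌋₊ - 2, by omega⟩
    rw [MemHs, hj] at hv
    have hj' : 1 ≤ j ∨ 1 / 2 < Int.fract s := by
      rcases Nat.eq_zero_or_pos j with rfl | h
      · right
        have h1 := natCast_floor_eq_intCast_floor (a := s) (by linarith)
        rw [hj] at h1
        rw [Int.fract, ← h1]
        push_cast
        linarith
      · exact Or.inl h
    have hv1 := fun i => hv.hasWeakPartial hKo (hDv i)
    have hv2 := fun i l => ((hv1 i).hasWeakPartial hKo (hD2v i l)).exists_trace hR
      (Int.fract_lt_one s) hj'
    choose q hq using fun i => hv2 i i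
    refine ⟨hv.exists_trace hR (Int.fract_lt_one s) (Or.inl (by omega)),
      exists_vectorTrace fun i => (hv1 i).exists_trace hR (Int.fract_lt_one s) (Or.inl (by omega)),
      ?_, ⟨_, HasTrace.sum hTF.domain.isBounded hKm Finset.univ hq⟩,
      fun g G Q L hg hG hQ hL => ⟨⟨_, htan hg hG hDv⟩, fun W hW => ?_⟩⟩
    · choose Q hQ using fun i => exists_vectorTrace (hv2 i)
      exact ⟨Q, hQ⟩
    have hWG := hW.unique hX hn1 hnt (htan hg hG hDv)
    -- the components of the tangential part `G - ⟪N, G⟫ N` have chart gradients by the Leibniz rule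
    obtain ⟨V, N, hV, hFV, hN, hN1, hNn, hHN⟩ := hH
    have hB := HasChartGradient.tangentialPart hFm hV hFV hN hNn
      fun i => (hG i).hasChartGradient hTF (hQ i) (hD2v i)
    -- the tangential gradients of the components of `W`
    have hWj := fun i => ((hB i).hasTangentialGradient hFm hn1 hnt).congr_ae
      (u' := fun x => W x i) (by
        filter_upwards [hWG] with x hx
        rw [hx])
    refine ⟨⟨_, hW.1, _, hWj, ae_of_all _ fun _ => rfl⟩, ?_⟩
    rintro h ⟨-, A', hA', hh⟩
    -- the trace of the Laplacian is the sum of the traces of the pure second derivatives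
    have hLQ := hL.unique hTF (HasTrace.sum hTF.domain.isBounded hKm Finset.univ fun i => hQ i i)
    filter_upwards [hLQ, hh, ae_all_iff.2 fun i => (hA' i).unique hX hn1 hnt (hWj i),
      mem_of_ae_surf hFm] with x hxL hxh hxA hxF
    rw [hxL, hxh, hHN x hxF, sum_trace_eq (G := G) (Q := Q) hV hFV hN hN1 hNn hxF fun i => rfl]
    simp only [hxA]
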